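/- Let $a_s(u,x)\in\mathbb R^l$ and $b_s(u,x)\in\mathbb R^{l\times k}$, for $s\ge 0$, $u\in\mathbb R^n$, $x\in\mathbb R^l$, be jointly measurable (time carrying the Lebesgue $\sigma$-algebra), and put $c_s(u,x)=b_s(u,x)b_s(u,x)^T$. "Locally in $(s,u)$" means for $s\in[0,T]$, $|u|\le N$, for all $T,N>0$; suprema in time are essential suprema. Suppose that $b_s(u,x)$ is bounded locally in $(s,u)$ and globally in $x$; that $a_s(u,x)$ is locally bounded in $(s,u,x)$ and Lipschitz continuous in $x$ locally uniformly in $(s,u)$; that $c_s(u,x)$ is of class $C^1$ in $x$, its first partial derivatives in $x$ being bounded and Lipschitz continuous in $x$ locally uniformly in $(s,u)$; and that $c_s(u,x)$ is positive definite uniformly in $x$ and locally uniformly in $(s,u)$. Let $t>0$, $L_1>0$ and $N\in\mathbb R$. Then there is a constant $L_2>0$, which depends only on $L_1$, $t$, $N$ and the functions $a,b$, such that the following holds. Let $X:[0,\infty)\to\mathbb R^n$ be continuous with $|X_s|\le N$ for all $s\in[0,t]$, and let $m_s(x)\ge0$, $s\ge0$, $x\in\mathbb R^l$, be a measurable function that,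 for almost every $s$, is a probability density on $\mathbb R^l$ and an element of $W^{1,1}_{\rm loc}(\mathbb R^l)$ in $x$. Let $Dm_s(x)$ be a jointly measurable version of its weak gradient in $x$. If $$\int_0^t\int_S\frac{|Dm_s(x)|^2}{m_s(x)}\,dx\,ds<\infty\quad\text{for all open balls } S\subset\mathbb R^l$$ and $$\int_0^t\ \sup_{h\in C^1_0(\mathbb R^l)}\int_{\mathbb R^l}\Big(Dh(x)^T\big(\tfrac12\,\mathrm{div}(c_s(X_s,x)m_s(x))-a_s(X_s,x)m_s(x)\big)-\tfrac12\,Dh(x)^Tc_s(X_s,x)Dh(x)\,m_s(x)\Big)dx\,ds\le L_1,$$ then $$\int_0^t\int_{\mathbb R^l}\frac{|Dm_s(x)|^2}{m_s(x)}\,dx\,ds\le L_2 .$$ Here $C^1_0(\mathbb R^l)$ is the set of continuously differentiable functions of compact support, $\mathrm{div}$ of a matrix function is the weak divergence in $x$, taken row by row, and $0/0=0$. -/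

import Mathlib

open MeasureTheory Set
open scoped NNReal ENNReal Gradient Matrix

namespace FastDiffusion

/-- `ℝᵈ` with the Euclidean norm. -/
abbrev Eu (d : ℕ) : Type := EuclideanSpace ℝ (Fin d)

/-- `g` is the weak gradient of `f` on `ℝᵈ`, where `f` and `g` are locally integrable. The integration
by parts formula is required for the `C¹` test functions of compact support; by mollification, this
is the same as requiring it for the `C^∞` ones. Thus `f ∈ W^{1,1}_loc(ℝᵈ)` iff such a `g` exists, and
`g` is then unique almost everywhere. -/
structure HasWeakGradient {d : ℕ} (f : Eu d → ℝ) (g : Eu d → Eu d) : Prop where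
  locallyIntegrable : LocallyIntegrable f
  locallyIntegrable_grad : LocallyIntegrable g
  integral_eq : ∀ φ : Eu d → ℝ, ContDiff ℝ 1 φ → HasCompactSupport φ →
    ∀ i : Fin d, ∫ x, f x * (∇ φ x) i = - ∫ x, φ x * g x i

/-- `g` is the weak divergence of the matrix-valued function `F` on `ℝᵈ`, taken rowwise:
`g_i = ∑ⱼ ∂ⱼ F_{ij}`, where the entries of `F` and `g` are locally integrable. -/
structure HasWeakDivergence {d : ℕ} (F : Eu d → Matrix (Fin d) (Fin d) ℝ) (g : Eu d → Eu d) :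
    Prop where
  locallyIntegrable : ∀ i j : Fin d, LocallyIntegrable (fun x => F x i j)
  locallyIntegrable_div : LocallyIntegrable g
  integral_eq : ∀ φ : Eu d → ℝ, ContDiff ℝ 1 φ → HasCompactSupport φ →
    ∀ i : Fin d, ∫ x, ∑ j, F x i j * (∇ φ x) j = - ∫ x, φ x * g x i

/-- `‖v‖²_Δ = vᵀ Δ v`. -/
def quadForm {d : ℕ} (Δ : Matrix (Fin d) (Fin d) ℝ) (v : Eu d) : ℝ :=
  ∑ i, ∑ j, v i * Δ i j * v j

/-- The diffusion matrix `c_s(u,x) = b_s(u,x) b_s(u,x)ᵀ`. -/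
def diffusionMatrix {n k l : ℕ} (b : ℝ → Eu n → Eu l → Matrix (Fin l) (Fin k) ℝ)
    (s : ℝ) (u : Eu n) (x : Eu l) : Matrix (Fin l) (Fin l) ℝ :=
  b s u x * (b s u x)ᵀ

/-- Regularity of the coefficients `a_s(u,x)`, `b_s(u,x)` of the fast diffusion, for `s ≥ 0` (values at
negative `s` are immaterial). Time carries the Lebesgue (completed) σ-algebra, and suprema in time
are essential suprema. "Locally in `(s,u)`" means: for `s ≤ T` and `|u| ≤ N`, for all `T`, `N`. -/
structure RegularCoefficients {n k l : ℕ} (a : ℝ → Eu n → Eu l → Eu l)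
    (b : ℝ → Eu n → Eu l → Matrix (Fin l) (Fin k) ℝ) : Prop where
  /-- `a` is jointly measurable. -/
  measurable_a :
    Measurable (fun p : NullMeasurableSpace ℝ (volume : Measure ℝ) × Eu n × Eu l =>
      a p.1 p.2.1 p.2.2)
  /-- `b` is jointly measurable. -/
  measurable_b : ∀ i j,
    Measurable (fun p : NullMeasurableSpace ℝ (volume : Measure ℝ) × Eu n × Eu l =>
      b p.1 p.2.1 p.2.2 i j)
  /-- `b` is bounded, locally in `(s,u)` and globally in `x`. -/
  bounded_b : ∀ T N : ℝ, ∃ K : ℝ, ∀ᵐ s : ℝ, 0 ≤ s → s ≤ T → ∀ u : Eu n, ‖u‖ ≤ N →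
    ∀ x i j, |b s u x i j| ≤ K
  /-- `a` is locally bounded in `(s,u,x)`. -/
  bounded_a : ∀ T N R : ℝ, ∃ K : ℝ, ∀ᵐ s : ℝ, 0 ≤ s → s ≤ T → ∀ u : Eu n, ‖u‖ ≤ N →
    ∀ x : Eu l, ‖x‖ ≤ R → ‖a s u x‖ ≤ K
  /-- `a` is Lipschitz continuous in `x` locally uniformly in `(s,u)`. -/
  lipschitz_a : ∀ T N : ℝ, ∃ K : ℝ≥0, ∀ᵐ s : ℝ, 0 ≤ s → s ≤ T → ∀ u : Eu n, ‖u‖ ≤ N →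
    LipschitzWith K (a s u)
  /-- `c = b bᵀ` is of class `C¹` in `x`. -/
  contDiff_c : ∀ s : ℝ, 0 ≤ s → ∀ (u : Eu n) (i j : Fin l),
    ContDiff ℝ 1 (fun x => diffusionMatrix b s u x i j)
  /-- The first partial derivatives of `c` in `x` are bounded and Lipschitz continuous in `x`, locally
  uniformly in `(s,u)`. -/
  deriv_c : ∀ T N : ℝ, ∃ K : ℝ≥0, ∀ᵐ s : ℝ, 0 ≤ s → s ≤ T → ∀ u : Eu n, ‖u‖ ≤ N →
    ∀ i j : Fin l, (∀ x, ‖∇ (fun y => diffusionMatrix b s u y i j) x‖ ≤ K) ∧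
      LipschitzWith K (∇ (fun y => diffusionMatrix b s u y i j))
  /-- `c` is positive definite uniformly in `x` and locally uniformly in `(s,u)`. -/
  elliptic_c : ∀ T N : ℝ, ∃ κ : ℝ, 0 < κ ∧ ∀ᵐ s : ℝ, 0 ≤ s → s ≤ T → ∀ u : Eu n, ‖u‖ ≤ N →
    ∀ (x v : Eu l), κ * ‖v‖ ^ 2 ≤ quadForm (diffusionMatrix b s u x) v

/-- `∫ (Dh(x)ᵀ (½ div(A m)(x) - α(x) m(x)) - ½ ‖Dh(x)‖²_{A(x)} m(x)) dx`, where `divAm` stands for the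
weak divergence of the matrix function `A m`. -/
noncomputable def fastFunctional {d : ℕ} (A : Eu d → Matrix (Fin d) (Fin d) ℝ) (α : Eu d → Eu d)
    (m : Eu d → ℝ≥0) (divAm : Eu d → Eu d) (h : Eu d → ℝ) : ℝ :=
  ∫ x, (inner ℝ (∇ h x) ((1 / 2 : ℝ) • divAm x - (m x : ℝ) • α x)
    - 1 / 2 * quadForm (A x) (∇ h x) * (m x : ℝ))

/-- The supremum of `fastFunctional` over the `C¹` functions `h` of compact support, in `[0,∞]`. Taking
`h = 0` shows that the supremum is nonnegative, so it is not affected by `ENNReal.ofReal`. -/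
noncomputable def fastRate {d : ℕ} (A : Eu d → Matrix (Fin d) (Fin d) ℝ) (α : Eu d → Eu d)
    (m : Eu d → ℝ≥0) (divAm : Eu d → Eu d) : ℝ≥0∞ :=
  ⨆ h : {h : Eu d → ℝ // ContDiff ℝ 1 h ∧ HasCompactSupport h},
    ENNReal.ofReal (fastFunctional A α m divAm h.1)

/-- `|Dm(x)|² / m(x)` in `[0,∞]`, with `0 / 0 = 0`. -/
noncomputable def fisherDensity {d : ℕ} (m : Eu d → ℝ≥0) (Dm : Eu d → Eu d) (x : Eu d) : ℝ≥0∞ :=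
  ‖Dm x‖ₑ ^ 2 / (m x : ℝ≥0∞)

end FastDiffusion

/-!
The estimate holds at each time separately, and is then integrated over `[0, t]`. At a fixed time write
`A` for the diffusion matrix, `α` for the drift, `q = Dm / m` for the score, and `μ` for the probability
measure with density `m`. Since `½ div (A m) - α m = m β` with `β = ½ div A + ½ A q - α` (`rateField`), the
rate is the supremum over test functions `h` of `∫ (⟨Dh, β⟩ - ½ ⟨Dh, A Dh⟩) dμ`. Formally, take
`h = c log m`, so that `Dh = c q`. Ellipticity gives `∫ ⟨q, ½ A q⟩ dμ ≥ ½ κ ∫ |q|² dμ`. The term with `div A`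
is absorbed, because `div A` is bounded, and the quadratic term is absorbed by a small `c`. The drift,
which may grow linearly, contributes `∫ ⟨q, α⟩ dμ = ∫ ⟨Dm, α⟩ = - ∫ m div α`; this is bounded by a multiple
of the Lipschitz constant because `m` has mass one. The Fisher information `∫ |q|² dμ` is therefore at
most a multiple of the rate plus a constant.

To make `log m` admissible, the logarithm is truncated (`truncLog`) and multiplied by a cutoff at scale
`R` (`stdBump`); this gives `testField`. The cutoff costs terms of order `1 / R`, a multiple of the mass
that `μ` gives to `{R ≤ |x|}`, because `|Dφ(x)| (1 + |x|)` is bounded (`norm_gradient_stdBump_mul_le`), and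
the term `∫ truncLog(m) ⟨Dφ, A q⟩ dμ`, in which a second integration by parts removes the score
(`abs_integral_truncLog_mul_inner_le`). All of them vanish as `R → ∞` for a fixed truncation.

The truncated logarithm of `m` is not of class `C¹`. That `testField` is nevertheless a limit of gradients
of test functions, weakly in `L²(μ)`, is the main technical point, as `μ` is a weighted measure and
mollification need not be bounded on `L²(μ)`. The mollifications of `truncLog δ m` have gradients that are
bounded in `L²(μ)` (`exists_bound_lintegral_gradient_mollify_truncLog`), for two reasons: `√m` times an
increment of `truncLog δ m` is dominated by an increment of `√(m + δ)`, and the latter function lies in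
`W^{1,2}` locally by the local finiteness of the Fisher information. Together with almost everywhere
convergence, this yields weak convergence. As the closed span of the gradients of test functions is weakly
closed, the quadratic bound extends to `testField` (`integral_inner_sub_le_of_ae_tendsto`).
-/

open Filter Topology Convolution

namespace FastDiffusion

/-! ### Gradients, cutoff functions and mollifiers -/

lemma gradient_coord {d : ℕ} (h : Eu d → ℝ) (x : Eu d) (i : Fin d) :
    (∇ h x) i = fderiv ℝ h x (EuclideanSpace.single i 1) := by
  rw [← inner_gradient_left, EuclideanSpace.inner_single_right]; simp

lemma norm_gradient_eq {d : ℕ} (h : Eu d → ℝ) (x : Eu d) : ‖∇ h x‖ = ‖fderiv ℝ h x‖ := by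
  simp [gradient]

lemma continuous_gradient {d : ℕ} {h : Eu d → ℝ} (hh : ContDiff ℝ 1 h) : Continuous (∇ h) :=
  (InnerProductSpace.toDual ℝ (Eu d)).symm.continuous.comp (hh.continuous_fderiv one_ne_zero)

lemma tsupport_gradient_subset {d : ℕ} (h : Eu d → ℝ) : tsupport (∇ h) ⊆ tsupport h := by
  refine closure_minimal (fun x hx => ?_) (isClosed_tsupport h)
  refine support_fderiv_subset ℝ (f := h) ?_
  intro h0
  apply hx
  simp [gradient, h0]

lemma hasCompactSupport_gradient {d : ℕ} {h : Eu d → ℝ} (hh : HasCompactSupport h) :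
    HasCompactSupport (∇ h) :=
  hh.mono' ((subset_tsupport _).trans (tsupport_gradient_subset h))

lemma gradient_add_apply {d : ℕ} {f g : Eu d → ℝ} {x : Eu d} (hf : DifferentiableAt ℝ f x)
    (hg : DifferentiableAt ℝ g x) : ∇ (fun y => f y + g y) x = ∇ f x + ∇ g x := by
  simp [gradient, fderiv_fun_add hf hg]

lemma gradient_const_mul_apply {d : ℕ} {f : Eu d → ℝ} {x : Eu d} (c : ℝ)
    (hf : DifferentiableAt ℝ f x) : ∇ (fun y => c * f y) x = c • ∇ f x := by
  simp [gradient, fderiv_const_mul hf]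

lemma gradient_mul_apply {d : ℕ} {f g : Eu d → ℝ} {x : Eu d} (hf : DifferentiableAt ℝ f x)
    (hg : DifferentiableAt ℝ g x) :
    ∇ (fun y => f y * g y) x = f x • ∇ g x + g x • ∇ f x := by
  simp [gradient, fderiv_fun_mul hf hg]

/-- The smooth bump function equal to `1` on the ball of radius `r` and supported in the ball of
radius `2 r`. -/
noncomputable def stdBump {d : ℕ} (r : ℝ) (hr : 0 < r) : ContDiffBump (0 : Eu d) :=
  ⟨r, 2 * r, hr, by linarith⟩

/-- All the functions `stdBump r` are rescalings of this one. -/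
noncomputable def bumpProfile (d : ℕ) : Eu d → ℝ := ⇑(stdBump (d := d) 1 one_pos)

lemma stdBump_eq {d : ℕ} (r : ℝ) (hr : 0 < r) :
    ⇑(stdBump (d := d) r hr) = fun x => bumpProfile d (r⁻¹ • x) := by
  ext x
  rw [bumpProfile, ContDiffBump.apply, ContDiffBump.apply]
  simp [stdBump, hr.ne']

lemma contDiff_bumpProfile (d : ℕ) {n : ℕ∞} : ContDiff ℝ n (bumpProfile d) :=
  (stdBump (d := d) 1 one_pos).contDiff

lemma hasCompactSupport_bumpProfile (d : ℕ) : HasCompactSupport (bumpProfile d) :=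
  (stdBump (d := d) 1 one_pos).hasCompactSupport

lemma gradient_comp_smul {d : ℕ} (f : Eu d → ℝ) (c : ℝ) (x : Eu d) :
    ∇ (fun y => f (c • y)) x = c • ∇ f (c • x) := by
  have h : fderiv ℝ (fun y => f (c • y)) x = c • fderiv ℝ f (c • x) := fderiv_comp_smul c
  simp [gradient, h]

lemma exists_bound_gradient_stdBump (d : ℕ) : ∃ C : ℝ, 0 ≤ C ∧ ∀ (r : ℝ) (hr : 0 < r) (x : Eu d),
    ‖∇ (stdBump r hr) x‖ ≤ C / r := by
  have h1 : ContDiff ℝ 1 (bumpProfile d) := contDiff_bumpProfile d (n := 1)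
  obtain ⟨C, hC⟩ := (hasCompactSupport_gradient (hasCompactSupport_bumpProfile d)).exists_bound_of_continuous
    (continuous_gradient h1)
  refine ⟨C, (norm_nonneg _).trans (hC 0), fun r hr x => ?_⟩
  rw [stdBump_eq, gradient_comp_smul, norm_smul, norm_inv,
    Real.norm_of_nonneg hr.le, div_eq_inv_mul]
  gcongr
  exact hC _

lemma contDiff_gradient_coord {d : ℕ} {f : Eu d → ℝ} (hf : ContDiff ℝ 2 f) (i : Fin d) :
    ContDiff ℝ 1 (fun y => (∇ f y) i) := by
  simp_rw [gradient_coord]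
  exact (hf.fderiv_right (m := 1) (by norm_num)).clm_apply contDiff_const

lemma exists_bound_hessian_stdBump (d : ℕ) : ∃ C : ℝ, 0 ≤ C ∧ ∀ (r : ℝ) (hr : 0 < r) (x : Eu d)
    (i j : Fin d), |(∇ (fun y => (∇ (stdBump r hr) y) i) x) j| ≤ C / r ^ 2 := by
  have h2 : ContDiff ℝ 2 (bumpProfile d) := contDiff_bumpProfile d (n := 2)
  have h1 : ContDiff ℝ 1 (bumpProfile d) := contDiff_bumpProfile d (n := 1)
  have hK : ∀ i, ∃ C, ∀ x, ‖∇ (fun y => (∇ (bumpProfile d) y) i) x‖ ≤ C := fun i => by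
    refine HasCompactSupport.exists_bound_of_continuous (hasCompactSupport_gradient ?_)
      (continuous_gradient (contDiff_gradient_coord h2 i))
    exact (hasCompactSupport_gradient (hasCompactSupport_bumpProfile d)).comp_left
      (g := fun v : Eu d => v i) rfl
  choose C hC using hK
  refine ⟨∑ i, |C i|, Finset.sum_nonneg fun _ _ => abs_nonneg _, fun r hr x i j => ?_⟩
  have e : (fun y => (∇ (stdBump r hr) y) i) =
      fun y => r⁻¹ * (fun w => (∇ (bumpProfile d) w) i) (r⁻¹ • y) := by
    ext y
    rw [stdBump_eq, gradient_comp_smul]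
    simp
  have hd : Differentiable ℝ (fun w => (∇ (bumpProfile d) w) i) :=
    (contDiff_gradient_coord h2 i).differentiable one_ne_zero
  rw [e, gradient_const_mul_apply,
    gradient_comp_smul (fun w => (∇ (bumpProfile d) w) i), PiLp.smul_apply, PiLp.smul_apply,
    smul_eq_mul, smul_eq_mul, ← mul_assoc, abs_mul, div_eq_inv_mul]
  · have hr2 : |r⁻¹ * r⁻¹| = (r ^ 2)⁻¹ := by rw [← sq, inv_pow, abs_of_pos (by positivity)]
    rw [hr2]
    gcongr
    calc _ ≤ ‖∇ (fun y => (∇ (bumpProfile d) y) i) (r⁻¹ • x)‖ := by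
          rw [← Real.norm_eq_abs]; exact PiLp.norm_apply_le _ _
      _ ≤ |C i| := (hC i _).trans (le_abs_self _)
      _ ≤ _ := Finset.single_le_sum (f := fun i => |C i|) (fun _ _ => abs_nonneg _) (Finset.mem_univ i)
  · exact (hd.comp (differentiable_id.const_smul (r⁻¹))) x

/-- The radius `1 / (k + 1)` of the support of the mollifier with index `k`. -/
noncomputable def molRadius (k : ℕ) : ℝ := 1 / (k + 1)

lemma molRadius_pos (k : ℕ) : 0 < molRadius k := by unfold molRadius; positivity

lemma molRadius_le_one (k : ℕ) : molRadius k ≤ 1 := by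
  unfold molRadius; rw [div_le_one (by positivity)]; linarith [k.cast_nonneg (α := ℝ)]

/-- The unnormalised bump function behind the mollifier with index `k`. -/
noncomputable def molBump (d k : ℕ) : ContDiffBump (0 : Eu d) :=
  stdBump (molRadius k / 2) (half_pos (molRadius_pos k))

lemma molBump_rOut (d k : ℕ) : (molBump d k).rOut = molRadius k := by
  simp only [molBump, stdBump]; ring

lemma molBump_rIn (d k : ℕ) : (molBump d k).rIn = molRadius k / 2 := rfl

/-- A mollifier: a smooth probability density supported in the ball of radius `1 / (k + 1)`. -/
noncomputable def molKernel (d k : ℕ) : Eu d → ℝ := (molBump d k).normed volume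

/-- The mollification of `f` by `molKernel d k`. -/
noncomputable def mollify {d : ℕ} {E : Type*} [NormedAddCommGroup E] [NormedSpace ℝ E] (k : ℕ)
    (f : Eu d → E) : Eu d → E :=
  molKernel d k ⋆[ContinuousLinearMap.lsmul ℝ ℝ, volume] f

section
variable {d : ℕ} {E : Type*} [NormedAddCommGroup E] [NormedSpace ℝ E]

lemma molKernel_nonneg (d k : ℕ) (x : Eu d) : 0 ≤ molKernel d k x :=
  (molBump d k).nonneg_normed x

lemma contDiff_molKernel (d k : ℕ) {n : ℕ∞} : ContDiff ℝ n (molKernel d k) :=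
  (molBump d k).contDiff_normed

lemma hasCompactSupport_molKernel (d k : ℕ) : HasCompactSupport (molKernel d k) :=
  (molBump d k).hasCompactSupport_normed

lemma integral_molKernel (d k : ℕ) : ∫ x, molKernel d k x = 1 :=
  (molBump d k).integral_normed

lemma integrable_molKernel (d k : ℕ) : Integrable (molKernel d k) :=
  (molBump d k).integrable_normed

lemma lintegral_molKernel (d k : ℕ) : ∫⁻ x, ‖molKernel d k x‖ₑ = 1 := by
  have h := ofReal_integral_eq_lintegral_ofReal (integrable_molKernel d k)
    (ae_of_all _ (molKernel_nonneg d k))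
  rw [integral_molKernel] at h
  simp_rw [Real.enorm_of_nonneg (molKernel_nonneg d k _)]
  rw [← h]; simp

lemma molKernel_eq_zero {k : ℕ} {x : Eu d} (hx : molRadius k < ‖x‖) : molKernel d k x = 0 := by
  by_contra h
  have : x ∈ tsupport (molKernel d k) := subset_tsupport _ h
  rw [molKernel, (molBump d k).tsupport_normed_eq, molBump_rOut] at this
  simp at this; linarith

lemma gradient_molKernel_eq_zero {k : ℕ} {x : Eu d} (hx : molRadius k < ‖x‖) :
    ∇ (molKernel d k) x = 0 := by
  by_contra h
  have : x ∈ tsupport (molKernel d k) := tsupport_gradient_subset _ (subset_tsupport _ h)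
  rw [molKernel, (molBump d k).tsupport_normed_eq, molBump_rOut] at this
  simp at this; linarith

lemma exists_lintegral_gradient_molKernel_le (d : ℕ) : ∃ C : ℝ, 0 ≤ C ∧ ∀ k,
    ∫⁻ x, ‖∇ (molKernel d k) x‖ₑ ≤ ENNReal.ofReal (C / molRadius k) := by
  obtain ⟨C, hC0, hC⟩ := exists_bound_gradient_stdBump d
  refine ⟨C * 2 * 2 ^ d, by positivity, fun k => ?_⟩
  set B := molBump d k
  have hr := molRadius_pos k
  have hI : 0 < ∫ x, B x := B.integral_pos
  have hmeas := B.measure_closedBall_div_le_integral (μ := volume) 2 (by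
    rw [molBump_rOut, molBump_rIn]; linarith)
  have hgrad : ∀ x, ‖∇ (molKernel d k) x‖ₑ ≤ (Metric.closedBall (0 : Eu d) (molRadius k)).indicator
      (fun _ => ENNReal.ofReal ((C / (molRadius k / 2)) / ∫ x, B x)) x := by
    intro x
    by_cases hx : x ∈ Metric.closedBall (0 : Eu d) (molRadius k)
    · rw [indicator_of_mem hx, ← ofReal_norm]
      apply ENNReal.ofReal_le_ofReal
      have e : molKernel d k = fun x => (∫ x, B x)⁻¹ * B x := by
        ext x; rw [molKernel, ContDiffBump.normed_def, div_eq_inv_mul]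
      rw [e, gradient_const_mul_apply _ (B.contDiff.differentiable (n := 1) (by simp) x), norm_smul,
        norm_inv, Real.norm_of_nonneg hI.le, div_eq_inv_mul _ (∫ x, B x)]
      gcongr
      exact hC _ _ _
    · rw [indicator_of_notMem hx, gradient_molKernel_eq_zero (by simpa using hx)]; simp
  refine (lintegral_mono hgrad).trans ?_
  rw [lintegral_indicator_const Metric.isClosed_closedBall.measurableSet]
  rw [← ENNReal.ofReal_toReal (a := volume (Metric.closedBall (0 : Eu d) (molRadius k)))
    measure_closedBall_lt_top.ne, ← ENNReal.ofReal_mul (by positivity)]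
  apply ENNReal.ofReal_le_ofReal
  rw [molBump_rOut, finrank_euclideanSpace_fin, div_le_iff₀ (by positivity)] at hmeas
  change volume.real _ ≤ _ at hmeas
  change _ * volume.real _ ≤ _
  calc _ ≤ (C / (molRadius k / 2)) / (∫ x, B x) * ((∫ x, B x) * 2 ^ d) := by gcongr
    _ = _ := by field_simp

lemma mollify_apply (k : ℕ) (f : Eu d → E) (x : Eu d) :
    mollify k f x = ∫ t, molKernel d k t • f (x - t) := rfl

lemma mollify_apply' (k : ℕ) (f : Eu d → E) (x : Eu d) :
    mollify k f x = ∫ t, molKernel d k (x - t) • f t := by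
  rw [mollify, convolution_eq_swap]; rfl

lemma contDiff_mollify (k : ℕ) {f : Eu d → E} (hf : LocallyIntegrable f) {n : ℕ∞} :
    ContDiff ℝ n (mollify k f) :=
  (hasCompactSupport_molKernel d k).contDiff_convolution_left _ (contDiff_molKernel d k) hf

lemma ae_tendsto_mollify [CompleteSpace E] {f : Eu d → E} (hf : LocallyIntegrable f) :
    ∀ᵐ x, Tendsto (fun k => mollify k f x) atTop (𝓝 (f x)) := by
  refine ContDiffBump.ae_convolution_tendsto_right_of_locallyIntegrable (K := 2)
    (φ := fun k => molBump d k) ?_ ?_ hf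
  · simp_rw [molBump_rOut]
    exact tendsto_one_div_add_atTop_nhds_zero_nat
  · filter_upwards with k
    rw [molBump_rOut, molBump_rIn]; linarith

lemma integrable_mollify_integrand (k : ℕ) {f : Eu d → E} (hf : LocallyIntegrable f) (x : Eu d) :
    Integrable (fun t => molKernel d k t • f (x - t)) :=
  (hasCompactSupport_molKernel d k).convolutionExists_left (ContinuousLinearMap.lsmul ℝ ℝ)
    (contDiff_molKernel d k (n := 0)).continuous hf x

lemma integrable_mollify_integrand' (k : ℕ) {f : Eu d → E} (hf : LocallyIntegrable f) (x : Eu d) :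
    Integrable (fun t => molKernel d k (x - t) • f t) :=
  ((hasCompactSupport_molKernel d k).convolutionExists_left (ContinuousLinearMap.lsmul ℝ ℝ)
    (contDiff_molKernel d k (n := 0)).continuous hf x).integrable_swap

lemma gradient_mollify (k : ℕ) {f : Eu d → ℝ} (hf : LocallyIntegrable f) (x : Eu d) :
    ∇ (mollify k f) x = ∫ t, f (x - t) • ∇ (molKernel d k) t := by
  have h := (hasCompactSupport_molKernel d k).hasFDerivAt_convolution_left
    (ContinuousLinearMap.lsmul ℝ ℝ) (contDiff_molKernel d k (n := 1)) hf x
  have h2 : fderiv ℝ (mollify k f) x = _ := h.fderiv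
  rw [gradient, h2, convolution_def]
  rw [show (InnerProductSpace.toDual ℝ (Eu d)).symm (∫ t, ((ContinuousLinearMap.lsmul ℝ ℝ).precompL (Eu d)) (fderiv ℝ (molKernel d k) t) (f (x - t)))
    = (InnerProductSpace.toDual ℝ (Eu d)).symm.toContinuousLinearEquiv (∫ t, ((ContinuousLinearMap.lsmul ℝ ℝ).precompL (Eu d)) (fderiv ℝ (molKernel d k) t) (f (x - t))) from rfl]
  rw [← ContinuousLinearEquiv.integral_comp_comm]
  refine integral_congr_ae (ae_of_all _ fun t => ?_)
  change (InnerProductSpace.toDual ℝ (Eu d)).symm _ =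
    f (x - t) • (InnerProductSpace.toDual ℝ (Eu d)).symm _
  rw [← map_smul]
  congr 1
  ext v
  simp [mul_comm]

end

/-! ### Mollification and weak gradients -/

/-- A dominated convergence theorem with varying dominating functions `G k`. -/
lemma tendsto_integral_of_varying_dominated {α : Type*} {mα : MeasurableSpace α} {μ : Measure α}
    {F : ℕ → α → ℝ} {f : α → ℝ} {G : ℕ → α → ℝ≥0∞} {g : α → ℝ≥0∞}
    (hF : ∀ k, AEStronglyMeasurable (F k) μ) (hG : ∀ k, AEMeasurable (G k) μ)
    (hdom : ∀ k, ∀ᵐ x ∂μ, ‖F k x‖ₑ ≤ G k x)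
    (hFf : ∀ᵐ x ∂μ, Tendsto (fun k => F k x) atTop (𝓝 (f x)))
    (hGg : ∀ᵐ x ∂μ, Tendsto (fun k => G k x) atTop (𝓝 (g x)))
    (hint : ∀ k, ∫⁻ x, G k x ∂μ ≤ ∫⁻ x, g x ∂μ) (hfin : ∫⁻ x, g x ∂μ ≠ ∞) :
    Tendsto (fun k => ∫ x, F k x ∂μ) atTop (𝓝 (∫ x, f x ∂μ)) := by
  have hf : AEStronglyMeasurable f μ := aestronglyMeasurable_of_tendsto_ae atTop hF hFf
  have hg : AEMeasurable g μ := aemeasurable_of_tendsto_metrizable_ae atTop hG hGg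
  have hfg : ∀ᵐ x ∂μ, ‖f x‖ₑ ≤ g x := by
    filter_upwards [hFf, hGg, ae_all_iff.2 hdom] with x h1 h2 h3
    exact le_of_tendsto_of_tendsto' h1.enorm h2 h3
  have hint' : ∀ k, Integrable (F k) μ := fun k => ⟨hF k, by
    exact lt_of_le_of_lt ((lintegral_mono_ae (hdom k)).trans (hint k)) hfin.lt_top⟩
  have hfint : Integrable f μ := ⟨hf, lt_of_le_of_lt (lintegral_mono_ae hfg) hfin.lt_top⟩
  refine tendsto_integral_of_L1 f hf (Eventually.of_forall hint') ?_
  set I := ∫⁻ x, g x ∂μ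
  have hle : ∀ k, ∀ᵐ x ∂μ, ‖F k x - f x‖ₑ ≤ G k x + g x := fun k => by
    filter_upwards [hdom k, hfg] with x h1 h2
    exact (enorm_sub_le).trans (add_le_add h1 h2)
  have hsum : ∀ k, ∫⁻ x, G k x + g x ∂μ ≤ I + I := fun k => by
    rw [lintegral_add_right' _ hg]; exact add_le_add (hint k) le_rfl
  have hmeas : ∀ k, AEMeasurable (fun x => ‖F k x - f x‖ₑ) μ := fun k => ((hF k).sub hf).enorm
  have hle' : ∀ k, ∫⁻ x, ‖F k x - f x‖ₑ ∂μ ≤ I + I := fun k =>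
    (lintegral_mono_ae (hle k)).trans (hsum k)
  have hII : I + I ≠ ∞ := ENNReal.add_ne_top.2 ⟨hfin, hfin⟩
  -- Fatou's lemma for the nonnegative functions `G k + g - |F k - f|`
  have hfatou : I + I ≤ liminf (fun k => (I + I) - ∫⁻ x, ‖F k x - f x‖ₑ ∂μ) atTop := by
    calc I + I = ∫⁻ x, g x + g x ∂μ := by rw [lintegral_add_right' _ hg]
      _ = ∫⁻ x, liminf (fun k => G k x + g x - ‖F k x - f x‖ₑ) atTop ∂μ := by
        refine lintegral_congr_ae ?_
        filter_upwards [hFf, hGg] with x h1 h2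
        have h3 : Tendsto (fun k => ‖F k x - f x‖ₑ) atTop (𝓝 0) := by
          have := (h1.sub_const (f x)).enorm
          simpa using this
        have h4 := ENNReal.Tendsto.sub (h2.add_const (g x)) h3 (Or.inr ENNReal.zero_ne_top)
        rw [tsub_zero] at h4
        exact h4.liminf_eq.symm
      _ ≤ liminf (fun k => ∫⁻ x, G k x + g x - ‖F k x - f x‖ₑ ∂μ) atTop :=
        lintegral_liminf_le' fun k => ((hG k).add hg).sub (hmeas k)
      _ ≤ _ := by
        refine liminf_le_liminf (Eventually.of_forall fun k => ?_)
        rw [lintegral_sub' (hmeas k) (ne_top_of_le_ne_top hII (hle' k)) (hle k)]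
        exact tsub_le_tsub_right (hsum k) _
  rw [ENNReal.tendsto_nhds_zero]
  intro ε hε
  rcases eq_or_ne (I + I) 0 with h0 | h0
  · exact Eventually.of_forall fun k => ((hle' k).trans h0.le).trans zero_le
  have hlt : I + I - ε < liminf (fun k => (I + I) - ∫⁻ x, ‖F k x - f x‖ₑ ∂μ) atTop :=
    lt_of_lt_of_le (ENNReal.sub_lt_self hII h0 hε.ne') hfatou
  filter_upwards [eventually_lt_of_lt_liminf hlt] with k hk
  by_contra hcon
  exact absurd hk (not_lt.2 (tsub_le_tsub_left (not_le.1 hcon).le _))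

section
variable {d : ℕ} {E : Type*} [NormedAddCommGroup E]

lemma locallyIntegrable_norm {f : Eu d → E} (hf : LocallyIntegrable f) :
    LocallyIntegrable (fun x => ‖f x‖) :=
  hf.mono hf.aestronglyMeasurable.norm (ae_of_all _ fun x => by simp)

lemma integrable_indicator_of_locallyIntegrable {f : Eu d → E} (hf : LocallyIntegrable f) (R : ℝ) :
    Integrable ((Metric.closedBall (0 : Eu d) R).indicator f) :=
  (hf.integrableOn_isCompact (isCompact_closedBall _ _)).integrable_indicator
    Metric.isClosed_closedBall.measurableSet

variable [NormedSpace ℝ E]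

lemma norm_mollify_le (k : ℕ) (f : Eu d → E) (x : Eu d) :
    ‖mollify k f x‖ ≤ mollify k (fun y => ‖f y‖) x := by
  rw [mollify_apply, mollify_apply]
  refine (norm_integral_le_integral_norm _).trans_eq ?_
  congr 1; ext t
  rw [norm_smul, Real.norm_of_nonneg (molKernel_nonneg d k t), smul_eq_mul]

lemma mollify_nonneg (k : ℕ) {f : Eu d → ℝ} (hf : ∀ x, 0 ≤ f x) (x : Eu d) :
    0 ≤ mollify k f x := by
  rw [mollify_apply]
  exact integral_nonneg fun t => mul_nonneg (molKernel_nonneg d k t) (hf _)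

lemma mollify_congr_ball {k : ℕ} {f g : Eu d → E} {R : ℝ} {x : Eu d} (hx : ‖x‖ ≤ R)
    (h : ∀ y, ‖y‖ ≤ R + 1 → f y = g y) : mollify k f x = mollify k g x := by
  rw [mollify_apply, mollify_apply]
  congr 1; ext t
  by_cases ht : molRadius k < ‖t‖
  · simp [molKernel_eq_zero ht]
  · rw [h]
    calc ‖x - t‖ ≤ ‖x‖ + ‖t‖ := norm_sub_le _ _
      _ ≤ R + 1 := add_le_add hx ((not_lt.1 ht).trans (molRadius_le_one k))

lemma lintegral_ofReal_mollify (k : ℕ) {u : Eu d → ℝ} (hu : Integrable u) (hu0 : ∀ x, 0 ≤ u x) :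
    ∫⁻ x, ENNReal.ofReal (mollify k u x) = ∫⁻ x, ENNReal.ofReal (u x) := by
  have hi : Integrable (mollify k u) :=
    (integrable_molKernel d k).integrable_convolution (ContinuousLinearMap.lsmul ℝ ℝ) hu
  rw [← ofReal_integral_eq_lintegral_ofReal hi (ae_of_all _ (mollify_nonneg k hu0)),
    ← ofReal_integral_eq_lintegral_ofReal hu (ae_of_all _ hu0)]
  congr 1
  have := integral_convolution (ContinuousLinearMap.lsmul ℝ ℝ : ℝ →L[ℝ] ℝ →L[ℝ] ℝ)
    (integrable_molKernel d k) hu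
  rw [mollify, this, integral_molKernel]; simp

/-- Functions `F k` that are supported in a fixed ball and dominated by mollifications of a locally
integrable function may be integrated in the limit. -/
lemma tendsto_integral_of_mollify_dominated {d : ℕ} {E : Type*} [NormedAddCommGroup E]
    {F : ℕ → Eu d → ℝ} {F' : Eu d → ℝ} {f : Eu d → E}
    (hf : LocallyIntegrable f) {R C : ℝ} (hC : 0 ≤ C) (hF : ∀ k, AEStronglyMeasurable (F k))
    (hdom : ∀ k x, ‖x‖ ≤ R → ‖F k x‖ ≤ C * mollify k (fun y => ‖f y‖) x)
    (hzero : ∀ k x, R < ‖x‖ → F k x = 0)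
    (hFF : ∀ᵐ x, Tendsto (fun k => F k x) atTop (𝓝 (F' x))) :
    Tendsto (fun k => ∫ x, F k x) atTop (𝓝 (∫ x, F' x)) := by
  set u : Eu d → ℝ := fun x => C * (Metric.closedBall (0 : Eu d) (R + 1)).indicator (fun y => ‖f y‖) x
  have hu : Integrable u := (integrable_indicator_of_locallyIntegrable (locallyIntegrable_norm hf) (R + 1)).const_mul C
  have hu0 : ∀ x, 0 ≤ u x := fun x => mul_nonneg hC (indicator_nonneg (fun _ _ => norm_nonneg _) _)
  refine tendsto_integral_of_varying_dominated (G := fun k x => ENNReal.ofReal (mollify k u x))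
    (g := fun x => ENNReal.ofReal (u x)) hF ?_ ?_ hFF ?_ ?_ ?_
  · intro k
    exact ((contDiff_mollify k hu.locallyIntegrable (n := 0)).continuous.measurable.ennreal_ofReal).aemeasurable
  · refine fun k => ae_of_all _ fun x => ?_
    rw [← ofReal_norm]
    apply ENNReal.ofReal_le_ofReal
    by_cases hx : R < ‖x‖
    · rw [hzero k x hx, norm_zero]; exact mollify_nonneg k hu0 x
    · refine (hdom k x (not_lt.1 hx)).trans_eq ?_
      have e : mollify k u x = mollify k (fun y => C * ‖f y‖) x := by
        refine mollify_congr_ball (not_lt.1 hx) fun y hy => ?_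
        simp only [u]
        rw [indicator_of_mem (by simpa using hy)]
      rw [e, mollify_apply, mollify_apply, ← integral_const_mul]
      congr 1; ext t; simp only [smul_eq_mul]; ring
  · filter_upwards [ae_tendsto_mollify hu.locallyIntegrable] with x hx
    exact ENNReal.tendsto_ofReal hx
  · exact fun k => (lintegral_ofReal_mollify k hu hu0).le
  · rw [← ofReal_integral_eq_lintegral_ofReal hu (ae_of_all _ hu0)]
    exact ENNReal.ofReal_ne_top

end

lemma integral_coord {d : ℕ} {α : Type*} {mα : MeasurableSpace α} {μ : Measure α} {f : α → Eu d}
    (hf : Integrable f μ) (i : Fin d) : (∫ x, f x ∂μ) i = ∫ x, f x i ∂μ :=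
  ((EuclideanSpace.proj (𝕜 := ℝ) i).integral_comp_comm hf).symm

lemma LocallyIntegrable.coord {d : ℕ} {g : Eu d → Eu d} (hg : LocallyIntegrable g) (i : Fin d) :
    LocallyIntegrable (fun x => g x i) := fun x => by
  obtain ⟨U, hU, h⟩ := hg x
  exact ⟨U, hU, (EuclideanSpace.proj (𝕜 := ℝ) i).integrable_comp h⟩

lemma integrable_mul_of_locallyIntegrable {d : ℕ} {f ψ : Eu d → ℝ} (hf : LocallyIntegrable f)
    (hψ : Continuous ψ) (hψc : HasCompactSupport ψ) : Integrable (fun x => f x * ψ x) := by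
  have := hf.integrable_smul_left_of_hasCompactSupport hψ hψc
  simpa [mul_comm] using this

/-- Mollification commutes with weak differentiation. -/
lemma gradient_mollify_of_hasWeakGradient {d : ℕ} {f : Eu d → ℝ} {g : Eu d → Eu d}
    (h : HasWeakGradient f g) (k : ℕ) (x : Eu d) : ∇ (mollify k f) x = mollify k g x := by
  have hK := contDiff_molKernel d k (n := 1)
  have hK' : ContDiff ℝ 1 (fun y => molKernel d k (x - y)) := hK.comp (contDiff_const.sub contDiff_id)
  have hKc : HasCompactSupport (fun y => molKernel d k (x - y)) :=
    (hasCompactSupport_molKernel d k).comp_homeomorph (Homeomorph.subLeft x)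
  have hgrad : ∀ y, ∇ (fun y => molKernel d k (x - y)) y = - ∇ (molKernel d k) (x - y) := by
    intro y
    have : fderiv ℝ (fun y => molKernel d k (x - y)) y = - fderiv ℝ (molKernel d k) (x - y) := by
      have h0 : HasFDerivAt (fun y => x - y) (-ContinuousLinearMap.id ℝ (Eu d)) y :=
        (hasFDerivAt_id y).const_sub x
      have h1 := ((hK.differentiable one_ne_zero (x - y)).hasFDerivAt.comp y h0).fderiv
      rw [Function.comp_def] at h1
      rw [h1]; ext v; simp
    simp [gradient, this]
  have hint : Integrable (fun t => f (x - t) • ∇ (molKernel d k) t) := by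
    have h1 : LocallyIntegrable (fun t => f (x - t)) := by
      intro y
      obtain ⟨U, hU, hi⟩ := h.locallyIntegrable (x - y)
      refine ⟨(fun t => x - t) ⁻¹' U, (continuous_const.sub continuous_id).continuousAt hU, ?_⟩
      have hmp : MeasurePreserving (fun t : Eu d => x - t) volume volume :=
        volume.measurePreserving_sub_left x
      exact (hmp.integrableOn_comp_preimage (Homeomorph.subLeft x).measurableEmbedding).2 hi
    exact h1.integrable_smul_right_of_hasCompactSupport (continuous_gradient hK)
      (hasCompactSupport_gradient (hasCompactSupport_molKernel d k))
  ext i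
  rw [gradient_mollify k h.locallyIntegrable, mollify_apply', integral_coord hint,
    integral_coord (integrable_mollify_integrand' k h.locallyIntegrable_grad x)]
  have h1 := h.integral_eq _ hK' hKc i
  simp only [hgrad, PiLp.neg_apply, mul_neg, integral_neg, neg_inj] at h1
  simp only [PiLp.smul_apply, smul_eq_mul]
  rw [← h1, ← integral_sub_left_eq_self (fun t => f t * (∇ (molKernel d k) (x - t)) i) volume x]
  simp

/-- Integration by parts for two `C¹` functions, one of them with compact support. -/
lemma integral_mul_gradient_coord {d : ℕ} {f φ : Eu d → ℝ} (hf : ContDiff ℝ 1 f) (hφ : ContDiff ℝ 1 φ)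
    (hc : HasCompactSupport φ) (i : Fin d) :
    ∫ x, f x * (∇ φ x) i = - ∫ x, φ x * (∇ f x) i := by
  simp_rw [gradient_coord]
  rw [integral_mul_fderiv_eq_neg_fderiv_mul_of_integrable]
  · simp_rw [mul_comm]
  · exact (((hf.continuous_fderiv one_ne_zero).clm_apply continuous_const).mul
      hφ.continuous).integrable_of_hasCompactSupport hc.mul_left
  · exact (hf.continuous.mul ((hφ.continuous_fderiv one_ne_zero).clm_apply
      continuous_const)).integrable_of_hasCompactSupport
      ((hc.fderiv_apply (𝕜 := ℝ) _).mul_left)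
  · exact (hf.continuous.mul hφ.continuous).integrable_of_hasCompactSupport hc.mul_left
  · exact fun x _ => hf.differentiable one_ne_zero x
  · exact fun x _ => hφ.differentiable one_ne_zero x

/-! ### The chain rule for weak gradients -/

lemma abs_sub_le_of_hasDerivAt_nonneg {T T' : ℝ → ℝ} (hT : ∀ u, 0 ≤ u → HasDerivAt T (T' u) u) {L : ℝ}
    (hL : ∀ u, 0 ≤ u → |T' u| ≤ L) {u v : ℝ} (hu : 0 ≤ u) (hv : 0 ≤ v) :
    |T u - T v| ≤ L * |u - v| := by
  have := Convex.norm_image_sub_le_of_norm_hasDerivWithin_le (f := T) (f' := T') (s := Ici 0)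
    (fun x hx => (hT x hx).hasDerivWithinAt) (fun x hx => hL x hx) (convex_Ici 0) hv hu
  simpa using this

/-- A continuous function on `ℝ` that agrees with `S` on `[0, ∞)`. -/
lemma continuous_comp_max {S : ℝ → ℝ} (hS : ContinuousOn S (Ici 0)) :
    Continuous (fun u => S (max u 0)) :=
  hS.comp_continuous (by fun_prop) (fun u => mem_Ici.2 (le_max_right _ _))

lemma aestronglyMeasurable_comp_nonneg {α : Type*} {mα : MeasurableSpace α} {μ : Measure α}
    {S : ℝ → ℝ} (hS : ContinuousOn S (Ici 0)) {f : α → ℝ} (hf : AEStronglyMeasurable f μ)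
    (hf0 : ∀ x, 0 ≤ f x) : AEStronglyMeasurable (fun x => S (f x)) μ := by
  have := (continuous_comp_max hS).comp_aestronglyMeasurable hf
  refine this.congr (ae_of_all _ fun x => ?_)
  simp [max_eq_left (hf0 x)]

lemma continuousOn_of_hasDerivAt_nonneg {T T' : ℝ → ℝ} (hT : ∀ u, 0 ≤ u → HasDerivAt T (T' u) u) :
    ContinuousOn T (Ici 0) := fun u hu => (hT u hu).continuousAt.continuousWithinAt

lemma locallyIntegrable_comp_nonneg {d : ℕ} {f : Eu d → ℝ} (hf : LocallyIntegrable f)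
    (hf0 : ∀ x, 0 ≤ f x) {T T' : ℝ → ℝ} (hT : ∀ u, 0 ≤ u → HasDerivAt T (T' u) u) {L : ℝ}
    (hL : ∀ u, 0 ≤ u → |T' u| ≤ L) : LocallyIntegrable (fun x => T (f x)) := by
  refine ((locallyIntegrable_const (|T 0|)).add (hf.smul L)).mono
    (aestronglyMeasurable_comp_nonneg (continuousOn_of_hasDerivAt_nonneg hT) hf.aestronglyMeasurable hf0)
    (ae_of_all _ fun x => ?_)
  have h := abs_sub_le_of_hasDerivAt_nonneg hT hL (hf0 x) le_rfl
  rw [sub_zero, abs_of_nonneg (hf0 x)] at h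
  rw [Real.norm_eq_abs]
  refine le_trans ?_ (le_abs_self _)
  change |T (f x)| ≤ |T 0| + L * f x
  have := abs_sub_abs_le_abs_sub (T (f x)) (T 0)
  linarith

/-- The chain rule for weak gradients: nonnegative functions may be composed with functions that are
continuously differentiable on `[0, ∞)` with bounded derivative. -/
lemma HasWeakGradient.comp_nonneg {d : ℕ} {f : Eu d → ℝ} {g : Eu d → Eu d} (h : HasWeakGradient f g)
    (hf0 : ∀ x, 0 ≤ f x) {T T' : ℝ → ℝ} (hT : ∀ u, 0 ≤ u → HasDerivAt T (T' u) u)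
    (hT' : ContinuousOn T' (Ici 0)) {L : ℝ} (hL : ∀ u, 0 ≤ u → |T' u| ≤ L) :
    HasWeakGradient (fun x => T (f x)) (fun x => T' (f x) • g x) := by
  have hL0 : 0 ≤ L := (abs_nonneg _).trans (hL 0 le_rfl)
  have hTc := continuousOn_of_hasDerivAt_nonneg hT
  refine ⟨locallyIntegrable_comp_nonneg h.locallyIntegrable hf0 hT hL, ?_, ?_⟩
  · refine (h.locallyIntegrable_grad.smul L).mono
      ((aestronglyMeasurable_comp_nonneg hT' h.locallyIntegrable.aestronglyMeasurable hf0).smul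
        h.locallyIntegrable_grad.aestronglyMeasurable) (ae_of_all _ fun x => ?_)
    simp only [Pi.smul_apply, norm_smul, Real.norm_eq_abs, abs_of_nonneg hL0]
    gcongr
    exact hL _ (hf0 x)
  intro φ hφ hφc i
  obtain ⟨R, hR⟩ := hφc.isCompact.isBounded.subset_closedBall 0
  have hφ0 : ∀ x, R < ‖x‖ → φ x = 0 := fun x hx => by
    by_contra hne
    have := hR (subset_tsupport _ hne)
    simp at this; linarith
  have hdφ0 : ∀ x, R < ‖x‖ → ∇ φ x = 0 := fun x hx => by
    by_contra hne
    have := hR (tsupport_gradient_subset φ (subset_tsupport _ hne))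
    simp at this; linarith
  obtain ⟨A, hA⟩ := hφc.exists_bound_of_continuous hφ.continuous
  obtain ⟨B, hB⟩ := (hasCompactSupport_gradient hφc).exists_bound_of_continuous (continuous_gradient hφ)
  have hA0 : 0 ≤ A := (norm_nonneg _).trans (hA 0)
  have hB0 : 0 ≤ B := (norm_nonneg _).trans (hB 0)
  have hfk : ∀ k, ContDiff ℝ 1 (mollify k f) := fun k => contDiff_mollify k h.locallyIntegrable (n := 1)
  have hfk0 : ∀ k x, 0 ≤ mollify k f x := fun k => mollify_nonneg k hf0
  have hdT : ∀ k x, HasFDerivAt (fun y => T (mollify k f y)) (T' (mollify k f x) • fderiv ℝ (mollify k f) x) x :=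
    fun k x => (hT _ (hfk0 k x)).comp_hasFDerivAt x ((hfk k).differentiable one_ne_zero x).hasFDerivAt
  have hgT : ∀ k x, ∇ (fun y => T (mollify k f y)) x = T' (mollify k f x) • mollify k g x := fun k x => by
    rw [← gradient_mollify_of_hasWeakGradient h]
    simp [gradient, (hdT k x).fderiv]
  have hT'k : ∀ k, Continuous (fun x => T' (mollify k f x)) := fun k =>
    hT'.comp_continuous (hfk k).continuous (hfk0 k)
  have hTk : ∀ k, ContDiff ℝ 1 (fun y => T (mollify k f y)) := fun k => by
    rw [contDiff_one_iff_hasFDerivAt]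
    exact ⟨_, (hT'k k).smul ((hfk k).continuous_fderiv one_ne_zero), hdT k⟩
  have hae := ae_tendsto_mollify h.locallyIntegrable
  have haeg := ae_tendsto_mollify h.locallyIntegrable_grad
  have hlim : ∀ {S : ℝ → ℝ}, ContinuousOn S (Ici 0) → ∀ {x}, Tendsto (fun k => mollify k f x) atTop (𝓝 (f x)) →
      Tendsto (fun k => S (mollify k f x)) atTop (𝓝 (S (f x))) := fun {S} hS {x} hx =>
    (hS (f x) (hf0 x)).tendsto.comp (tendsto_nhdsWithin_iff.2 ⟨hx, Eventually.of_forall fun k => hfk0 k x⟩)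
  have hnormf : (fun x => ‖f x‖) = f := by ext x; exact Real.norm_of_nonneg (hf0 x)
  have hone : ∀ k x, mollify k (fun y => ‖|T 0| + L * f y‖) x = |T 0| + L * mollify k f x := fun k x => by
    have e : ∀ t, molKernel d k t * ‖|T 0| + L * f (x - t)‖ =
        |T 0| * molKernel d k t + L * (molKernel d k t • f (x - t)) := fun t => by
      rw [Real.norm_of_nonneg (by have := hf0 (x - t); positivity), smul_eq_mul]; ring
    rw [mollify_apply, mollify_apply]
    simp only [smul_eq_mul]
    simp_rw [e]
    rw [integral_add ((integrable_molKernel d k).const_mul _)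
      ((integrable_mollify_integrand k h.locallyIntegrable x).const_mul _), integral_const_mul,
      integral_const_mul, integral_molKernel, mul_one]
    rfl
  -- both sides of the formula for the mollifications converge
  have h1 : Tendsto (fun k => ∫ x, T (mollify k f x) * (∇ φ x) i) atTop (𝓝 (∫ x, T (f x) * (∇ φ x) i)) := by
    refine tendsto_integral_of_mollify_dominated (R := R) (C := B) (f := fun y => |T 0| + L * f y)
      ((locallyIntegrable_const _).add (h.locallyIntegrable.smul L)) hB0 (fun k => ?_) (fun k x _ => ?_)
      (fun k x hx => ?_) ?_
    · exact ((hTk k).continuous.mul ((EuclideanSpace.proj i).continuous.comp (continuous_gradient hφ))).aestronglyMeasurable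
    · rw [hone, norm_mul, mul_comm]
      gcongr
      · exact (PiLp.norm_apply_le _ _).trans (hB x)
      · have h := abs_sub_le_of_hasDerivAt_nonneg hT hL (hfk0 k x) le_rfl
        rw [sub_zero, abs_of_nonneg (hfk0 k x)] at h
        have := abs_sub_abs_le_abs_sub (T (mollify k f x)) (T 0)
        rw [Real.norm_eq_abs]; linarith
    · simp [hdφ0 x hx]
    · filter_upwards [hae] with x hx
      exact (hlim hTc hx).mul_const _
  have h2 : Tendsto (fun k => ∫ x, φ x * (T' (mollify k f x) • mollify k g x) i) atTop
      (𝓝 (∫ x, φ x * (T' (f x) • g x) i)) := by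
    refine tendsto_integral_of_mollify_dominated (R := R) (C := A * L) (f := g)
      h.locallyIntegrable_grad (by positivity) (fun k => ?_) (fun k x _ => ?_)
      (fun k x hx => ?_) ?_
    · exact (hφ.continuous.mul ((EuclideanSpace.proj i).continuous.comp ((hT'k k).smul
        (contDiff_mollify k h.locallyIntegrable_grad (n := 0)).continuous))).aestronglyMeasurable
    · rw [norm_mul, mul_assoc]
      gcongr
      · exact hA x
      · refine (PiLp.norm_apply_le _ _).trans ?_
        rw [norm_smul]
        gcongr
        · exact hL _ (hfk0 k x)
        · exact norm_mollify_le k g x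
    · simp [hφ0 x hx]
    · filter_upwards [hae, haeg] with x hx hgx
      exact (((EuclideanSpace.proj i).continuous.tendsto _).comp ((hlim hT' hx).smul hgx)).const_mul _
  refine tendsto_nhds_unique h1 ?_
  convert h2.neg using 2 with k
  rw [integral_mul_gradient_coord (hTk k) hφ hφc i]
  simp_rw [hgT]

/-! ### Local square integrals under mollification and translation -/

/-- The Cauchy–Schwarz inequality for a weight `w`. -/
lemma sq_lintegral_mul_le {α : Type*} {mα : MeasurableSpace α} {μ : Measure α} {F w : α → ℝ≥0∞}
    (hF : AEMeasurable F μ) (hw : AEMeasurable w μ) :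
    (∫⁻ x, F x * w x ∂μ) ^ 2 ≤ (∫⁻ x, w x ∂μ) * ∫⁻ x, F x ^ 2 * w x ∂μ := by
  have hp : (2 : ℝ).HolderConjugate 2 := Real.HolderConjugate.two_two
  have h := ENNReal.lintegral_mul_le_Lp_mul_Lq μ hp (f := fun x => w x ^ (1 / 2 : ℝ))
    (g := fun x => F x * w x ^ (1 / 2 : ℝ)) (hw.pow_const _) (hF.mul (hw.pow_const _))
  have e0 : ∀ a : ℝ≥0∞, (a ^ (1 / 2 : ℝ)) ^ (2 : ℝ) = a := fun a => by
    rw [← ENNReal.rpow_mul]; norm_num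
  have e1 : ∀ a : ℝ≥0∞, a ^ (1 / 2 : ℝ) * a ^ (1 / 2 : ℝ) = a := fun a => by
    rw [← ENNReal.rpow_add_of_nonneg _ _ (by norm_num) (by norm_num)]; norm_num
  have e2 : ∀ x, (F x * w x ^ (1 / 2 : ℝ)) ^ (2 : ℝ) = F x ^ 2 * w x := fun x => by
    rw [ENNReal.mul_rpow_of_nonneg _ _ (by norm_num), e0, ENNReal.rpow_two]
  have e3 : ∀ x, w x ^ (1 / 2 : ℝ) * (F x * w x ^ (1 / 2 : ℝ)) = F x * w x := fun x => by
    rw [mul_left_comm, e1]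
  simp only [Pi.mul_apply, e0, e2, e3] at h
  calc _ ≤ ((∫⁻ x, w x ∂μ) ^ (1 / 2 : ℝ) * (∫⁻ x, F x ^ 2 * w x ∂μ) ^ (1 / 2 : ℝ)) ^ 2 := by gcongr
    _ = _ := by
      rw [← ENNReal.rpow_two, ENNReal.mul_rpow_of_nonneg _ _ (by norm_num), e0, e0]

/-- The square of an average of functions is at most the average of the squares. -/
lemma lintegral_sq_lintegral_mul_le {α β : Type*} {mα : MeasurableSpace α} {mβ : MeasurableSpace β}
    {μ : Measure α} {ν : Measure β} [SFinite μ] [SFinite ν] {Φ : α → β → ℝ≥0∞} {w : β → ℝ≥0∞}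
    (hΦ : AEMeasurable (fun p : α × β => Φ p.1 p.2) (μ.prod ν)) (hw : AEMeasurable w ν)
    {M : ℝ≥0∞} (hw' : ∀ t, w t ≠ ∞) (hM : ∀ᵐ t ∂ν, w t ≠ 0 → ∫⁻ x, Φ x t ^ 2 ∂μ ≤ M) :
    ∫⁻ x, (∫⁻ t, Φ x t * w t ∂ν) ^ 2 ∂μ ≤ (∫⁻ t, w t ∂ν) ^ 2 * M := by
  have hw2 : AEMeasurable (fun p : α × β => w p.2) (μ.prod ν) := hw.comp_snd
  have h1 : ∀ᵐ x ∂μ, AEMeasurable (Φ x) ν := by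
    filter_upwards [hΦ.aestronglyMeasurable.prodMk_left] with x hx using hx.aemeasurable
  calc ∫⁻ x, (∫⁻ t, Φ x t * w t ∂ν) ^ 2 ∂μ
      ≤ ∫⁻ x, (∫⁻ t, w t ∂ν) * ∫⁻ t, Φ x t ^ 2 * w t ∂ν ∂μ := by
        refine lintegral_mono_ae ?_
        filter_upwards [h1] with x hx
        exact sq_lintegral_mul_le hx hw
    _ = (∫⁻ t, w t ∂ν) * ∫⁻ x, ∫⁻ t, Φ x t ^ 2 * w t ∂ν ∂μ :=
        lintegral_const_mul'' _ ((hΦ.pow_const 2).mul hw2).lintegral_prod_right'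
    _ = (∫⁻ t, w t ∂ν) * ∫⁻ t, ∫⁻ x, Φ x t ^ 2 * w t ∂μ ∂ν := by
        rw [lintegral_lintegral_swap ((hΦ.pow_const 2).mul hw2)]
    _ ≤ (∫⁻ t, w t ∂ν) * ∫⁻ t, M * w t ∂ν := by
        refine mul_le_mul' le_rfl (lintegral_mono_ae ?_)
        filter_upwards [hM] with t hMt
        rw [lintegral_mul_const' _ _ (hw' t)]
        by_cases ht : w t = 0
        · simp [ht]
        · exact mul_le_mul' (hMt ht) le_rfl
    _ = _ := by rw [lintegral_const_mul'' _ hw]; ring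

lemma lintegral_closedBall_comp_sub_le {d : ℕ} (F : Eu d → ℝ≥0∞) {R s : ℝ} {t : Eu d} (ht : ‖t‖ ≤ s) :
    ∫⁻ x in Metric.closedBall 0 R, F (x - t) ≤ ∫⁻ x in Metric.closedBall 0 (R + s), F x := by
  rw [← lintegral_indicator Metric.isClosed_closedBall.measurableSet,
    ← lintegral_indicator Metric.isClosed_closedBall.measurableSet]
  rw [← lintegral_sub_right_eq_self ((Metric.closedBall (0 : Eu d) (R + s)).indicator F) t]
  refine lintegral_mono fun x => ?_
  by_cases hx : x ∈ Metric.closedBall (0 : Eu d) R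
  · rw [indicator_of_mem hx, indicator_of_mem]
    simp only [mem_closedBall_zero_iff] at hx ⊢
    exact (norm_sub_le _ _).trans (add_le_add hx ht)
  · rw [indicator_of_notMem hx]; exact zero_le

lemma aemeasurable_comp_sub {d : ℕ} {γ : Type*} [MeasurableSpace γ] {F : Eu d → γ} (hF : AEMeasurable F) :
    AEMeasurable (fun p : Eu d × Eu d => F (p.1 - p.2)) (volume.prod volume) :=
  hF.comp_quasiMeasurePreserving (quasiMeasurePreserving_sub volume volume)

lemma enorm_mollify_le {d : ℕ} {E : Type*} [NormedAddCommGroup E] [NormedSpace ℝ E] (k : ℕ)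
    (f : Eu d → E) (x : Eu d) : ‖mollify k f x‖ₑ ≤ ∫⁻ t, ‖f (x - t)‖ₑ * ‖molKernel d k t‖ₑ := by
  rw [mollify_apply]
  refine (enorm_integral_le_lintegral_enorm _).trans_eq ?_
  simp_rw [enorm_smul, mul_comm]

/-- Mollification does not increase the local `L²` norm, up to a change of radius. -/
lemma lintegral_sq_mollify_le {d : ℕ} {E : Type*} [NormedAddCommGroup E] [NormedSpace ℝ E] (k : ℕ)
    {g : Eu d → E} (hg : LocallyIntegrable g) (R : ℝ) :
    ∫⁻ x in Metric.closedBall 0 R, ‖mollify k g x‖ₑ ^ 2 ≤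
      ∫⁻ x in Metric.closedBall 0 (R + 1), ‖g x‖ₑ ^ 2 := by
  calc _ ≤ ∫⁻ x in Metric.closedBall 0 R, (∫⁻ t, ‖g (x - t)‖ₑ * ‖molKernel d k t‖ₑ) ^ 2 := by
        gcongr with x; exact enorm_mollify_le k g x
    _ ≤ (∫⁻ t, ‖molKernel d k t‖ₑ) ^ 2 * ∫⁻ x in Metric.closedBall 0 (R + 1), ‖g x‖ₑ ^ 2 := by
        refine lintegral_sq_lintegral_mul_le (Φ := fun x t => ‖g (x - t)‖ₑ) ?_ ?_
          (fun t => enorm_ne_top) (ae_of_all _ fun t ht => ?_)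
        · have : AEMeasurable (fun p : Eu d × Eu d => ‖g (p.1 - p.2)‖ₑ) (volume.prod volume) :=
            aemeasurable_comp_sub (F := fun x => ‖g x‖ₑ) hg.aestronglyMeasurable.enorm
          exact this.mono_ac (Measure.AbsolutelyContinuous.prod Measure.absolutelyContinuous_restrict
            Measure.AbsolutelyContinuous.rfl)
        · exact (contDiff_molKernel d k (n := 0)).continuous.aestronglyMeasurable.enorm
        · refine lintegral_closedBall_comp_sub_le (fun x => ‖g x‖ₑ ^ 2) ?_
          by_contra hcon
          exact ht (by rw [molKernel_eq_zero ((molRadius_le_one k).trans_lt (not_le.1 hcon)), enorm_zero])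
    _ = _ := by rw [lintegral_molKernel]; simp

/-- A function whose weak gradient is locally square integrable is Lipschitz continuous under
translations in the local `L²` norm. -/
lemma HasWeakGradient.lintegral_sq_translate_le {d : ℕ} {f : Eu d → ℝ} {g : Eu d → Eu d}
    (h : HasWeakGradient f g) (R : ℝ) {z : Eu d} (hz : ‖z‖ ≤ 1) :
    ∫⁻ x in Metric.closedBall 0 R, ‖f (x - z) - f x‖ₑ ^ 2 ≤
      ‖z‖ₑ ^ 2 * ∫⁻ x in Metric.closedBall 0 (R + 2), ‖g x‖ₑ ^ 2 := by
  have hfk : ∀ k, ContDiff ℝ 1 (mollify k f) := fun k => contDiff_mollify k h.locallyIntegrable (n := 1)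
  have hgk : ∀ k, Continuous (mollify k g) := fun k =>
    (contDiff_mollify k h.locallyIntegrable_grad (n := 0)).continuous
  -- the fundamental theorem of calculus along the segment from `x` to `x - z`
  have hftc : ∀ k x, ‖mollify k f (x - z) - mollify k f x‖ₑ ≤
      ∫⁻ θ in Icc (0 : ℝ) 1, ‖z‖ₑ * ‖mollify k g (x - θ • z)‖ₑ * 1 := by
    intro k x
    have hd : ∀ θ : ℝ, HasDerivAt (fun θ : ℝ => mollify k f (x - θ • z))
        (inner ℝ (mollify k g (x - θ • z)) (-z)) θ := by
      intro θ
      have h1 : HasDerivAt (fun θ : ℝ => x - θ • z) (-z) θ := by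
        simpa using ((hasDerivAt_id θ).smul_const z).const_sub x
      have h2 := ((hfk k).differentiable one_ne_zero (x - θ • z)).hasFDerivAt.comp_hasDerivAt θ h1
      rw [← gradient_mollify_of_hasWeakGradient h, inner_gradient_left]
      exact h2
    have hc : Continuous (fun θ : ℝ => (inner ℝ (mollify k g (x - θ • z)) (-z) : ℝ)) :=
      Continuous.inner ((hgk k).comp (by fun_prop)) continuous_const
    have hi := intervalIntegral.integral_eq_sub_of_hasDerivAt (a := 0) (b := 1) (fun θ _ => hd θ)
      (hc.intervalIntegrable _ _)
    simp only [one_smul, zero_smul, sub_zero] at hi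
    rw [← hi, intervalIntegral.integral_of_le zero_le_one]
    refine (enorm_integral_le_lintegral_enorm _).trans ?_
    rw [restrict_Ioc_eq_restrict_Icc]
    refine lintegral_mono fun θ => ?_
    rw [mul_one, mul_comm]
    rw [← ofReal_norm, ← ofReal_norm, ← ofReal_norm, ← ENNReal.ofReal_mul (norm_nonneg _)]
    refine ENNReal.ofReal_le_ofReal ((norm_inner_le_norm (𝕜 := ℝ) _ _).trans_eq ?_)
    rw [norm_neg]
  have hk : ∀ k, ∫⁻ x in Metric.closedBall 0 R, ‖mollify k f (x - z) - mollify k f x‖ₑ ^ 2 ≤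
      ‖z‖ₑ ^ 2 * ∫⁻ x in Metric.closedBall 0 (R + 2), ‖g x‖ₑ ^ 2 := by
    intro k
    calc _ ≤ ∫⁻ x in Metric.closedBall 0 R,
          (∫⁻ θ in Icc (0 : ℝ) 1, ‖z‖ₑ * ‖mollify k g (x - θ • z)‖ₑ * 1) ^ 2 := by
          gcongr with x; exact hftc k x
      _ ≤ (∫⁻ θ in Icc (0 : ℝ) 1, 1) ^ 2 *
          (‖z‖ₑ ^ 2 * ∫⁻ x in Metric.closedBall 0 (R + 2), ‖g x‖ₑ ^ 2) := by
          have hclip : ∀ θ ∈ Icc (0 : ℝ) 1, ∫⁻ x in Metric.closedBall 0 R,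
              (‖z‖ₑ * ‖mollify k g (x - θ • z)‖ₑ) ^ 2 ≤
              ‖z‖ₑ ^ 2 * ∫⁻ x in Metric.closedBall 0 (R + 2), ‖g x‖ₑ ^ 2 := by
            intro θ hθ
            simp_rw [mul_pow]
            rw [lintegral_const_mul' _ _ (by finiteness)]
            refine mul_le_mul' le_rfl ?_
            refine (lintegral_closedBall_comp_sub_le (fun x => ‖mollify k g x‖ₑ ^ 2) (s := 1) ?_).trans ?_
            · rw [norm_smul, Real.norm_of_nonneg hθ.1]
              exact mul_le_one₀ hθ.2 (norm_nonneg _) hz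
            · refine (lintegral_sq_mollify_le k h.locallyIntegrable_grad (R + 1)).trans_eq ?_
              rw [add_assoc]; norm_num
          refine lintegral_sq_lintegral_mul_le (Φ := fun x θ => ‖z‖ₑ * ‖mollify k g (x - θ • z)‖ₑ) ?_
            aemeasurable_const (fun _ => ENNReal.one_ne_top)
            ((ae_restrict_mem measurableSet_Icc).mono fun θ hθ _ => hclip θ hθ)
          have hc : Continuous fun p : Eu d × ℝ => mollify k g (p.1 - p.2 • z) :=
            (hgk k).comp (by fun_prop)
          exact ((hc.measurable.enorm).const_mul _).aemeasurable
      _ = _ := by simp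
  calc _ ≤ ∫⁻ x in Metric.closedBall 0 R, liminf (fun k => ‖mollify k f (x - z) - mollify k f x‖ₑ ^ 2) atTop := by
        refine lintegral_mono_ae (ae_restrict_of_ae ?_)
        have hae := ae_tendsto_mollify h.locallyIntegrable
        have hae' : ∀ᵐ x, Tendsto (fun k => mollify k f (x - z)) atTop (𝓝 (f (x - z))) :=
          (measurePreserving_sub_right volume z).quasiMeasurePreserving.ae hae
        filter_upwards [hae, hae'] with x h1 h2
        have h3 := ((ENNReal.continuous_pow 2).tendsto _).comp (h2.sub h1).enorm
        exact h3.liminf_eq.ge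
    _ ≤ liminf (fun k => ∫⁻ x in Metric.closedBall 0 R, ‖mollify k f (x - z) - mollify k f x‖ₑ ^ 2) atTop := by
        refine lintegral_liminf_le fun k => ?_
        have := (hfk k).continuous
        exact (Continuous.measurable (by fun_prop)).enorm.pow_const 2
    _ ≤ _ := liminf_le_of_frequently_le' (Eventually.of_forall hk).frequently

/-! ### The truncated logarithm -/

/-- The truncated logarithm `log ((u + δ) / (1 + δ u))`. On `[0, ∞)` it is smooth, and bounded by
`- log δ` if `δ ∈ (0, 1)`; it tends to `log u` as `δ → 0`. -/
noncomputable def truncLog (δ u : ℝ) : ℝ := Real.log (u + δ) - Real.log (1 + δ * u)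

/-- The derivative of `truncLog δ` on `[0, ∞)`. -/
noncomputable def truncInv (δ u : ℝ) : ℝ := 1 / (u + δ) - δ / (1 + δ * u)

section
variable {δ : ℝ}

lemma hasDerivAt_truncLog (hδ : 0 < δ) {u : ℝ} (hu : 0 ≤ u) :
    HasDerivAt (truncLog δ) (truncInv δ u) u := by
  have h1 : HasDerivAt (fun u => u + δ) 1 u := (hasDerivAt_id u).add_const δ
  have h2 : HasDerivAt (fun u => 1 + δ * u) δ u := by
    simpa using ((hasDerivAt_id u).const_mul δ).const_add 1
  exact (h1.log (by positivity)).sub (h2.log (by positivity))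

lemma truncInv_eq (hδ : 0 < δ) {u : ℝ} (hu : 0 ≤ u) :
    truncInv δ u = (1 - δ ^ 2) / ((u + δ) * (1 + δ * u)) := by
  have h1 : u + δ ≠ 0 := by positivity
  have h2 : 1 + δ * u ≠ 0 := by positivity
  unfold truncInv
  field_simp
  ring

lemma truncInv_nonneg (hδ : 0 < δ) (hδ1 : δ < 1) {u : ℝ} (hu : 0 ≤ u) : 0 ≤ truncInv δ u := by
  rw [truncInv_eq hδ hu]
  have : 0 ≤ 1 - δ ^ 2 := by nlinarith
  positivity

lemma add_mul_truncInv_le (hδ : 0 < δ) {u : ℝ} (hu : 0 ≤ u) : (u + δ) * truncInv δ u ≤ 1 := by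
  unfold truncInv
  rw [mul_sub, mul_one_div_cancel (by positivity)]
  have : 0 ≤ (u + δ) * (δ / (1 + δ * u)) := by positivity
  linarith

lemma mul_truncInv_le (hδ : 0 < δ) (hδ1 : δ < 1) {u : ℝ} (hu : 0 ≤ u) : u * truncInv δ u ≤ 1 := by
  have h1 := add_mul_truncInv_le hδ hu
  have h2 := truncInv_nonneg hδ hδ1 hu
  nlinarith

lemma abs_truncInv_le (hδ : 0 < δ) (hδ1 : δ < 1) {u : ℝ} (hu : 0 ≤ u) : |truncInv δ u| ≤ 1 / δ := by
  rw [abs_of_nonneg (truncInv_nonneg hδ hδ1 hu), le_div_iff₀ hδ]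
  have h1 := add_mul_truncInv_le hδ hu
  have h2 := truncInv_nonneg hδ hδ1 hu
  nlinarith

lemma continuousOn_truncInv (hδ : 0 < δ) : ContinuousOn (truncInv δ) (Ici 0) := by
  refine (continuousOn_const.div (by fun_prop) fun u hu => ?_).sub
    (continuousOn_const.div (by fun_prop) fun u hu => ?_)
  all_goals
    have hu' : 0 ≤ u := hu
    positivity

lemma tendsto_mul_truncInv {u : ℝ} (hu : 0 < u) {δ : ℕ → ℝ} (hδ0 : ∀ n, 0 < δ n)
    (hδ : Tendsto δ atTop (𝓝 0)) :
    Tendsto (fun n => u * truncInv (δ n) u) atTop (𝓝 1) := by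
  have h : Tendsto (fun n => u * ((1 - δ n ^ 2) / ((u + δ n) * (1 + δ n * u)))) atTop
      (𝓝 (u * ((1 - 0 ^ 2) / ((u + 0) * (1 + 0 * u))))) :=
    ((tendsto_const_nhds.sub (hδ.pow 2)).div ((tendsto_const_nhds.add hδ).mul
      (tendsto_const_nhds.add (hδ.mul_const u))) (by simpa using hu.ne')).const_mul u
  have e : u * ((1 - 0 ^ 2) / ((u + 0) * (1 + 0 * u))) = 1 := by field_simp; ring
  rw [e] at h
  exact h.congr fun n => by rw [truncInv_eq (hδ0 n) hu.le]

lemma abs_truncLog_le (hδ : 0 < δ) (hδ1 : δ < 1) {u : ℝ} (hu : 0 ≤ u) : |truncLog δ u| ≤ - Real.log δ := by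
  have h1 : 0 < u + δ := by positivity
  have h2 : 0 < 1 + δ * u := by positivity
  rw [abs_le]
  unfold truncLog
  constructor
  · have : Real.log (δ * (1 + δ * u)) ≤ Real.log (u + δ) := by
      apply Real.log_le_log (by positivity)
      nlinarith [mul_nonneg hu (by nlinarith : 0 ≤ 1 - δ ^ 2)]
    rw [Real.log_mul hδ.ne' h2.ne'] at this
    linarith
  · have : Real.log (δ * (u + δ)) ≤ Real.log (1 + δ * u) := by
      apply Real.log_le_log (by positivity)
      nlinarith
    rw [Real.log_mul hδ.ne' h1.ne'] at this
    linarith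

/-- The increments of the truncated logarithm, weighted by `√(a + δ)`, are controlled by those of the
square root. -/
lemma sqrt_mul_abs_truncLog_sub_le (hδ : 0 < δ) (hδ1 : δ < 1) {a b : ℝ} (ha : 0 ≤ a) (hb : 0 ≤ b) :
    √(a + δ) * |truncLog δ b - truncLog δ a| ≤ (2 - 2 * Real.log δ) * |√(b + δ) - √(a + δ)| := by
  set M := - Real.log δ
  -- as a function of `p = √(u + δ)`, the product `√(u + δ) truncLog δ u` is Lipschitz continuous
  have hderiv : ∀ p ∈ Ici (√δ), HasDerivWithinAt (fun p => p * truncLog δ (p ^ 2 - δ))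
      (1 * truncLog δ (p ^ 2 - δ) + p * (truncInv δ (p ^ 2 - δ) * (2 * p))) (Ici (√δ)) p := by
    intro p hp
    have hp0 : 0 ≤ p ^ 2 - δ := by
      have := Real.sq_sqrt hδ.le
      have hp' : √δ ≤ p := hp
      nlinarith [Real.sqrt_nonneg δ]
    have h1 : HasDerivAt (fun p : ℝ => p ^ 2 - δ) (2 * p) p := by
      simpa using (hasDerivAt_pow 2 p).sub_const δ
    exact ((hasDerivAt_id p).mul ((hasDerivAt_truncLog hδ hp0).comp p h1)).hasDerivWithinAt
  have hbound : ∀ p ∈ Ici (√δ),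
      ‖1 * truncLog δ (p ^ 2 - δ) + p * (truncInv δ (p ^ 2 - δ) * (2 * p))‖ ≤ M + 2 := by
    intro p hp
    have hp0 : 0 ≤ p ^ 2 - δ := by
      have := Real.sq_sqrt hδ.le
      have hp' : √δ ≤ p := hp
      nlinarith [Real.sqrt_nonneg δ]
    have h1 := abs_truncLog_le hδ hδ1 hp0
    have h2 := add_mul_truncInv_le hδ hp0
    have h3 := truncInv_nonneg hδ hδ1 hp0
    have e : p * (truncInv δ (p ^ 2 - δ) * (2 * p)) = 2 * ((p ^ 2 - δ + δ) * truncInv δ (p ^ 2 - δ)) := by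
      ring
    rw [one_mul, e]
    refine (norm_add_le _ _).trans (add_le_add h1 ?_)
    rw [Real.norm_eq_abs, abs_of_nonneg (by positivity)]
    linarith
  have hmem : ∀ {c : ℝ}, 0 ≤ c → √(c + δ) ∈ Ici (√δ) := fun hc => Real.sqrt_le_sqrt (by linarith)
  have hsq : ∀ {c : ℝ}, 0 ≤ c → √(c + δ) ^ 2 - δ = c := fun hc => by
    rw [Real.sq_sqrt (by positivity)]; ring
  have h := Convex.norm_image_sub_le_of_norm_hasDerivWithin_le hderiv hbound (convex_Ici _) (hmem ha) (hmem hb)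
  simp only [hsq ha, hsq hb, Real.norm_eq_abs] at h
  have h4 := abs_truncLog_le hδ hδ1 hb
  have e : √(a + δ) * |truncLog δ b - truncLog δ a| =
      |(√(b + δ) * truncLog δ b - √(a + δ) * truncLog δ a) - (√(b + δ) - √(a + δ)) * truncLog δ b| := by
    rw [← abs_of_nonneg (Real.sqrt_nonneg (a + δ)), ← abs_mul, abs_of_nonneg (Real.sqrt_nonneg (a + δ))]
    congr 1; ring
  rw [e]
  refine (abs_sub _ _).trans ?_
  rw [abs_mul (√(b + δ) - √(a + δ))]
  have h5 : |√(b + δ) - √(a + δ)| * |truncLog δ b| ≤ |√(b + δ) - √(a + δ)| * M := by gcongr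
  calc _ ≤ (M + 2) * |√(b + δ) - √(a + δ)| + |√(b + δ) - √(a + δ)| * M := add_le_add h h5
    _ = _ := by simp only [M]; ring

end

/-- The gradient of the mollifier has integral zero, so that it sees only increments. -/
lemma gradient_mollify_eq_integral_sub {d : ℕ} (k : ℕ) {F : Eu d → ℝ} (hF : LocallyIntegrable F) (x : Eu d) :
    ∇ (mollify k F) x = ∫ t, (F (x - t) - F x) • ∇ (molKernel d k) t := by
  have hK := contDiff_molKernel d k (n := 1)
  have hi := (continuous_gradient hK).integrable_of_hasCompactSupport
    (hasCompactSupport_gradient (hasCompactSupport_molKernel d k)) (μ := volume)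
  have hG : LocallyIntegrable (fun y => F y - F x) := hF.sub (locallyIntegrable_const _)
  have e : mollify k (fun y => F y - F x) = fun y => mollify k F y + (- F x) := by
    ext y
    simp only [mollify_apply, smul_sub]
    rw [integral_sub (integrable_mollify_integrand k hF y) ((integrable_molKernel d k).smul_const (F x)),
      integral_smul_const, integral_molKernel]
    simp; rfl
  have h := gradient_mollify k hG x
  rw [← h, e]
  simp [gradient]

section
variable {d : ℕ} {m : Eu d → ℝ≥0} {Dm : Eu d → Eu d}

/-- The `L²` norms, with weight `m`, of the gradients of the mollified truncated logarithms of `m` are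
bounded. The gradient of the mollification is an integral of increments of `truncLog δ (m ·)`; weighted
by `√m`, these are dominated by the increments of `√(m + δ)`, which lies in `W^{1,2}` locally. -/
lemma exists_bound_lintegral_gradient_mollify_truncLog (h : HasWeakGradient (fun x => (m x : ℝ)) Dm)
    (hfin : ∀ r, ∫⁻ x in Metric.closedBall 0 r, fisherDensity m Dm x < ∞) {δ : ℝ} (hδ : 0 < δ)
    (hδ1 : δ < 1) (R : ℝ) : ∃ C : ℝ≥0∞, C ≠ ∞ ∧ ∀ k,
      ∫⁻ x in Metric.closedBall 0 R, ‖∇ (mollify k (fun y => truncLog δ (m y))) x‖ₑ ^ 2 * m x ≤ C := by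
  have hm0 : ∀ x, 0 ≤ (m x : ℝ) := fun x => (m x).2
  have hsd : ∀ u, 0 ≤ u → HasDerivAt (fun u => √(u + δ)) (1 / (2 * √(u + δ))) u := fun u hu =>
    ((hasDerivAt_id u).add_const δ).sqrt (by simp; positivity)
  have hψ := h.comp_nonneg hm0 hsd
    (continuousOn_const.div (by fun_prop) fun u hu => by
      have hu' : 0 ≤ u := hu
      positivity)
    (L := 1 / (2 * √δ)) (fun u hu => by
      rw [abs_of_nonneg (by positivity)]
      gcongr; linarith)
  have hF := h.comp_nonneg hm0 (fun u hu => hasDerivAt_truncLog hδ hu) (continuousOn_truncInv hδ)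
    (fun u hu => abs_truncInv_le hδ hδ1 hu)
  -- the factor `1 / molRadius k` from the gradient of the mollifier cancels against the increments
  obtain ⟨C, hC0, hC⟩ := exists_lintegral_gradient_molKernel_le d
  set I := ∫⁻ x in Metric.closedBall 0 (R + 2), ‖(1 / (2 * √((m x : ℝ) + δ))) • Dm x‖ₑ ^ 2 with hI
  have hIfin : I < ∞ := by
    refine lt_of_le_of_lt (lintegral_mono fun x => ?_) (hfin (R + 2))
    unfold fisherDensity
    rcases eq_or_ne (Dm x) 0 with h0 | h0
    · simp [h0]
    rw [ENNReal.le_div_iff_mul_le (Or.inr (by simpa using h0)) (Or.inl (by finiteness)), enorm_smul, mul_pow, mul_right_comm]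
    · have : ‖1 / (2 * √((m x : ℝ) + δ))‖ₑ ^ 2 * (m x : ℝ≥0∞) ≤ 1 := by
        rw [Real.enorm_of_nonneg (by positivity), ← ENNReal.ofReal_coe_nnreal,
          ← ENNReal.ofReal_pow (by positivity), ← ENNReal.ofReal_mul (by positivity)]
        refine ENNReal.ofReal_le_one.2 ?_
        rw [div_pow, mul_pow, Real.sq_sqrt (by positivity), div_mul_eq_mul_div, div_le_one (by positivity)]
        linarith [hm0 x]
      exact mul_le_of_le_one_left' this
  set c : ℝ := 2 - 2 * Real.log δ with hc
  have hc0 : 0 ≤ c := by have := Real.log_neg hδ hδ1; linarith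
  refine ⟨ENNReal.ofReal C ^ 2 * (ENNReal.ofReal c ^ 2 * I), by finiteness, fun k => ?_⟩
  have hr := molRadius_pos k
  have hK := contDiff_molKernel d k (n := 1)
  calc _ ≤ ∫⁻ x in Metric.closedBall 0 R, (∫⁻ t, (ENNReal.ofReal c * ‖√((m (x - t) : ℝ) + δ) - √((m x : ℝ) + δ)‖ₑ) *
        ‖∇ (molKernel d k) t‖ₑ) ^ 2 := by
        refine lintegral_mono fun x => ?_
        have hs : ENNReal.ofReal (√(m x : ℝ)) ^ 2 = m x := by
          rw [← ENNReal.ofReal_pow (Real.sqrt_nonneg _), Real.sq_sqrt (hm0 x), ENNReal.ofReal_coe_nnreal]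
        rw [← hs, ← mul_pow]
        gcongr
        rw [gradient_mollify_eq_integral_sub k hF.locallyIntegrable]
        refine (mul_le_mul' (enorm_integral_le_lintegral_enorm _) le_rfl).trans ?_
        rw [← lintegral_mul_const' _ _ ENNReal.ofReal_ne_top]
        refine lintegral_mono fun t => ?_
        rw [enorm_smul, mul_right_comm]
        refine mul_le_mul' ?_ le_rfl
        rw [← ofReal_norm, ← ofReal_norm, ← ENNReal.ofReal_mul (norm_nonneg _), ← ENNReal.ofReal_mul hc0]
        apply ENNReal.ofReal_le_ofReal
        refine le_trans ?_ (sqrt_mul_abs_truncLog_sub_le hδ hδ1 (hm0 x) (hm0 (x - t)))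
        rw [mul_comm]
        gcongr
        · linarith
        · rfl
    _ ≤ (∫⁻ t, ‖∇ (molKernel d k) t‖ₑ) ^ 2 * (ENNReal.ofReal c ^ 2 * (ENNReal.ofReal (molRadius k) ^ 2 * I)) := by
        refine lintegral_sq_lintegral_mul_le (Φ := fun x t => ENNReal.ofReal c *
          ‖√((m (x - t) : ℝ) + δ) - √((m x : ℝ) + δ)‖ₑ) ?_
          (continuous_gradient hK).aestronglyMeasurable.enorm (fun t => enorm_ne_top) (ae_of_all _ fun t ht => ?_)
        · have hme : AEMeasurable (fun x => √((m x : ℝ) + δ)) :=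
            hψ.locallyIntegrable.aestronglyMeasurable.aemeasurable
          have h1 : AEMeasurable (fun p : Eu d × Eu d => ENNReal.ofReal c *
              ‖√((m (p.1 - p.2) : ℝ) + δ) - √((m p.1 : ℝ) + δ)‖ₑ) (volume.prod volume) :=
            (((aemeasurable_comp_sub hme).sub hme.comp_fst).enorm).const_mul _
          exact h1.mono_ac (Measure.AbsolutelyContinuous.prod Measure.absolutelyContinuous_restrict
            Measure.AbsolutelyContinuous.rfl)
        · have htr : ‖t‖ ≤ molRadius k := by
            by_contra hcon
            exact ht (by rw [gradient_molKernel_eq_zero (not_le.1 hcon), enorm_zero])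
          simp_rw [mul_pow]
          rw [lintegral_const_mul' _ _ (by finiteness)]
          refine mul_le_mul' le_rfl ((hψ.lintegral_sq_translate_le R (htr.trans (molRadius_le_one k))).trans ?_)
          rw [← ofReal_norm]
          gcongr
    _ ≤ ENNReal.ofReal (C / molRadius k) ^ 2 * (ENNReal.ofReal c ^ 2 * (ENNReal.ofReal (molRadius k) ^ 2 * I)) := by
        gcongr; exact hC k
    _ = _ := by
        rw [mul_left_comm (ENNReal.ofReal c ^ 2), ← mul_assoc, ← mul_pow, ← ENNReal.ofReal_mul (by positivity),
          div_mul_cancel₀ _ hr.ne']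

end

/-! ### Integration by parts and weak divergences -/

/-- The classical divergence of a vector field. -/
noncomputable def divergence {d : ℕ} (V : Eu d → Eu d) (x : Eu d) : ℝ :=
  ∑ i, (∇ (fun y => V y i) x) i

section
variable {d : ℕ} {f : Eu d → ℝ} {g : Eu d → Eu d}

lemma real_inner_eq_sum (v w : Eu d) : (inner ℝ v w : ℝ) = ∑ i, v i * w i := by
  rw [PiLp.inner_apply]
  exact Finset.sum_congr rfl fun i _ => by simp [mul_comm]

lemma hasCompactSupport_coord {V : Eu d → Eu d} (hc : HasCompactSupport V) (i : Fin d) :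
    HasCompactSupport (fun x => V x i) :=
  hc.comp_left (g := fun v : Eu d => v i) rfl

lemma integrable_mul_gradient_coord (hf : LocallyIntegrable f) {φ : Eu d → ℝ} (hφ : ContDiff ℝ 1 φ)
    (hc : HasCompactSupport φ) (i : Fin d) : Integrable (fun x => f x * (∇ φ x) i) :=
  integrable_mul_of_locallyIntegrable hf
    ((EuclideanSpace.proj (𝕜 := ℝ) i).continuous.comp (continuous_gradient hφ))
    (hasCompactSupport_coord (hasCompactSupport_gradient hc) i)

lemma integrable_mul_coord (hg : LocallyIntegrable g) {φ : Eu d → ℝ} (hφ : Continuous φ)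
    (hc : HasCompactSupport φ) (i : Fin d) : Integrable (fun x => φ x * g x i) := by
  simpa only [mul_comm] using integrable_mul_of_locallyIntegrable (LocallyIntegrable.coord hg i) hφ hc

/-- Integration by parts against a vector field of class `C¹` with compact support. -/
lemma HasWeakGradient.integral_inner_eq (h : HasWeakGradient f g) {V : Eu d → Eu d}
    (hV : ∀ i, ContDiff ℝ 1 (fun x => V x i)) (hc : HasCompactSupport V) :
    ∫ x, (inner ℝ (V x) (g x) : ℝ) = - ∫ x, f x * divergence V x := by
  simp_rw [real_inner_eq_sum, divergence, Finset.mul_sum]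
  rw [integral_finsetSum _ fun i _ => integrable_mul_coord h.locallyIntegrable_grad (hV i).continuous
      (hasCompactSupport_coord hc i) i,
    integral_finsetSum _ fun i _ => integrable_mul_gradient_coord h.locallyIntegrable (hV i)
      (hasCompactSupport_coord hc i) i, ← Finset.sum_neg_distrib]
  refine Finset.sum_congr rfl fun i _ => ?_
  rw [h.integral_eq _ (hV i) (hasCompactSupport_coord hc i) i, neg_neg]

lemma lipschitzWith_mollify {α : Eu d → Eu d} {K : ℝ≥0} (hα : LipschitzWith K α) (k : ℕ) :
    LipschitzWith K (mollify k α) := by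
  have hl : LocallyIntegrable α := hα.continuous.locallyIntegrable
  refine LipschitzWith.of_dist_le_mul fun x y => ?_
  rw [dist_eq_norm, mollify_apply, mollify_apply, ← integral_sub (integrable_mollify_integrand k hl x)
    (integrable_mollify_integrand k hl y)]
  calc _ ≤ ∫ t, molKernel d k t * (K * dist x y) := by
        refine norm_integral_le_of_norm_le ((integrable_molKernel d k).mul_const _) (ae_of_all _ fun t => ?_)
        rw [← smul_sub, norm_smul, Real.norm_of_nonneg (molKernel_nonneg d k t), ← dist_eq_norm]
        refine mul_le_mul_of_nonneg_left ?_ (molKernel_nonneg d k t)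
        simpa using hα.dist_le_mul (x - t) (y - t)
    _ = _ := by rw [integral_mul_const, integral_molKernel, one_mul]

lemma norm_mollify_sub_le {α : Eu d → Eu d} {K : ℝ≥0} (hα : LipschitzWith K α) (k : ℕ) (x : Eu d) :
    ‖mollify k α x - α x‖ ≤ K * molRadius k := by
  have hl : LocallyIntegrable α := hα.continuous.locallyIntegrable
  have e : α x = ∫ t, molKernel d k t • α x := by
    rw [integral_smul_const, integral_molKernel, one_smul]
  rw [e, mollify_apply, ← integral_sub (integrable_mollify_integrand k hl x)
    ((integrable_molKernel d k).smul_const _)]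
  calc _ ≤ ∫ t, molKernel d k t * (K * molRadius k) := by
        refine norm_integral_le_of_norm_le ((integrable_molKernel d k).mul_const _) (ae_of_all _ fun t => ?_)
        rw [← smul_sub, norm_smul, Real.norm_of_nonneg (molKernel_nonneg d k t), ← dist_eq_norm]
        by_cases ht : molRadius k < ‖t‖
        · simp [molKernel_eq_zero ht]
        · refine mul_le_mul_of_nonneg_left ((hα.dist_le_mul _ _).trans ?_) (molKernel_nonneg d k t)
          have : dist (x - t) x = ‖t‖ := by rw [dist_eq_norm]; simp
          rw [this]
          gcongr
          exact not_lt.1 ht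
    _ = _ := by rw [integral_mul_const, integral_molKernel, one_mul]

/-- Integration by parts against a Lipschitz vector field with a cutoff, in the form of an inequality.
Mollifying the field avoids its almost everywhere derivatives. -/
lemma HasWeakGradient.abs_integral_mul_inner_le (h : HasWeakGradient f g) {α : Eu d → Eu d} {K : ℝ≥0}
    (hα : LipschitzWith K α) {φ : Eu d → ℝ} (hφ : ContDiff ℝ 1 φ) (hc : HasCompactSupport φ) :
    |∫ x, φ x * (inner ℝ (α x) (g x) : ℝ)| ≤
      ∫ x, |f x| * (|φ x| * (d * K) + ‖∇ φ x‖ * ‖α x‖) := by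
  have hl : LocallyIntegrable α := hα.continuous.locallyIntegrable
  have hfa : LocallyIntegrable (fun x => |f x|) := locallyIntegrable_norm h.locallyIntegrable
  have hga : LocallyIntegrable (fun x => ‖g x‖) := locallyIntegrable_norm h.locallyIntegrable_grad
  have hgr := continuous_gradient hφ
  have hgc := hasCompactSupport_gradient hc
  have hαc := hα.continuous
  have hφc := hφ.continuous
  have hi1 : Integrable (fun x => |f x| * (|φ x| * (d * K) + ‖∇ φ x‖ * ‖α x‖)) := by
    refine integrable_mul_of_locallyIntegrable hfa (by fun_prop) ?_
    exact (hc.abs.mul_right).add hgc.norm.mul_right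
  have hi2 : Integrable (fun x => |f x| * ‖∇ φ x‖) :=
    integrable_mul_of_locallyIntegrable hfa (by fun_prop) hgc.norm
  have hi3 : Integrable (fun x => ‖g x‖ * |φ x|) :=
    integrable_mul_of_locallyIntegrable hga (by fun_prop) hc.abs
  have hint : ∀ {V : Eu d → Eu d}, Continuous V → Integrable (fun x => φ x * (inner ℝ (V x) (g x) : ℝ)) := by
    intro V hV
    simp_rw [real_inner_eq_sum, Finset.mul_sum, ← mul_assoc]
    refine integrable_finsetSum _ fun i _ => ?_
    exact integrable_mul_coord h.locallyIntegrable_grad (φ := fun x => φ x * V x i)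
      (hφc.mul ((EuclideanSpace.proj (𝕜 := ℝ) i).continuous.comp hV)) hc.mul_right i
  have key : ∀ k, |∫ x, φ x * (inner ℝ (α x) (g x) : ℝ)| ≤
      (∫ x, |f x| * (|φ x| * (d * K) + ‖∇ φ x‖ * ‖α x‖)) +
        molRadius k * (K * (∫ x, |f x| * ‖∇ φ x‖) + K * ∫ x, ‖g x‖ * |φ x|) := by
    intro k
    set β := mollify k α with hβ
    have hβ1 : ContDiff ℝ 1 β := contDiff_mollify k hl (n := 1)
    have hβL : LipschitzWith K β := lipschitzWith_mollify hα k
    have hβi : ∀ i, ContDiff ℝ 1 (fun x => β x i) := fun i =>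
      (EuclideanSpace.proj (𝕜 := ℝ) i).contDiff.comp hβ1
    have hβg : ∀ i x, ‖∇ (fun y => β y i) x‖ ≤ K := fun i x => by
      rw [norm_gradient_eq]
      refine norm_fderiv_le_of_lipschitz ℝ (LipschitzWith.of_dist_le_mul fun y z => ?_)
      refine le_trans ?_ (hβL.dist_le_mul y z)
      rw [dist_eq_norm, dist_eq_norm]
      exact PiLp.norm_apply_le (β y - β z) i
    have hdiff : ∀ x, ‖β x - α x‖ ≤ K * molRadius k := norm_mollify_sub_le hα k
    have hV : ∀ i, ContDiff ℝ 1 (fun x => (φ x • β x) i) := fun i => hφ.mul (hβi i)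
    have hibp := h.integral_inner_eq hV (hc.smul_right (f' := β))
    have hdiv : ∀ x, |divergence (fun x => φ x • β x) x| ≤
        |φ x| * (d * K) + ‖∇ φ x‖ * (‖α x‖ + K * molRadius k) := by
      intro x
      have e : divergence (fun x => φ x • β x) x =
          φ x * ∑ i, (∇ (fun y => β y i) x) i + inner ℝ (∇ φ x) (β x) := by
        rw [divergence, real_inner_eq_sum, Finset.mul_sum, ← Finset.sum_add_distrib]
        refine Finset.sum_congr rfl fun i _ => ?_
        have := gradient_mul_apply (hφ.differentiable one_ne_zero x) ((hβi i).differentiable one_ne_zero x)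
        simp only [PiLp.smul_apply, smul_eq_mul]
        rw [this]
        simp [mul_comm]
      rw [e]
      refine (abs_add_le _ _).trans (add_le_add ?_ ?_)
      · rw [abs_mul]
        refine mul_le_mul_of_nonneg_left ((Finset.abs_sum_le_sum_abs _ _).trans ?_) (abs_nonneg _)
        refine (Finset.sum_le_card_nsmul _ _ (K : ℝ) fun i _ => ?_).trans_eq (by simp)
        exact (PiLp.norm_apply_le _ i).trans (hβg i x)
      · refine (abs_real_inner_le_norm _ _).trans (mul_le_mul_of_nonneg_left ?_ (norm_nonneg _))
        have : β x = α x + (β x - α x) := by abel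
        rw [this]
        exact (norm_add_le _ _).trans (add_le_add le_rfl (hdiff x))
    have h1 : |∫ x, φ x * (inner ℝ (β x) (g x) : ℝ)| ≤
        (∫ x, |f x| * (|φ x| * (d * K) + ‖∇ φ x‖ * ‖α x‖)) + molRadius k * (K * ∫ x, |f x| * ‖∇ φ x‖) := by
      have e : ∫ x, φ x * (inner ℝ (β x) (g x) : ℝ) = - ∫ x, f x * divergence (fun x => φ x • β x) x := by
        rw [← hibp]; simp_rw [real_inner_smul_left]
      rw [e, abs_neg, ← integral_const_mul, ← integral_const_mul, ← integral_add hi1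
        ((hi2.const_mul _).const_mul _), ← Real.norm_eq_abs]
      refine norm_integral_le_of_norm_le (hi1.add ((hi2.const_mul _).const_mul _)) (ae_of_all _ fun x => ?_)
      rw [norm_mul, Real.norm_eq_abs, Real.norm_eq_abs]
      refine (mul_le_mul_of_nonneg_left (hdiv x) (abs_nonneg _)).trans_eq ?_
      ring
    have h2 : |∫ x, φ x * (inner ℝ (α x) (g x) : ℝ) - φ x * (inner ℝ (β x) (g x) : ℝ)| ≤
        molRadius k * (K * ∫ x, ‖g x‖ * |φ x|) := by
      rw [← integral_const_mul, ← integral_const_mul, ← Real.norm_eq_abs]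
      refine norm_integral_le_of_norm_le ((hi3.const_mul _).const_mul _) (ae_of_all _ fun x => ?_)
      rw [← mul_sub, ← inner_sub_left, norm_mul, Real.norm_eq_abs, Real.norm_eq_abs]
      calc _ ≤ |φ x| * (‖α x - β x‖ * ‖g x‖) := by gcongr; exact abs_real_inner_le_norm _ _
        _ ≤ |φ x| * ((K * molRadius k) * ‖g x‖) := by
          gcongr; rw [norm_sub_rev]; exact hdiff x
        _ = _ := by ring
    rw [integral_sub (hint hαc) (hint hβ1.continuous)] at h2
    have h3 := abs_sub_abs_le_abs_sub (∫ x, φ x * (inner ℝ (α x) (g x) : ℝ)) (∫ x, φ x * (inner ℝ (β x) (g x) : ℝ))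
    rw [mul_add, ← add_assoc]
    linarith
  have hlim : Tendsto (fun k => (∫ x, |f x| * (|φ x| * (d * K) + ‖∇ φ x‖ * ‖α x‖)) +
        molRadius k * (K * (∫ x, |f x| * ‖∇ φ x‖) + K * ∫ x, ‖g x‖ * |φ x|)) atTop
      (𝓝 ((∫ x, |f x| * (|φ x| * (d * K) + ‖∇ φ x‖ * ‖α x‖)) + 0 *
        (K * (∫ x, |f x| * ‖∇ φ x‖) + K * ∫ x, ‖g x‖ * |φ x|))) :=
    ((tendsto_one_div_add_atTop_nhds_zero_nat (𝕜 := ℝ)).mul_const _).const_add _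
  rw [zero_mul, add_zero] at hlim
  exact ge_of_tendsto' hlim key

lemma locallyIntegrable_mul_continuous (hf : LocallyIntegrable f) {ψ : Eu d → ℝ} (hψ : Continuous ψ) :
    LocallyIntegrable (fun x => f x * ψ x) := by
  rw [locallyIntegrable_iff]
  intro K hK
  exact (hf.integrableOn_isCompact hK).mul_continuousOn hψ.continuousOn hK

/-- The weak divergence of `f A` for a matrix function `A` of class `C¹`. -/
lemma HasWeakDivergence.ae_eq {A : Eu d → Matrix (Fin d) (Fin d) ℝ} {D : Eu d → Eu d}
    (hD : HasWeakDivergence (fun x => f x • A x) D) (h : HasWeakGradient f g)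
    (hA : ∀ i j, ContDiff ℝ 1 (fun x => A x i j)) :
    ∀ᵐ x, ∀ i, D x i = f x * divergence (fun y => WithLp.toLp 2 (A y i)) x + ∑ j, A x i j * g x j := by
  rw [ae_all_iff]
  intro i
  have hdivc : Continuous (divergence (fun y => WithLp.toLp 2 (A y i))) := by
    unfold divergence
    refine continuous_finsetSum _ fun j _ => ?_
    exact (EuclideanSpace.proj (𝕜 := ℝ) j).continuous.comp (continuous_gradient (hA i j))
  have hR : LocallyIntegrable (fun x => f x * divergence (fun y => WithLp.toLp 2 (A y i)) x +
      ∑ j, A x i j * g x j) := by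
    refine (locallyIntegrable_mul_continuous h.locallyIntegrable hdivc).add ?_
    refine locallyIntegrable_finsetSum _ fun j _ => ?_
    simpa only [mul_comm] using locallyIntegrable_mul_continuous
      (LocallyIntegrable.coord h.locallyIntegrable_grad j) (hA i j).continuous
  refine ae_eq_of_integral_contDiff_smul_eq (LocallyIntegrable.coord hD.locallyIntegrable_div i) hR ?_
  intro φ hφ hc
  have hφ1 : ContDiff ℝ 1 φ := hφ.of_le (by simp)
  have h1 := hD.integral_eq φ hφ1 hc i
  have hcA : ∀ j, HasCompactSupport (fun x => φ x * A x i j) := fun j => hc.mul_right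
  have h2 : ∀ j, ∫ x, f x * (∇ (fun y => φ y * A y i j) x) j = - ∫ x, (φ x * A x i j) * g x j := fun j =>
    h.integral_eq _ (hφ1.mul (hA i j)) (hcA j) j
  have h3 : ∀ x, ∑ j, f x * (∇ (fun y => φ y * A y i j) x) j =
      φ x * (f x * divergence (fun y => WithLp.toLp 2 (A y i)) x) + ∑ j, (f x • A x) i j * (∇ φ x) j := by
    intro x
    rw [divergence, Finset.mul_sum, Finset.mul_sum, ← Finset.sum_add_distrib]
    refine Finset.sum_congr rfl fun j _ => ?_
    rw [gradient_mul_apply (hφ1.differentiable one_ne_zero x) ((hA i j).differentiable one_ne_zero x)]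
    simp only [PiLp.add_apply, PiLp.smul_apply, smul_eq_mul, Matrix.smul_apply]
    ring
  have hi1 : Integrable (fun x => φ x * (f x * divergence (fun y => WithLp.toLp 2 (A y i)) x)) := by
    simpa only [mul_comm] using integrable_mul_of_locallyIntegrable
      (locallyIntegrable_mul_continuous h.locallyIntegrable hdivc) hφ1.continuous hc
  have hi2 : ∀ j, Integrable (fun x => (f x • A x) i j * (∇ φ x) j) := fun j =>
    integrable_mul_gradient_coord (hD.locallyIntegrable i j) hφ1 hc j
  have hi3 : ∀ j, Integrable (fun x => (φ x * A x i j) * g x j) := fun j =>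
    integrable_mul_coord h.locallyIntegrable_grad (hφ1.continuous.mul (hA i j).continuous) (hcA j) j
  have h4 : (∫ x, φ x * (f x * divergence (fun y => WithLp.toLp 2 (A y i)) x)) +
      ∫ x, ∑ j, (f x • A x) i j * (∇ φ x) j = - ∫ x, ∑ j, (φ x * A x i j) * g x j := by
    rw [← integral_add hi1 (integrable_finsetSum _ fun j _ => hi2 j)]
    simp_rw [← h3]
    rw [integral_finsetSum _ fun j _ => integrable_mul_gradient_coord h.locallyIntegrable
      (hφ1.mul (hA i j)) (hcA j) j, integral_finsetSum _ fun j _ => hi3 j, ← Finset.sum_neg_distrib]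
    exact Finset.sum_congr rfl fun j _ => h2 j
  rw [h1] at h4
  simp only [smul_eq_mul, mul_add, Finset.mul_sum]
  simp_rw [← mul_assoc] at h4 hi1 ⊢
  rw [integral_add hi1 (integrable_finsetSum _ fun j _ => hi3 j)]
  linarith

end

/-! ### Weak limits of gradients of test functions -/

/-- A subspace of a Hilbert space contains the weak limits of its sequences in its closure. -/
lemma mem_topologicalClosure_of_tendsto_inner {H : Type*} [NormedAddCommGroup H]
    [InnerProductSpace ℝ H] [CompleteSpace H] (S : Submodule ℝ H) {v : ℕ → H} {w : H}
    (hv : ∀ k, v k ∈ S) (hw : ∀ u, Tendsto (fun k => (inner ℝ (v k) u : ℝ)) atTop (𝓝 (inner ℝ w u))) :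
    w ∈ S.topologicalClosure := by
  rw [← Submodule.orthogonal_orthogonal_eq_closure, Submodule.mem_orthogonal']
  intro u hu
  refine tendsto_nhds_unique (hw u) ?_
  have : ∀ k, (inner ℝ (v k) u : ℝ) = 0 := fun k => Submodule.inner_right_of_mem_orthogonal (hv k) hu
  simp [this]

section
variable {d : ℕ} {α : Type*} {mα : MeasurableSpace α} {μ : Measure α}

lemma eLpNorm_two_pow {f : α → Eu d} : eLpNorm f 2 μ ^ 2 = ∫⁻ x, ‖f x‖ₑ ^ 2 ∂μ := by
  have h := eLpNorm_nnreal_pow_eq_lintegral (f := f) (μ := μ) (p := 2) two_ne_zero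
  simpa using h

lemma memLp_two_of_lintegral_lt_top {f : α → Eu d} (hf : AEStronglyMeasurable f μ)
    (h : ∫⁻ x, ‖f x‖ₑ ^ 2 ∂μ < ∞) : MemLp f 2 μ := by
  refine ⟨hf, ?_⟩
  rw [← eLpNorm_two_pow] at h
  by_contra hcon
  rw [not_lt, top_le_iff] at hcon
  simp [hcon] at h

lemma integrable_inner_of_memLp_two {f g : α → Eu d} (hf : MemLp f 2 μ) (hg : MemLp g 2 μ) :
    Integrable (fun x => (inner ℝ (f x) (g x) : ℝ)) μ :=
  (hf.norm.integrable_mul hg.norm).mono (hf.aestronglyMeasurable.inner hg.aestronglyMeasurable)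
    (ae_of_all _ fun x => by
      rw [Pi.mul_apply, norm_mul, norm_norm, norm_norm]; exact norm_inner_le_norm _ _)

/-- A sequence that is bounded in `L²` and converges almost everywhere converges weakly. -/
lemma tendsto_integral_inner_of_ae_tendsto [IsFiniteMeasure μ] {V : ℕ → α → Eu d} {W u : α → Eu d}
    (hV : ∀ k, AEStronglyMeasurable (V k) μ) {C : ℝ≥0∞} (hC : C ≠ ∞)
    (hb : ∀ k, ∫⁻ x, ‖V k x‖ₑ ^ 2 ∂μ ≤ C)
    (hlim : ∀ᵐ x ∂μ, Tendsto (fun k => V k x) atTop (𝓝 (W x))) (hW : MemLp W 2 μ) (hu : MemLp u 2 μ) :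
    Tendsto (fun k => ∫ x, (inner ℝ (V k x) (u x) : ℝ) ∂μ) atTop (𝓝 (∫ x, (inner ℝ (W x) (u x) : ℝ) ∂μ)) := by
  have hVm : ∀ k, MemLp (V k) 2 μ := fun k =>
    memLp_two_of_lintegral_lt_top (hV k) ((hb k).trans_lt hC.lt_top)
  have hWu : MemLp (fun x => (inner ℝ (W x) (u x) : ℝ)) 1 μ :=
    memLp_one_iff_integrable.2 (integrable_inner_of_memLp_two hW hu)
  have hVu : ∀ k, Integrable (fun x => (inner ℝ (V k x) (u x) : ℝ)) μ := fun k => integrable_inner_of_memLp_two (hVm k) hu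
  set c : ℝ≥0∞ := C + 1 with hc
  have hc1 : ∀ k, eLpNorm (V k) 2 μ ≤ c := fun k => by
    have h1 : eLpNorm (V k) 2 μ ^ 2 ≤ C := eLpNorm_two_pow.trans_le (hb k)
    by_contra hcon
    rw [not_le] at hcon
    have h2 : c ^ 2 < C + 1 := by
      calc c ^ 2 ≤ eLpNorm (V k) 2 μ ^ 2 := by gcongr
        _ ≤ C := h1
        _ < C + 1 := ENNReal.lt_add_right hC one_ne_zero
    have h3 : c ≤ c ^ 2 := le_self_pow₀ (by simp [hc]) two_ne_zero
    exact absurd (h3.trans_lt h2) (lt_irrefl _)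
  have hc0 : c ≠ 0 := by simp [hc]
  have hct : c ≠ ∞ := by simp [hc, hC]
  -- Vitali's theorem applies, as the inner products with `u` are uniformly integrable
  have hUI : UnifIntegrable (fun k x => (inner ℝ (V k x) (u x) : ℝ)) 1 μ := by
    intro ε hε
    set ε' : ℝ := (ENNReal.ofReal ε / c).toReal with hε'
    have hε'0 : 0 < ε' := by
      apply ENNReal.toReal_pos
      · simp [ENNReal.div_eq_zero_iff, hε, hct]
      · exact ENNReal.div_ne_top ENNReal.ofReal_ne_top hc0
    obtain ⟨δ, hδ, h⟩ := hu.eLpNorm_indicator_le one_le_two (by simp) hε'0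
    refine ⟨δ, hδ, fun k s hs hμs => ?_⟩
    have e : s.indicator (fun x => (inner ℝ (V k x) (u x) : ℝ)) =
        fun x => (inner ℝ (V k x) (s.indicator u x) : ℝ) := by
      ext x
      by_cases hx : x ∈ s <;> simp [hx]
    rw [e]
    calc _ ≤ eLpNorm (V k) 2 μ * eLpNorm (s.indicator u) 2 μ := by
          refine eLpNorm_le_eLpNorm_mul_eLpNorm_of_nnnorm (p := 2) (q := 2) (r := 1) (hV k)
            (hu.aestronglyMeasurable.indicator hs) (fun a b => (inner ℝ a b : ℝ)) 1
            (ae_of_all _ fun x => ?_) |>.trans_eq (by simp)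
          rw [one_mul]; exact nnnorm_inner_le_nnnorm _ _
      _ ≤ c * ENNReal.ofReal ε' := mul_le_mul' (hc1 k) (h s hs hμs)
      _ = ENNReal.ofReal ε := by
          rw [hε', ENNReal.ofReal_toReal (ENNReal.div_ne_top ENNReal.ofReal_ne_top hc0),
            ENNReal.mul_div_cancel hc0 hct]
  have h := tendsto_Lp_finite_of_tendsto_ae le_rfl ENNReal.one_ne_top
    (fun k => (hVu k).aestronglyMeasurable) hWu hUI (by
      filter_upwards [hlim] with x hx
      exact hx.inner tendsto_const_nhds)
  exact tendsto_integral_of_L1' _ hWu.aestronglyMeasurable (Eventually.of_forall hVu) h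

end

/-- The gradients of the `C¹` functions with compact support in `U`, as a subspace of `L²(μ)`. -/
def gradientSpace {d : ℕ} (μ : Measure (Eu d)) (U : Set (Eu d)) : Submodule ℝ (Lp (Eu d) 2 μ) where
  carrier := {v | ∃ h : Eu d → ℝ, ContDiff ℝ 1 h ∧ HasCompactSupport h ∧ tsupport h ⊆ U ∧ v =ᵐ[μ] ∇ h}
  zero_mem' := ⟨fun _ => 0, contDiff_const, HasCompactSupport.zero, by simp [tsupport], by
    rw [gradient_fun_const']; exact Lp.coeFn_zero _ _ _⟩
  add_mem' := by
    rintro v w ⟨h, h1, h2, h3, h4⟩ ⟨g, g1, g2, g3, g4⟩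
    refine ⟨fun x => h x + g x, h1.add g1, h2.add g2, (tsupport_add h g).trans (union_subset h3 g3), ?_⟩
    filter_upwards [Lp.coeFn_add v w, h4, g4] with x hx hv hw
    rw [hx, Pi.add_apply, hv, hw,
      gradient_add_apply (h1.differentiable one_ne_zero x) (g1.differentiable one_ne_zero x)]
  smul_mem' := by
    rintro c v ⟨h, h1, h2, h3, h4⟩
    refine ⟨fun x => c * h x, contDiff_const.mul h1, h2.mul_left, (tsupport_mul_subset_right).trans h3, ?_⟩
    filter_upwards [Lp.coeFn_smul c v, h4] with x hx hv
    rw [hx, Pi.smul_apply, hv, gradient_const_mul_apply c (h1.differentiable one_ne_zero x)]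

/-- A quadratic bound that holds for the gradients of the test functions extends to every vector field
`W` that is an almost everywhere limit of such gradients with bounded `L²` norms. -/
lemma integral_inner_sub_le_of_ae_tendsto {d : ℕ} {μ : Measure (Eu d)} [IsFiniteMeasure μ]
    {β W : Eu d → Eu d} (hβ : MemLp β 2 μ) {U : Set (Eu d)} {Λ r : ℝ}
    (hr : ∀ h : Eu d → ℝ, ContDiff ℝ 1 h → HasCompactSupport h → tsupport h ⊆ U →
      (∫ x, (inner ℝ (∇ h x) (β x) : ℝ) ∂μ) - Λ * ∫ x, ‖∇ h x‖ ^ 2 ∂μ ≤ r)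
    {h : ℕ → Eu d → ℝ} (h1 : ∀ k, ContDiff ℝ 1 (h k)) (h2 : ∀ k, HasCompactSupport (h k))
    (h3 : ∀ k, tsupport (h k) ⊆ U) {C : ℝ≥0∞} (hC : C ≠ ∞)
    (hb : ∀ k, ∫⁻ x, ‖∇ (h k) x‖ₑ ^ 2 ∂μ ≤ C) (hW : MemLp W 2 μ)
    (hlim : ∀ᵐ x ∂μ, Tendsto (fun k => ∇ (h k) x) atTop (𝓝 (W x))) (c : ℝ) :
    c * (∫ x, (inner ℝ (W x) (β x) : ℝ) ∂μ) - Λ * (c ^ 2 * ∫ x, ‖W x‖ ^ 2 ∂μ) ≤ r := by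
  have hmem : ∀ k, MemLp (∇ (h k)) 2 μ := fun k =>
    (continuous_gradient (h1 k)).memLp_of_hasCompactSupport (hasCompactSupport_gradient (h2 k))
  have hinner : ∀ v w : Lp (Eu d) 2 μ, (inner ℝ v w : ℝ) = ∫ x, (inner ℝ (v x) (w x) : ℝ) ∂μ :=
    fun v w => L2.inner_def v w
  have hnorm : ∀ v : Lp (Eu d) 2 μ, ‖v‖ ^ 2 = ∫ x, ‖v x‖ ^ 2 ∂μ := fun v => by
    rw [← real_inner_self_eq_norm_sq, hinner]
    simp_rw [real_inner_self_eq_norm_sq]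
  have hcl : hW.toLp W ∈ (gradientSpace μ U).topologicalClosure := by
    refine mem_topologicalClosure_of_tendsto_inner _ (v := fun k => (hmem k).toLp _)
      (fun k => ⟨h k, h1 k, h2 k, h3 k, (hmem k).coeFn_toLp⟩) fun u => ?_
    have := tendsto_integral_inner_of_ae_tendsto (fun k => (hmem k).aestronglyMeasurable) hC hb hlim hW
      (Lp.memLp u)
    have e : ∀ {w : Eu d → Eu d} (hw : MemLp w 2 μ),
        (inner ℝ (hw.toLp w) u : ℝ) = ∫ x, (inner ℝ (w x) (u x) : ℝ) ∂μ := fun {w} hw => by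
      rw [hinner]
      refine integral_congr_ae ?_
      filter_upwards [hw.coeFn_toLp] with x hx
      rw [hx]
    rw [e hW]
    simp_rw [e (hmem _)]
    exact this
  have hclosed : IsClosed {v : Lp (Eu d) 2 μ | (inner ℝ v (hβ.toLp β) : ℝ) - Λ * ‖v‖ ^ 2 ≤ r} :=
    isClosed_le ((continuous_id.inner continuous_const).sub
      (continuous_const.mul (continuous_norm.pow 2))) continuous_const
  have hsub : ((gradientSpace μ U).topologicalClosure : Set (Lp (Eu d) 2 μ)) ⊆
      {v | (inner ℝ v (hβ.toLp β) : ℝ) - Λ * ‖v‖ ^ 2 ≤ r} := by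
    refine closure_minimal ?_ hclosed
    rintro v ⟨g, g1, g2, g3, g4⟩
    refine le_trans (le_of_eq ?_) (hr g g1 g2 g3)
    rw [hinner, hnorm]
    congr 1
    · refine integral_congr_ae ?_
      filter_upwards [g4, hβ.coeFn_toLp] with x hx hx'
      rw [hx, hx']
    · congr 1
      refine integral_congr_ae ?_
      filter_upwards [g4] with x hx
      rw [hx]
  -- the closure is a subspace, hence contains the multiples of `W`
  have h5 := hsub ((gradientSpace μ U).topologicalClosure.smul_mem c hcl)
  change (inner ℝ (c • hW.toLp W) (hβ.toLp β) : ℝ) - Λ * ‖c • hW.toLp W‖ ^ 2 ≤ r at h5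
  rw [real_inner_smul_left, norm_smul, mul_pow, hinner, hnorm, Real.norm_eq_abs, sq_abs] at h5
  refine le_trans (le_of_eq ?_) h5
  congr 1
  · congr 1
    refine integral_congr_ae ?_
    filter_upwards [hW.coeFn_toLp, hβ.coeFn_toLp] with x hx hx'
    rw [hx, hx']
  · congr 2
    refine integral_congr_ae ?_
    filter_upwards [hW.coeFn_toLp] with x hx
    rw [hx]

/-! ### The density, its score and the rate functional at a fixed time -/

/-- The product of a matrix and a vector of `ℝᵈ`, as a vector of `ℝᵈ`. -/
noncomputable def matVec {d : ℕ} (M : Matrix (Fin d) (Fin d) ℝ) (v : Eu d) : Eu d :=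
  WithLp.toLp 2 (fun i => ∑ j, M i j * v j)

/-- The classical divergence of a matrix function, taken row by row. -/
noncomputable def rowDivergence {d : ℕ} (A : Eu d → Matrix (Fin d) (Fin d) ℝ) (x : Eu d) : Eu d :=
  WithLp.toLp 2 (fun i => divergence (fun y => WithLp.toLp 2 (A y i)) x)

/-- The coefficients and the density of the fast diffusion at a fixed time, with the bounds on the
coefficients that enter the constant: `A` and `α` are the diffusion matrix and the drift, `Dm` is the
weak gradient of the density `m`, and `D` is the weak divergence of `m A`. -/
structure FixedTime {d : ℕ} (K : ℝ≥0) (κ : ℝ) (A : Eu d → Matrix (Fin d) (Fin d) ℝ) (α : Eu d → Eu d)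
    (m : Eu d → ℝ≥0) (Dm D : Eu d → Eu d) : Prop where
  contDiff : ∀ i j, ContDiff ℝ 1 (fun x => A x i j)
  bound : ∀ x i j, |A x i j| ≤ K
  bound_gradient : ∀ x i j, ‖∇ (fun y => A y i j) x‖ ≤ K
  elliptic : ∀ x v, κ * ‖v‖ ^ 2 ≤ quadForm (A x) v
  lipschitz : LipschitzWith K α
  bound_zero : ‖α 0‖ ≤ K
  mass : ∫⁻ x, (m x : ℝ≥0∞) = 1
  weakGradient : HasWeakGradient (fun x => (m x : ℝ)) Dm
  weakDivergence : HasWeakDivergence (fun x => (m x : ℝ) • A x) D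
  fisher_lt_top : ∀ r, ∫⁻ x in Metric.closedBall 0 r, fisherDensity m Dm x < ∞

/-- The score `Dm / m`, which is `0` where `m` vanishes. -/
noncomputable def score {d : ℕ} (m : Eu d → ℝ≥0) (Dm : Eu d → Eu d) (x : Eu d) : Eu d :=
  (m x : ℝ)⁻¹ • Dm x

/-- The measure with density `m`. -/
noncomputable def densityMeasure {d : ℕ} (m : Eu d → ℝ≥0) : Measure (Eu d) :=
  volume.withDensity (fun x => (m x : ℝ≥0∞))

lemma densityMeasure_ac {d : ℕ} (m : Eu d → ℝ≥0) : densityMeasure m ≪ volume :=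
  withDensity_absolutelyContinuous _ _

/-- The vector field `β` with `½ div (A m) - α m = m β`. -/
noncomputable def rateField {d : ℕ} (A : Eu d → Matrix (Fin d) (Fin d) ℝ) (α : Eu d → Eu d)
    (m : Eu d → ℝ≥0) (Dm : Eu d → Eu d) (x : Eu d) : Eu d :=
  (1 / 2 : ℝ) • rowDivergence A x + (1 / 2 : ℝ) • matVec (A x) (score m Dm x) - α x

section
variable {d : ℕ}

lemma norm_le_card_mul {v : Eu d} {c : ℝ} (h : ∀ i, |v i| ≤ c) : ‖v‖ ≤ d * c := by
  have h1 : ‖v‖ ≤ ∑ i, |v i| := by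
    have : v = ∑ i, EuclideanSpace.single i (v i) := by
      ext j; simp [Finset.sum_apply]
    calc ‖v‖ = ‖∑ i, EuclideanSpace.single i (v i)‖ := by rw [← this]
      _ ≤ ∑ i, ‖EuclideanSpace.single i (v i)‖ := norm_sum_le _ _
      _ = _ := by simp
  refine h1.trans ((Finset.sum_le_card_nsmul _ _ c fun i _ => h i).trans_eq (by simp))

lemma abs_sum_mul_le {K : ℝ} {a : Fin d → ℝ} (h : ∀ j, |a j| ≤ K) (v : Eu d) :
    |∑ j, a j * v j| ≤ d * (K * ‖v‖) := by
  refine (Finset.abs_sum_le_sum_abs _ _).trans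
    ((Finset.sum_le_card_nsmul _ _ (K * ‖v‖) fun i _ => ?_).trans_eq (by simp))
  rw [abs_mul]
  have : |v i| ≤ ‖v‖ := PiLp.norm_apply_le v i
  exact mul_le_mul (h i) this (abs_nonneg _) ((abs_nonneg _).trans (h i))

lemma norm_matVec_le {K : ℝ} {M : Matrix (Fin d) (Fin d) ℝ} (h : ∀ i j, |M i j| ≤ K) (v : Eu d) :
    ‖matVec M v‖ ≤ d ^ 2 * K * ‖v‖ := by
  refine (norm_le_card_mul (c := d * (K * ‖v‖)) fun i => abs_sum_mul_le (h i) v).trans_eq (by ring)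

lemma inner_matVec_self (M : Matrix (Fin d) (Fin d) ℝ) (v : Eu d) :
    (inner ℝ v (matVec M v) : ℝ) = quadForm M v := by
  rw [real_inner_eq_sum, quadForm]
  refine Finset.sum_congr rfl fun i _ => ?_
  change v i * ∑ j, M i j * v j = _
  rw [Finset.mul_sum]
  exact Finset.sum_congr rfl fun j _ => by ring

lemma quadForm_le {K : ℝ} {M : Matrix (Fin d) (Fin d) ℝ} (h : ∀ i j, |M i j| ≤ K) (v : Eu d) :
    quadForm M v ≤ d ^ 2 * K * ‖v‖ ^ 2 := by
  rw [← inner_matVec_self]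
  refine (real_inner_le_norm _ _).trans ?_
  calc _ ≤ ‖v‖ * (d ^ 2 * K * ‖v‖) := by gcongr; exact norm_matVec_le h v
    _ = _ := by ring

end

namespace FixedTime

variable {d : ℕ} {K : ℝ≥0} {κ : ℝ} {A : Eu d → Matrix (Fin d) (Fin d) ℝ} {α : Eu d → Eu d}
  {m : Eu d → ℝ≥0} {Dm D : Eu d → Eu d}

section
variable (H : FixedTime K κ A α m Dm D)
include H

lemma aemeasurable_density : AEMeasurable m := by
  have := H.weakGradient.locallyIntegrable.aestronglyMeasurable.aemeasurable.real_toNNReal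
  simpa using this

lemma aestronglyMeasurable_grad : AEStronglyMeasurable Dm :=
  H.weakGradient.locallyIntegrable_grad.aestronglyMeasurable

lemma isProbabilityMeasure : IsProbabilityMeasure (densityMeasure m) :=
  ⟨by rw [densityMeasure, withDensity_apply _ MeasurableSet.univ, Measure.restrict_univ]; exact H.mass⟩

lemma integral_density (F : Eu d → ℝ) : ∫ x, F x ∂(densityMeasure m) = ∫ x, (m x : ℝ) * F x :=
  integral_withDensity_eq_integral_smul₀ H.aemeasurable_density F

lemma setIntegral_density (F : Eu d → ℝ) {U : Set (Eu d)} (hF : ∀ x, x ∉ U → F x = 0) :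
    ∫ x in U, F x ∂(densityMeasure m) = ∫ x, (m x : ℝ) * F x := by
  rw [setIntegral_eq_integral_of_forall_compl_eq_zero hF, H.integral_density]

lemma setLIntegral_density (F : Eu d → ℝ≥0∞) {U : Set (Eu d)} (hU : MeasurableSet U) :
    ∫⁻ x in U, F x ∂(densityMeasure m) = ∫⁻ x in U, F x * m x := by
  rw [densityMeasure, setLIntegral_withDensity_eq_setLIntegral_mul_non_measurable₀ _
    H.aemeasurable_density.coe_nnreal_ennreal.restrict _ hU (ae_of_all _ fun x => ENNReal.coe_lt_top)]
  simp_rw [Pi.mul_apply, mul_comm]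

lemma aestronglyMeasurable_score : AEStronglyMeasurable (score m Dm) :=
  (H.weakGradient.locallyIntegrable.aestronglyMeasurable.aemeasurable.inv.aestronglyMeasurable).smul
    H.aestronglyMeasurable_grad

lemma ae_fisher_lt_top : ∀ᵐ x, fisherDensity m Dm x < ∞ := by
  have hm : AEMeasurable (fisherDensity m Dm) :=
    (H.aestronglyMeasurable_grad.enorm.pow_const 2).div H.aemeasurable_density.coe_nnreal_ennreal
  have h : ∀ n : ℕ, ∀ᵐ x, x ∈ Metric.closedBall (0 : Eu d) n → fisherDensity m Dm x < ∞ := fun n => by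
    rw [← ae_restrict_iff' Metric.isClosed_closedBall.measurableSet]
    exact ae_lt_top' hm.restrict (H.fisher_lt_top n).ne
  filter_upwards [ae_all_iff.2 h] with x hx
  obtain ⟨n, hn⟩ := exists_nat_ge ‖x‖
  exact hx n (by simpa using hn)

/-- Finiteness of the Fisher information forces the weak gradient to vanish where the density does. -/
lemma ae_grad_eq : ∀ᵐ x, Dm x = (m x : ℝ) • score m Dm x := by
  filter_upwards [H.ae_fisher_lt_top] with x hx
  by_cases h0 : m x = 0
  · by_contra hne
    have h1 : Dm x ≠ 0 := fun h => hne (by simp [score, h])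
    rw [fisherDensity, h0, ENNReal.coe_zero, ENNReal.div_zero (by simpa using h1)] at hx
    exact lt_irrefl _ hx
  · rw [score, smul_smul, mul_inv_cancel₀ (by simpa using h0), one_smul]

lemma ae_fisher_eq : ∀ᵐ x, fisherDensity m Dm x = ‖score m Dm x‖ₑ ^ 2 * m x := by
  filter_upwards [H.ae_grad_eq] with x hx
  by_cases h0 : m x = 0
  · have : Dm x = 0 := by rw [hx, h0]; simp
    simp [fisherDensity, this, h0]
  · rw [fisherDensity, hx, enorm_smul, mul_pow, Real.enorm_of_nonneg (by positivity),
      ENNReal.ofReal_coe_nnreal, sq (m x : ℝ≥0∞), mul_assoc, mul_div_assoc,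
      mul_div_assoc, mul_comm _ (m x : ℝ≥0∞)]
    congr 1
    exact ENNReal.mul_div_cancel (by simpa using h0) ENNReal.coe_ne_top

end

end FixedTime

lemma restrict_densityMeasure_ac {d : ℕ} (m : Eu d → ℝ≥0) (U : Set (Eu d)) :
    (densityMeasure m).restrict U ≪ volume :=
  Measure.absolutelyContinuous_restrict.trans (densityMeasure_ac m)

lemma memLp_two_of_bound_mul {d : ℕ} {m : Eu d → ℝ≥0} {F G : Eu d → Eu d} (hF : AEStronglyMeasurable F) (R : ℝ)
    (hG : MemLp G 2 ((densityMeasure m).restrict (Metric.closedBall 0 R))) {C : ℝ}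
    (h : ∀ x, ‖F x‖ ≤ C * ‖G x‖) : MemLp F 2 ((densityMeasure m).restrict (Metric.closedBall 0 R)) :=
  hG.of_le_mul (hF.mono_ac (restrict_densityMeasure_ac m _)) (ae_of_all _ h)

namespace FixedTime

variable {d : ℕ} {K : ℝ≥0} {κ : ℝ} {A : Eu d → Matrix (Fin d) (Fin d) ℝ} {α : Eu d → Eu d}
  {m : Eu d → ℝ≥0} {Dm D : Eu d → Eu d}

section
variable (H : FixedTime K κ A α m Dm D)
include H

lemma memLp_score (R : ℝ) :
    MemLp (score m Dm) 2 ((densityMeasure m).restrict (Metric.closedBall 0 R)) := by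
  refine memLp_two_of_lintegral_lt_top (H.aestronglyMeasurable_score.mono_ac (restrict_densityMeasure_ac m _)) ?_
  rw [H.setLIntegral_density _ Metric.isClosed_closedBall.measurableSet]
  refine lt_of_le_of_lt (lintegral_mono_ae (ae_restrict_of_ae ?_)) (H.fisher_lt_top R)
  filter_upwards [H.ae_fisher_eq] with x hx using hx.ge

lemma memLp_of_continuous {F : Eu d → Eu d} (hF : Continuous F) (R : ℝ) :
    MemLp F 2 ((densityMeasure m).restrict (Metric.closedBall 0 R)) := by
  have := H.isProbabilityMeasure
  obtain ⟨C, hC⟩ := (isCompact_closedBall (0 : Eu d) R).exists_bound_of_continuousOn hF.continuousOn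
  exact MemLp.of_bound hF.aestronglyMeasurable C ((ae_restrict_mem Metric.isClosed_closedBall.measurableSet).mono
    fun x hx => hC x hx)

lemma continuous_rowDivergence : Continuous (rowDivergence A) := by
  refine (PiLp.continuous_toLp 2 _).comp (continuous_pi fun i => ?_)
  exact continuous_finsetSum _ fun j _ =>
    (EuclideanSpace.proj (𝕜 := ℝ) j).continuous.comp (continuous_gradient (H.contDiff i j))

lemma norm_rowDivergence_le (x : Eu d) : ‖rowDivergence A x‖ ≤ d ^ 2 * K := by
  refine (norm_le_card_mul (c := d * K) fun i => ?_).trans_eq (by ring)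
  calc _ ≤ ∑ j, |(∇ (fun y => A y i j) x) j| := Finset.abs_sum_le_sum_abs _ _
    _ ≤ ∑ _j : Fin d, (K : ℝ) := Finset.sum_le_sum fun j _ =>
        (PiLp.norm_apply_le _ j).trans (H.bound_gradient x i j)
    _ = _ := by simp

lemma aestronglyMeasurable_matVec {v : Eu d → Eu d} (hv : AEStronglyMeasurable v) :
    AEStronglyMeasurable (fun x => matVec (A x) (v x)) := by
  refine (PiLp.continuous_toLp 2 _).comp_aestronglyMeasurable ?_
  refine (aemeasurable_pi_lambda _ fun i => ?_).aestronglyMeasurable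
  refine Finset.aemeasurable_fun_sum _ fun j _ => ?_
  exact (H.contDiff i j).continuous.measurable.aemeasurable.mul
    ((EuclideanSpace.proj (𝕜 := ℝ) j).continuous.comp_aestronglyMeasurable hv).aemeasurable

lemma memLp_matVec_score (R : ℝ) : MemLp (fun x => matVec (A x) (score m Dm x)) 2
    ((densityMeasure m).restrict (Metric.closedBall 0 R)) :=
  memLp_two_of_bound_mul (H.aestronglyMeasurable_matVec H.aestronglyMeasurable_score) R (H.memLp_score R)
    fun x => norm_matVec_le (H.bound x) _

lemma memLp_rateField (R : ℝ) :
    MemLp (rateField A α m Dm) 2 ((densityMeasure m).restrict (Metric.closedBall 0 R)) :=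
  (((H.memLp_of_continuous H.continuous_rowDivergence R).const_smul (1 / 2 : ℝ)).add
    ((H.memLp_matVec_score R).const_smul (1 / 2 : ℝ))).sub
    (H.memLp_of_continuous H.lipschitz.continuous R)

lemma ae_rateField : ∀ᵐ x, (1 / 2 : ℝ) • D x - (m x : ℝ) • α x = (m x : ℝ) • rateField A α m Dm x := by
  filter_upwards [HasWeakDivergence.ae_eq H.weakDivergence H.weakGradient H.contDiff, H.ae_grad_eq] with x h1 h2
  ext i
  have e : ∑ j, A x i j * Dm x j = (m x : ℝ) * ∑ j, A x i j * score m Dm x j := by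
    rw [Finset.mul_sum]
    refine Finset.sum_congr rfl fun j _ => ?_
    rw [h2]
    simp only [PiLp.smul_apply, smul_eq_mul]
    ring
  simp only [rateField, PiLp.sub_apply, PiLp.smul_apply, PiLp.add_apply, smul_eq_mul, h1 i, e]
  simp only [rowDivergence, matVec]
  ring

/-- On test functions, the variational functional is bounded from below in terms of `rateField`. -/
lemma integral_inner_rateField_sub_le (hfin : fastRate A α m D ≠ ∞) (R : ℝ) {h : Eu d → ℝ}
    (h1 : ContDiff ℝ 1 h) (h2 : HasCompactSupport h) (h3 : tsupport h ⊆ Metric.closedBall 0 R) :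
    (∫ x, (inner ℝ (∇ h x) (rateField A α m Dm x) : ℝ) ∂(densityMeasure m).restrict (Metric.closedBall 0 R)) -
      (d ^ 2 * K + 1) / 2 * ∫ x, ‖∇ h x‖ ^ 2 ∂(densityMeasure m).restrict (Metric.closedBall 0 R) ≤
      (fastRate A α m D).toReal := by
  set μ := (densityMeasure m).restrict (Metric.closedBall 0 R) with hμ
  have hprob := H.isProbabilityMeasure
  have hF : fastFunctional A α m D h ≤ (fastRate A α m D).toReal := by
    have : ENNReal.ofReal (fastFunctional A α m D h) ≤ fastRate A α m D :=
      le_iSup (fun h : {h : Eu d → ℝ // ContDiff ℝ 1 h ∧ HasCompactSupport h} =>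
        ENNReal.ofReal (fastFunctional A α m D h.1)) ⟨h, h1, h2⟩
    exact (ENNReal.ofReal_le_iff_le_toReal hfin).1 this
  refine le_trans ?_ hF
  have hgc := continuous_gradient h1
  have hgl : MemLp (∇ h) 2 μ := H.memLp_of_continuous hgc R
  have hi1 : Integrable (fun x => (inner ℝ (∇ h x) (rateField A α m Dm x) : ℝ)) μ :=
    integrable_inner_of_memLp_two hgl (H.memLp_rateField R)
  have hi2 : Integrable (fun x => ‖∇ h x‖ ^ 2) μ := by
    have := integrable_inner_of_memLp_two hgl hgl
    simpa only [real_inner_self_eq_norm_sq] using this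
  have hi3 : Integrable (fun x => quadForm (A x) (∇ h x)) μ := by
    simp_rw [← inner_matVec_self]
    exact integrable_inner_of_memLp_two hgl (memLp_two_of_bound_mul
      (H.aestronglyMeasurable_matVec hgc.aestronglyMeasurable) R hgl fun x => norm_matVec_le (H.bound x) _)
  have h0 : ∀ x, x ∉ Metric.closedBall (0 : Eu d) R → ∇ h x = 0 := fun x hx => by
    by_contra hne
    exact hx (h3 (tsupport_gradient_subset h (subset_tsupport _ hne)))
  have e : fastFunctional A α m D h =
      ∫ x, ((inner ℝ (∇ h x) (rateField A α m Dm x) : ℝ) - 1 / 2 * quadForm (A x) (∇ h x)) ∂μ := by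
    rw [hμ, H.setIntegral_density _ fun x hx => by simp [h0 x hx, quadForm]]
    refine integral_congr_ae ?_
    filter_upwards [H.ae_rateField] with x hx
    rw [hx, real_inner_smul_right]
    ring
  rw [e, integral_sub hi1 (hi3.const_mul _), integral_const_mul]
  have hle : ∫ x, quadForm (A x) (∇ h x) ∂μ ≤ (d ^ 2 * K + 1) * ∫ x, ‖∇ h x‖ ^ 2 ∂μ := by
    rw [← integral_const_mul]
    refine integral_mono hi3 (hi2.const_mul _) fun x => (quadForm_le (H.bound x) _).trans ?_
    have := sq_nonneg ‖∇ h x‖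
    nlinarith
  linarith

end

end FixedTime

/-! ### The gradient of the truncated logarithm as a test field -/

lemma norm_add_sq_le {E : Type*} [SeminormedAddCommGroup E] (v w : E) :
    ‖v + w‖ ^ 2 ≤ 2 * ‖v‖ ^ 2 + 2 * ‖w‖ ^ 2 := by
  have := norm_add_le v w
  have h0 := norm_nonneg (v + w)
  nlinarith [sq_nonneg (‖v‖ - ‖w‖)]

lemma enorm_add_sq_le {E : Type*} [SeminormedAddCommGroup E] (v w : E) :
    ‖v + w‖ₑ ^ 2 ≤ 2 * ‖v‖ₑ ^ 2 + 2 * ‖w‖ₑ ^ 2 := by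
  rw [← ofReal_norm, ← ofReal_norm, ← ofReal_norm, ← ENNReal.ofReal_pow (norm_nonneg _),
    ← ENNReal.ofReal_pow (norm_nonneg _), ← ENNReal.ofReal_pow (norm_nonneg _),
    ← ENNReal.ofReal_ofNat 2, ← ENNReal.ofReal_mul (by norm_num), ← ENNReal.ofReal_mul (by norm_num),
    ← ENNReal.ofReal_add (by positivity) (by positivity)]
  apply ENNReal.ofReal_le_ofReal
  exact norm_add_sq_le v w

lemma norm_mollify_le_of_bound {d : ℕ} {E : Type*} [NormedAddCommGroup E] [NormedSpace ℝ E] (k : ℕ)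
    {f : Eu d → E} {C : ℝ} (hf : ∀ x, ‖f x‖ ≤ C) (x : Eu d) : ‖mollify k f x‖ ≤ C := by
  rw [mollify_apply]
  calc _ ≤ ∫ t, molKernel d k t * C := by
        refine norm_integral_le_of_norm_le ((integrable_molKernel d k).mul_const _) (ae_of_all _ fun t => ?_)
        rw [norm_smul, Real.norm_of_nonneg (molKernel_nonneg d k t)]
        exact mul_le_mul_of_nonneg_left (hf _) (molKernel_nonneg d k t)
    _ = _ := by rw [integral_mul_const, integral_molKernel, one_mul]

/-- A continuous bounded function on `[0, ∞)` has an antiderivative of linear growth. -/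
lemma exists_antiderivative {S : ℝ → ℝ} (hS : ContinuousOn S (Ici 0)) {M : ℝ} (hM : ∀ u, 0 ≤ u → |S u| ≤ M) :
    ∃ P : ℝ → ℝ, (∀ u, 0 ≤ u → HasDerivAt P (S u) u) ∧ ∀ u, 0 ≤ u → |P u| ≤ M * u := by
  have hc := continuous_comp_max hS
  have hd : ∀ u, 0 ≤ u → HasDerivAt (fun u => ∫ v in (0 : ℝ)..u, S (max v 0)) (S u) u := fun u hu => by
    have := intervalIntegral.integral_hasDerivAt_right (hc.intervalIntegrable 0 u)
      (hc.stronglyMeasurableAtFilter _ _) hc.continuousAt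
    rwa [max_eq_left hu] at this
  refine ⟨_, hd, fun u hu => ?_⟩
  have := abs_sub_le_of_hasDerivAt_nonneg hd hM hu le_rfl
  simpa [abs_of_nonneg hu] using this

section cutoff
variable {d : ℕ}

lemma stdBump_eq_zero {R : ℝ} (hR : 0 < R) {x : Eu d} (hx : 2 * R < ‖x‖) : stdBump R hR x = 0 :=
  (stdBump R hR).zero_of_le_dist (by simpa [stdBump] using hx.le)

lemma stdBump_eq_one {R : ℝ} (hR : 0 < R) {x : Eu d} (hx : ‖x‖ ≤ R) : stdBump R hR x = 1 :=
  (stdBump R hR).one_of_mem_closedBall (by simpa [stdBump] using hx)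

lemma tsupport_stdBump {R : ℝ} (hR : 0 < R) :
    tsupport (stdBump (d := d) R hR) = Metric.closedBall 0 (2 * R) :=
  (stdBump R hR).tsupport_eq

lemma gradient_stdBump_eq_zero_of_lt {R : ℝ} (hR : 0 < R) {x : Eu d} (hx : ‖x‖ < R) :
    ∇ (stdBump R hR) x = 0 := by
  have : (stdBump (d := d) R hR : Eu d → ℝ) =ᶠ[𝓝 x] fun _ => 1 :=
    (stdBump R hR).eventuallyEq_one_of_mem_ball (by simpa [stdBump] using hx)
  rw [this.gradient_eq, gradient_fun_const]

lemma gradient_stdBump_eq_zero_of_gt {R : ℝ} (hR : 0 < R) {x : Eu d} (hx : 2 * R < ‖x‖) :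
    ∇ (stdBump R hR) x = 0 := by
  by_contra hne
  have := tsupport_gradient_subset _ (subset_tsupport _ hne)
  rw [tsupport_stdBump] at this
  simp at this; linarith

/-- The gradient of the cutoff at scale `R` compensates linear growth, and it lives where `R ≤ |x|`. -/
lemma norm_gradient_stdBump_mul_le {C : ℝ} (hC0 : 0 ≤ C) (hC : ∀ (r : ℝ) (hr : 0 < r) (x : Eu d), ‖∇ (stdBump r hr) x‖ ≤ C / r)
    {R : ℝ} (hR : 1 ≤ R) (x : Eu d) :
    ‖∇ (stdBump R (one_pos.trans_le hR)) x‖ * (1 + ‖x‖) ≤ {x : Eu d | R ≤ ‖x‖}.indicator (fun _ => 3 * C) x := by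
  have hR0 := one_pos.trans_le hR
  by_cases h1 : R ≤ ‖x‖
  · rw [indicator_of_mem (by exact h1)]
    by_cases h2 : 2 * R < ‖x‖
    · rw [gradient_stdBump_eq_zero_of_gt hR0 h2]; simp; positivity
    · calc _ ≤ C / R * (1 + ‖x‖) := by gcongr; exact hC _ _ _
        _ ≤ C / R * (3 * R) := by gcongr; linarith
        _ = _ := by field_simp
  · rw [indicator_of_notMem (by exact h1), gradient_stdBump_eq_zero_of_lt hR0 (not_le.1 h1)]; simp

end cutoff

/-- The weight of the score in `testField` takes its values in `[0, 1]`. -/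
lemma weight_mem {d : ℕ} (m : Eu d → ℝ≥0) {δ : ℝ} (hδ : 0 < δ) (hδ1 : δ < 1) (R : ℝ) (hR : 0 < R) (x : Eu d) :
    0 ≤ stdBump R hR x * (m x * truncInv δ (m x)) ∧ stdBump R hR x * (m x * truncInv δ (m x)) ≤ 1 := by
  have h1 := (stdBump R hR).nonneg' x
  have h2 : stdBump R hR x ≤ 1 := (stdBump R hR).le_one
  have h3 := truncInv_nonneg hδ hδ1 (m x).2
  have h4 := mul_truncInv_le hδ hδ1 (m x).2
  have h5 : 0 ≤ (m x : ℝ) * truncInv δ (m x) := mul_nonneg (m x).2 h3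
  exact ⟨mul_nonneg h1 h5, mul_le_one₀ h2 h5 h4⟩

namespace FixedTime

variable {d : ℕ} {K : ℝ≥0} {κ : ℝ} {A : Eu d → Matrix (Fin d) (Fin d) ℝ} {α : Eu d → Eu d}
  {m : Eu d → ℝ≥0} {Dm D : Eu d → Eu d}

section
variable (H : FixedTime K κ A α m Dm D)
include H

lemma hasWeakGradient_truncLog {δ : ℝ} (hδ : 0 < δ) (hδ1 : δ < 1) :
    HasWeakGradient (fun x => truncLog δ (m x)) (fun x => truncInv δ (m x) • Dm x) :=
  H.weakGradient.comp_nonneg (fun x => (m x).2) (fun _ hu => hasDerivAt_truncLog hδ hu)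
    (continuousOn_truncInv hδ) (fun _ hu => abs_truncInv_le hδ hδ1 hu)

lemma aestronglyMeasurable_truncInv {δ : ℝ} (hδ : 0 < δ) :
    AEStronglyMeasurable (fun x => truncInv δ (m x)) :=
  aestronglyMeasurable_comp_nonneg (continuousOn_truncInv hδ)
    H.weakGradient.locallyIntegrable.aestronglyMeasurable fun x => (m x).2

lemma aestronglyMeasurable_weight {δ : ℝ} (hδ : 0 < δ) (R : ℝ) (hR : 0 < R) :
    AEStronglyMeasurable (fun x => stdBump R hR x * ((m x : ℝ) * truncInv δ (m x))) :=
  (stdBump R hR).continuous.aestronglyMeasurable.mul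
    (H.weakGradient.locallyIntegrable.aestronglyMeasurable.mul (H.aestronglyMeasurable_truncInv hδ))

end

/-- The weak gradient of the cutoff `stdBump R` times `truncLog δ (m ·)`, written in terms of the
score. The test functions approximate it, although `truncLog δ (m ·)` itself need not be of class `C¹`. -/
noncomputable def testField {d : ℕ} (m : Eu d → ℝ≥0) (Dm : Eu d → Eu d) (δ R : ℝ) (hR : 0 < R)
    (x : Eu d) : Eu d :=
  (stdBump R hR x * (m x * truncInv δ (m x))) • score m Dm x + truncLog δ (m x) • ∇ (stdBump R hR) x

section
variable (H : FixedTime K κ A α m Dm D) {δ : ℝ} (hδ : 0 < δ) (hδ1 : δ < 1)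
include H hδ hδ1

lemma memLp_weight_smul_score (R r : ℝ) (hR : 0 < R) :
    MemLp (fun x => (stdBump R hR x * (m x * truncInv δ (m x))) • score m Dm x) 2
      ((densityMeasure m).restrict (Metric.closedBall 0 r)) := by
  refine memLp_two_of_bound_mul ((H.aestronglyMeasurable_weight hδ R hR).smul
    H.aestronglyMeasurable_score) r (H.memLp_score r) (C := 1) fun x => ?_
  have := weight_mem m hδ hδ1 R hR x
  rw [Pi.smul_apply', norm_smul, Real.norm_of_nonneg this.1]
  exact mul_le_mul_of_nonneg_right this.2 (norm_nonneg _)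

lemma memLp_truncLog_smul_gradient (R r : ℝ) (hR : 0 < R) :
    MemLp (fun x => truncLog δ (m x) • ∇ (stdBump R hR) x) 2
      ((densityMeasure m).restrict (Metric.closedBall 0 r)) := by
  have hg := continuous_gradient ((stdBump (d := d) R hR).contDiff (n := 1))
  refine memLp_two_of_bound_mul ((H.hasWeakGradient_truncLog hδ hδ1).locallyIntegrable.aestronglyMeasurable.smul
    hg.aestronglyMeasurable) r (H.memLp_of_continuous hg r) (C := - Real.log δ) fun x => ?_
  rw [Pi.smul_apply', norm_smul]
  exact mul_le_mul_of_nonneg_right (abs_truncLog_le hδ hδ1 (m x).2) (norm_nonneg _)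

lemma memLp_testField (R r : ℝ) (hR : 0 < R) :
    MemLp (testField m Dm δ R hR) 2 ((densityMeasure m).restrict (Metric.closedBall 0 r)) :=
  (H.memLp_weight_smul_score hδ hδ1 R r hR).add (H.memLp_truncLog_smul_gradient hδ hδ1 R r hR)

/-- The variational bound extends from gradients of test functions to multiples of `testField`. -/
lemma integral_testField_le (hfin : fastRate A α m D ≠ ∞) (R : ℝ) (hR : 0 < R) (c : ℝ) :
    c * (∫ x, (inner ℝ (testField m Dm δ R hR x) (rateField A α m Dm x) : ℝ)
        ∂(densityMeasure m).restrict (Metric.closedBall 0 (2 * R))) -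
      (d ^ 2 * K + 1) / 2 * (c ^ 2 * ∫ x, ‖testField m Dm δ R hR x‖ ^ 2
        ∂(densityMeasure m).restrict (Metric.closedBall 0 (2 * R))) ≤ (fastRate A α m D).toReal := by
  have hprob := H.isProbabilityMeasure
  set μ := (densityMeasure m).restrict (Metric.closedBall 0 (2 * R)) with hμ
  have hT := H.hasWeakGradient_truncLog hδ hδ1
  have hφ : ContDiff ℝ 1 (stdBump (d := d) R hR) := (stdBump R hR).contDiff (n := 1)
  have hmk : ∀ k, ContDiff ℝ 1 (mollify k (fun y => truncLog δ (m y))) := fun k =>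
    contDiff_mollify k hT.locallyIntegrable (n := 1)
  obtain ⟨C, hC, hCk⟩ := exists_bound_lintegral_gradient_mollify_truncLog H.weakGradient H.fisher_lt_top
    hδ hδ1 (2 * R)
  obtain ⟨B, hB⟩ := (hasCompactSupport_gradient (stdBump (d := d) R hR).hasCompactSupport).exists_bound_of_continuous
    (continuous_gradient hφ)
  have hgrad : ∀ k x, ∇ (fun y => stdBump R hR y * mollify k (fun y => truncLog δ (m y)) y) x =
      stdBump R hR x • ∇ (mollify k (fun y => truncLog δ (m y))) x +
        mollify k (fun y => truncLog δ (m y)) x • ∇ (stdBump R hR) x := fun k x =>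
    gradient_mul_apply (hφ.differentiable one_ne_zero x) ((hmk k).differentiable one_ne_zero x)
  refine integral_inner_sub_le_of_ae_tendsto (H.memLp_rateField (2 * R)) (U := Metric.closedBall 0 (2 * R))
    (fun h h1 h2 h3 => H.integral_inner_rateField_sub_le hfin (2 * R) h1 h2 h3)
    (h := fun k y => stdBump R hR y * mollify k (fun y => truncLog δ (m y)) y)
    (fun k => hφ.mul (hmk k)) (fun k => (stdBump R hR).hasCompactSupport.mul_right) (fun k => ?_)
    (C := 2 * C + 2 * ENNReal.ofReal ((- Real.log δ) * B) ^ 2) (by finiteness) (fun k => ?_)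
    (H.memLp_testField hδ hδ1 R (2 * R) hR) ?_ c
  · exact (tsupport_mul_subset_left).trans (tsupport_stdBump hR).subset
  · calc _ ≤ ∫⁻ x, 2 * ‖∇ (mollify k (fun y => truncLog δ (m y))) x‖ₑ ^ 2 +
          2 * ENNReal.ofReal ((- Real.log δ) * B) ^ 2 ∂μ := by
          refine lintegral_mono fun x => ?_
          rw [hgrad]
          refine (enorm_add_sq_le _ _).trans (add_le_add ?_ ?_)
          · gcongr
            rw [enorm_smul, Real.enorm_of_nonneg ((stdBump R hR).nonneg' x)]
            exact mul_le_of_le_one_left' (ENNReal.ofReal_le_one.2 (stdBump R hR).le_one)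
          · gcongr
            rw [← ofReal_norm, norm_smul]
            apply ENNReal.ofReal_le_ofReal
            refine mul_le_mul (norm_mollify_le_of_bound k (fun y => ?_) x) (hB x) (norm_nonneg _) ?_
            · exact abs_truncLog_le hδ hδ1 (m y).2
            · have := Real.log_neg hδ hδ1; linarith
      _ = 2 * (∫⁻ x, ‖∇ (mollify k (fun y => truncLog δ (m y))) x‖ₑ ^ 2 ∂μ) +
          2 * ENNReal.ofReal ((- Real.log δ) * B) ^ 2 * μ univ := by
          rw [lintegral_add_right _ measurable_const, lintegral_const_mul' _ _ (by simp), lintegral_const]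
      _ ≤ _ := by
          rw [hμ, H.setLIntegral_density _ Metric.isClosed_closedBall.measurableSet]
          refine add_le_add (mul_le_mul' le_rfl (hCk k)) ?_
          refine mul_le_of_le_one_right' ?_
          rw [Measure.restrict_apply_univ]
          exact prob_le_one
  · refine (restrict_densityMeasure_ac m _).ae_le ?_
    filter_upwards [ae_tendsto_mollify hT.locallyIntegrable, ae_tendsto_mollify hT.locallyIntegrable_grad,
      H.ae_grad_eq] with x h1 h2 h3
    simp_rw [hgrad, gradient_mollify_of_hasWeakGradient hT]
    have e : testField m Dm δ R hR x = stdBump R hR x • (truncInv δ (m x) • Dm x) +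
        truncLog δ (m x) • ∇ (stdBump R hR) x := by
      rw [testField, h3, smul_smul, smul_smul]
      congr 2
      ring
    rw [e]
    exact (h2.const_smul _).add (h1.smul_const _)

end

end FixedTime

/-! ### Terms of lower order -/

/-- `C` bounds the first and second derivatives of all the functions `stdBump`, up to scaling. -/
structure BumpBound (d : ℕ) (C : ℝ) : Prop where
  nonneg : 0 ≤ C
  gradient_le : ∀ (r : ℝ) (hr : 0 < r) (x : Eu d), ‖∇ (stdBump r hr) x‖ ≤ C / r
  hessian_le : ∀ (r : ℝ) (hr : 0 < r) (x : Eu d) (i j : Fin d),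
    |(∇ (fun y => (∇ (stdBump r hr) y) i) x) j| ≤ C / r ^ 2

lemma exists_bumpBound (d : ℕ) : ∃ C, BumpBound d C := by
  obtain ⟨C₁, h₁, h₁'⟩ := exists_bound_gradient_stdBump d
  obtain ⟨C₂, h₂, h₂'⟩ := exists_bound_hessian_stdBump d
  refine ⟨C₁ + C₂, by positivity, fun r hr x => (h₁' r hr x).trans ?_, fun r hr x i j => (h₂' r hr x i j).trans ?_⟩
  · gcongr; linarith
  · gcongr; linarith

namespace FixedTime

variable {d : ℕ} {K : ℝ≥0} {κ : ℝ} {A : Eu d → Matrix (Fin d) (Fin d) ℝ} {α : Eu d → Eu d}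
  {m : Eu d → ℝ≥0} {Dm D : Eu d → Eu d}

section
variable (H : FixedTime K κ A α m Dm D)
include H

lemma norm_drift_le (x : Eu d) : ‖α x‖ ≤ K * (1 + ‖x‖) := by
  have h1 := H.lipschitz.dist_le_mul x 0
  rw [dist_eq_norm, dist_zero_right] at h1
  have h2 := H.bound_zero
  have h3 := norm_le_norm_add_norm_sub' (α x) (α 0)
  linarith

/-- A bound on an integral against Lebesgue measure, when the integrand is dominated by `m g`. -/
lemma integral_le_integral_density {F g : Eu d → ℝ} (hF : ∀ x, 0 ≤ F x) (hFg : ∀ x, F x ≤ m x * g x)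
    (hg : Integrable g (densityMeasure m)) : ∫ x, F x ≤ ∫ x, g x ∂(densityMeasure m) := by
  rw [H.integral_density]
  refine integral_mono_of_nonneg (ae_of_all _ hF) ?_ (ae_of_all _ hFg)
  exact (integrable_withDensity_iff_integrable_smul₀ H.aemeasurable_density).1 hg

variable {δ : ℝ} (hδ : 0 < δ) (hδ1 : δ < 1)
include hδ hδ1

/-- The drift term: integration by parts moves the derivative from `m` to the Lipschitz field `α`. -/
lemma abs_integral_weight_mul_inner_drift_le {C : ℝ} (hC : BumpBound d C) {R : ℝ} (hR : 1 ≤ R) :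
    |∫ x, stdBump R (one_pos.trans_le hR) x * (m x * truncInv δ (m x)) * (inner ℝ (score m Dm x) (α x) : ℝ)
      ∂(densityMeasure m).restrict (Metric.closedBall 0 (2 * R))| ≤
    d * K + 3 * C * K * (densityMeasure m).real {x | R ≤ ‖x‖} := by
  have hprob := H.isProbabilityMeasure
  set hR0 := one_pos.trans_le hR
  have hτc : ContinuousOn (fun u => u * truncInv δ u) (Ici 0) := continuousOn_id.mul (continuousOn_truncInv hδ)
  have hτ1 : ∀ u, 0 ≤ u → |u * truncInv δ u| ≤ 1 := fun u hu => by
    rw [abs_of_nonneg (mul_nonneg hu (truncInv_nonneg hδ hδ1 hu))]; exact mul_truncInv_le hδ hδ1 hu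
  -- `Q (m)` has weak gradient `m truncInv δ m • Dm` and is at most `m`
  obtain ⟨Q, hQ, hQ1⟩ := exists_antiderivative hτc hτ1
  have hw := H.weakGradient.comp_nonneg (fun x => (m x).2) hQ hτc hτ1
  have hφ : ContDiff ℝ 1 (stdBump (d := d) R hR0) := (stdBump R hR0).contDiff (n := 1)
  have hb := hw.abs_integral_mul_inner_le H.lipschitz hφ (stdBump R hR0).hasCompactSupport
  rw [H.setIntegral_density _ fun x hx => by
    rw [stdBump_eq_zero hR0 (by simpa using hx)]; simp]
  have e : ∫ x, (m x : ℝ) * (stdBump R hR0 x * (m x * truncInv δ (m x)) * (inner ℝ (score m Dm x) (α x) : ℝ)) =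
      ∫ x, stdBump R hR0 x * (inner ℝ (α x) (((m x : ℝ) * truncInv δ (m x)) • Dm x) : ℝ) := by
    refine integral_congr_ae ?_
    filter_upwards [H.ae_grad_eq] with x hx
    have e2 : (inner ℝ (α x) (((m x : ℝ) * truncInv δ (m x)) • Dm x) : ℝ) =
        (m x : ℝ) * truncInv δ (m x) * (m x * inner ℝ (score m Dm x) (α x)) := by
      rw [hx, real_inner_smul_right, real_inner_smul_right, real_inner_comm]
    rw [e2]; ring
  rw [e]
  refine hb.trans ?_
  have hS : MeasurableSet {x : Eu d | R ≤ ‖x‖} := measurableSet_le measurable_const measurable_norm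
  have hind : Integrable ({x : Eu d | R ≤ ‖x‖}.indicator fun _ => 3 * C) (densityMeasure m) :=
    (integrable_const _).indicator hS
  refine (H.integral_le_integral_density (g := fun x => d * K + K * {x : Eu d | R ≤ ‖x‖}.indicator (fun _ => 3 * C) x)
    (fun x => by positivity) (fun x => ?_) ((integrable_const _).add (hind.const_mul _))).trans ?_
  · have h1 : |Q (m x)| ≤ m x := (hQ1 _ (m x).2).trans_eq (one_mul _)
    have h2 : |stdBump R hR0 x| ≤ 1 := by
      rw [abs_of_nonneg ((stdBump R hR0).nonneg' x)]; exact (stdBump R hR0).le_one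
    have h3 := norm_gradient_stdBump_mul_le hC.nonneg hC.gradient_le hR x
    refine mul_le_mul h1 (add_le_add (mul_le_of_le_one_left (by positivity) h2) ?_) (by positivity) (m x).2
    calc _ ≤ ‖∇ (stdBump R hR0) x‖ * (K * (1 + ‖x‖)) := by gcongr; exact H.norm_drift_le x
      _ = K * (‖∇ (stdBump R hR0) x‖ * (1 + ‖x‖)) := by ring
      _ ≤ _ := by gcongr
  · rw [integral_add (integrable_const _) (hind.const_mul _), integral_const, integral_const_mul,
      integral_indicator_const _ hS]
    simp only [ probReal_univ, smul_eq_mul, one_mul]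
    refine le_of_eq ?_
    ring

/-- The diffusion term from the gradient of the cutoff: integration by parts produces the second
derivatives of the cutoff, which are small at large scales. -/
lemma abs_integral_truncLog_mul_inner_le {C : ℝ} (hC : BumpBound d C) {R : ℝ} (hR : 1 ≤ R) :
    |∫ x, truncLog δ (m x) * (inner ℝ (∇ (stdBump R (one_pos.trans_le hR)) x)
        (matVec (A x) (score m Dm x)) : ℝ) ∂(densityMeasure m).restrict (Metric.closedBall 0 (2 * R))| ≤
      - Real.log δ * (2 * d ^ 2 * K * C / R) := by
  have hprob := H.isProbabilityMeasure
  set hR0 := one_pos.trans_le hR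
  set M := - Real.log δ with hM
  have hM0 : 0 ≤ M := by have := Real.log_neg hδ hδ1; linarith
  have hC0 := hC.nonneg
  have hTc := continuousOn_of_hasDerivAt_nonneg (fun u hu => hasDerivAt_truncLog hδ (u := u) hu)
  have hT1 : ∀ u, 0 ≤ u → |truncLog δ u| ≤ M := fun u hu => abs_truncLog_le hδ hδ1 hu
  -- `P (m)` has weak gradient `truncLog δ m • Dm` and is at most `M m`
  obtain ⟨P, hP, hP1⟩ := exists_antiderivative hTc hT1
  have hw := H.weakGradient.comp_nonneg (fun x => (m x).2) hP hTc hT1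
  have hφ2 : ContDiff ℝ 2 (stdBump (d := d) R hR0) := (stdBump R hR0).contDiff (n := 2)
  have hφi : ∀ i, ContDiff ℝ 1 (fun x => (∇ (stdBump R hR0) x) i) := contDiff_gradient_coord hφ2
  -- the transpose of `A x` moves from the score to the gradient of the cutoff
  set V : Eu d → Eu d := fun x => matVec (A x)ᵀ (∇ (stdBump R hR0) x) with hVdef
  have hVi : ∀ j, (fun x => V x j) = fun x => ∑ i, A x i j * (∇ (stdBump R hR0) x) i := fun j => rfl
  have hV : ∀ j, ContDiff ℝ 1 (fun x => V x j) := fun j => by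
    rw [hVi]; exact ContDiff.sum fun i _ => (H.contDiff i j).mul (hφi i)
  have hVc : HasCompactSupport V := by
    refine (hasCompactSupport_gradient (stdBump (d := d) R hR0).hasCompactSupport).mono fun x hx h0 => hx ?_
    simp only [V]; rw [h0]
    ext i; simp [matVec]
  have hdiv : ∀ x, |divergence V x| ≤ 2 * d ^ 2 * K * C / R := by
    intro x
    have hj : ∀ j, |(∇ (fun y => V y j) x) j| ≤ ∑ _i : Fin d, 2 * K * C / R := fun j => by
      have e : (∇ (fun y => V y j) x) j = ∑ i, (A x i j * (∇ (fun y => (∇ (stdBump R hR0) y) i) x) j +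
          (∇ (stdBump R hR0) x) i * (∇ (fun y => A y i j) x) j) := by
        rw [hVi, gradient_coord, fderiv_fun_sum fun i _ =>
          ((H.contDiff i j).mul (hφi i)).differentiable one_ne_zero x, sum_apply]
        refine Finset.sum_congr rfl fun i _ => ?_
        rw [← gradient_coord, gradient_mul_apply ((H.contDiff i j).differentiable one_ne_zero x)
          ((hφi i).differentiable one_ne_zero x)]
        simp
      rw [e]
      refine (Finset.abs_sum_le_sum_abs _ _).trans (Finset.sum_le_sum fun i _ => ?_)
      have h1 : |(∇ (fun y => (∇ (stdBump R hR0) y) i) x) j| ≤ C / R := by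
        refine (hC.hessian_le R hR0 x i j).trans ?_
        gcongr
        nlinarith
      have h2 : |(∇ (stdBump R hR0) x) i| ≤ C / R := (PiLp.norm_apply_le _ i).trans (hC.gradient_le R hR0 x)
      have h3 : |(∇ (fun y => A y i j) x) j| ≤ K := (PiLp.norm_apply_le _ j).trans (H.bound_gradient x i j)
      refine (abs_add_le _ _).trans ?_
      rw [abs_mul, abs_mul]
      calc _ ≤ K * (C / R) + C / R * K := by
            gcongr
            · exact H.bound x i j
        _ = _ := by ring
    refine (Finset.abs_sum_le_sum_abs _ _).trans ((Finset.sum_le_sum fun j _ => hj j).trans_eq ?_)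
    simp; ring
  rw [H.setIntegral_density _ fun x hx => by
    rw [gradient_stdBump_eq_zero_of_gt hR0 (by simpa using hx)]; simp]
  have e : ∫ x, (m x : ℝ) * (truncLog δ (m x) * (inner ℝ (∇ (stdBump R hR0) x)
        (matVec (A x) (score m Dm x)) : ℝ)) = ∫ x, (inner ℝ (V x) (truncLog δ (m x) • Dm x) : ℝ) := by
    refine integral_congr_ae ?_
    filter_upwards [H.ae_grad_eq] with x hx
    have e1 : (inner ℝ (∇ (stdBump R hR0) x) (matVec (A x) (score m Dm x)) : ℝ) =
        inner ℝ (V x) (score m Dm x) := by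
      rw [real_inner_eq_sum, real_inner_eq_sum]
      simp only [V, matVec, Matrix.transpose_apply, Finset.mul_sum, Finset.sum_mul]
      rw [Finset.sum_comm]
      exact Finset.sum_congr rfl fun i _ => Finset.sum_congr rfl fun j _ => by ring
    have e2 : (inner ℝ (V x) (truncLog δ (m x) • Dm x) : ℝ) =
        truncLog δ (m x) * (m x * inner ℝ (V x) (score m Dm x)) := by
      rw [hx, real_inner_smul_right, real_inner_smul_right]
    rw [e1, e2]; ring
  rw [e, hw.integral_inner_eq hV hVc, abs_neg]
  refine abs_integral_le_integral_abs.trans ((H.integral_le_integral_density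
    (g := fun _ => M * (2 * d ^ 2 * K * C / R)) (fun x => abs_nonneg _) (fun x => ?_) (integrable_const _)).trans_eq (by simp))
  rw [abs_mul]
  calc _ ≤ (M * m x) * (2 * d ^ 2 * K * C / R) :=
        mul_le_mul (hP1 _ (m x).2) (hdiv x) (abs_nonneg _) (mul_nonneg hM0 (m x).2)
    _ = _ := by ring

end

end FixedTime

/-! ### The Fisher information at a fixed time -/

namespace FixedTime

variable {d : ℕ} {K : ℝ≥0} {κ : ℝ} {A : Eu d → Matrix (Fin d) (Fin d) ℝ} {α : Eu d → Eu d}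
  {m : Eu d → ℝ≥0} {Dm D : Eu d → Eu d}

section
variable (H : FixedTime K κ A α m Dm D) (hκ : 0 < κ)
include H hκ

/-- Ellipticity bounds the pairing of `testField` and `rateField` from below by the weighted square of
the score, up to a constant and terms to be integrated by parts or made small by the cutoff. -/
lemma le_inner_testField_rateField {δ : ℝ} (hδ : 0 < δ) (hδ1 : δ < 1) {C : ℝ} (hC : BumpBound d C) {R : ℝ}
    (hR : 1 ≤ R) (x : Eu d) :
    κ / 4 * (stdBump R (one_pos.trans_le hR) x * (m x * truncInv δ (m x)) * ‖score m Dm x‖ ^ 2) -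
      stdBump R (one_pos.trans_le hR) x * (m x * truncInv δ (m x)) * (inner ℝ (score m Dm x) (α x) : ℝ) +
      1 / 2 * (truncLog δ (m x) * (inner ℝ (∇ (stdBump R (one_pos.trans_le hR)) x)
        (matVec (A x) (score m Dm x)) : ℝ)) ≤
    (inner ℝ (testField m Dm δ R (one_pos.trans_le hR) x) (rateField A α m Dm x) : ℝ) +
      ((d ^ 2 * K) ^ 2 / (4 * κ) + - Real.log δ * (d ^ 2 * K / 2 + K) *
        {x : Eu d | R ≤ ‖x‖}.indicator (fun _ => 3 * C) x) := by
  have hR0 := one_pos.trans_le hR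
  obtain ⟨hw0, hw1⟩ := weight_mem m hδ hδ1 R hR0 x
  set w := stdBump R hR0 x * (m x * truncInv δ (m x)) with hw
  set q := score m Dm x
  set g := ∇ (stdBump R hR0) x
  set T := truncLog δ (m x)
  set L : ℝ := d ^ 2 * K with hL
  set ι := {x : Eu d | R ≤ ‖x‖}.indicator (fun _ => 3 * C) x
  set M := - Real.log δ with hM
  have hL0 : 0 ≤ L := by positivity
  have hM0 : 0 ≤ M := by have := Real.log_neg hδ hδ1; linarith
  have e : (inner ℝ (testField m Dm δ R hR0 x) (rateField A α m Dm x) : ℝ) =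
      1 / 2 * (w * inner ℝ q (rowDivergence A x)) + 1 / 2 * (w * inner ℝ q (matVec (A x) q)) -
        w * inner ℝ q (α x) + T * (inner ℝ g ((1 / 2 : ℝ) • rowDivergence A x - α x)) +
        1 / 2 * (T * inner ℝ g (matVec (A x) q)) := by
    simp only [testField, rateField, inner_add_left, inner_add_right, inner_sub_right, real_inner_smul_left,
      real_inner_smul_right]
    ring
  have h1 : κ * ‖q‖ ^ 2 ≤ inner ℝ q (matVec (A x) q) := by
    rw [inner_matVec_self]; exact H.elliptic x q
  have h2 : - (L * ‖q‖) ≤ inner ℝ q (rowDivergence A x) := by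
    have := abs_real_inner_le_norm q (rowDivergence A x)
    have h3 : ‖q‖ * ‖rowDivergence A x‖ ≤ ‖q‖ * L := by gcongr; exact H.norm_rowDivergence_le x
    linarith [neg_abs_le (inner ℝ q (rowDivergence A x))]
  have h4 : L * ‖q‖ / 2 ≤ κ / 4 * ‖q‖ ^ 2 + L ^ 2 / (4 * κ) := by
    have : κ / 4 * ‖q‖ ^ 2 + L ^ 2 / (4 * κ) - L * ‖q‖ / 2 = (κ * ‖q‖ - L) ^ 2 / (4 * κ) := by
      field_simp; ring
    have h5 : 0 ≤ (κ * ‖q‖ - L) ^ 2 / (4 * κ) := by positivity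
    linarith
  have h6 : - (M * (L / 2 + K) * ι) ≤ T * inner ℝ g ((1 / 2 : ℝ) • rowDivergence A x - α x) := by
    have hT : |T| ≤ M := abs_truncLog_le hδ hδ1 (m x).2
    have h7 : ‖(1 / 2 : ℝ) • rowDivergence A x - α x‖ ≤ (L / 2 + K) * (1 + ‖x‖) := by
      refine (norm_sub_le _ _).trans ?_
      rw [norm_smul]
      have h8 := H.norm_rowDivergence_le x
      have h9 := H.norm_drift_le x
      have : 0 ≤ L / 2 * ‖x‖ := by positivity
      norm_num
      linarith
    have h8 : |T * inner ℝ g ((1 / 2 : ℝ) • rowDivergence A x - α x)| ≤ M * (L / 2 + K) * ι := by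
      rw [abs_mul]
      calc _ ≤ M * (‖g‖ * ((L / 2 + K) * (1 + ‖x‖))) := by
            refine mul_le_mul hT ((abs_real_inner_le_norm _ _).trans ?_) (abs_nonneg _) hM0
            gcongr
        _ = M * (L / 2 + K) * (‖g‖ * (1 + ‖x‖)) := by ring
        _ ≤ _ := by
            gcongr
            exact norm_gradient_stdBump_mul_le hC.nonneg hC.gradient_le hR x
    exact (abs_le.1 h8).1
  have h10 : - (w * (κ / 4 * ‖q‖ ^ 2)) - L ^ 2 / (4 * κ) ≤ 1 / 2 * (w * inner ℝ q (rowDivergence A x)) := by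
    have h11 := mul_le_mul_of_nonneg_left h2 hw0
    have h12 := mul_le_mul_of_nonneg_left h4 hw0
    have h13 : w * (L ^ 2 / (4 * κ)) ≤ L ^ 2 / (4 * κ) := mul_le_of_le_one_left (by positivity) hw1
    linarith
  have h14 := mul_le_mul_of_nonneg_left h1 hw0
  rw [e]
  linarith

variable {δ : ℝ} (hδ : 0 < δ) (hδ1 : δ < 1)
include hδ hδ1

omit hκ in
lemma integrable_weight_mul_score (R : ℝ) (hR : 0 < R) (r : ℝ) :
    Integrable (fun x => stdBump R hR x * (m x * truncInv δ (m x)) * ‖score m Dm x‖ ^ 2)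
      ((densityMeasure m).restrict (Metric.closedBall 0 r)) := by
  have := integrable_inner_of_memLp_two (H.memLp_weight_smul_score hδ hδ1 R r hR) (H.memLp_score r)
  simpa only [real_inner_smul_left, real_inner_self_eq_norm_sq] using this

lemma le_integral_inner_testField_rateField {C : ℝ} (hC : BumpBound d C) {R : ℝ} (hR : 1 ≤ R) :
    κ / 4 * (∫ x, stdBump R (one_pos.trans_le hR) x * (m x * truncInv δ (m x)) * ‖score m Dm x‖ ^ 2
        ∂(densityMeasure m).restrict (Metric.closedBall 0 (2 * R))) -
      (d * K + 3 * C * K * (densityMeasure m).real {x | R ≤ ‖x‖}) -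
      1 / 2 * (- Real.log δ * (2 * d ^ 2 * K * C / R)) ≤
    (∫ x, (inner ℝ (testField m Dm δ R (one_pos.trans_le hR) x) (rateField A α m Dm x) : ℝ)
        ∂(densityMeasure m).restrict (Metric.closedBall 0 (2 * R))) +
      ((d ^ 2 * K) ^ 2 / (4 * κ) + - Real.log δ * (d ^ 2 * K / 2 + K) *
        (3 * C * (densityMeasure m).real {x | R ≤ ‖x‖})) := by
  have hprob := H.isProbabilityMeasure
  have hR0 := one_pos.trans_le hR
  have hC0 := hC.nonneg
  have hM0 : 0 ≤ - Real.log δ := by have := Real.log_neg hδ hδ1; linarith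
  set μ := (densityMeasure m).restrict (Metric.closedBall 0 (2 * R)) with hμ
  have hS : MeasurableSet {x : Eu d | R ≤ ‖x‖} := measurableSet_le measurable_const measurable_norm
  have hind : Integrable ({x : Eu d | R ≤ ‖x‖}.indicator fun _ => 3 * C) (densityMeasure m) :=
    (integrable_const _).indicator hS
  have hE : Integrable (fun x => (d ^ 2 * K) ^ 2 / (4 * κ) + - Real.log δ * (d ^ 2 * K / 2 + K) *
        {x : Eu d | R ≤ ‖x‖}.indicator (fun _ => 3 * C) x) (densityMeasure m) :=
    (integrable_const _).add (hind.const_mul _)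
  have hEb : ∫ x, ((d ^ 2 * K) ^ 2 / (4 * κ) + - Real.log δ * (d ^ 2 * K / 2 + K) *
        {x : Eu d | R ≤ ‖x‖}.indicator (fun _ => 3 * C) x) ∂μ ≤
      (d ^ 2 * K) ^ 2 / (4 * κ) + - Real.log δ * (d ^ 2 * K / 2 + K) *
        (3 * C * (densityMeasure m).real {x | R ≤ ‖x‖}) := by
    refine (setIntegral_le_integral hE (ae_of_all _ fun x => ?_)).trans_eq ?_
    · have : 0 ≤ {x : Eu d | R ≤ ‖x‖}.indicator (fun _ => 3 * C) x :=
        indicator_nonneg (fun _ _ => by positivity) x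
      simp only [Pi.zero_apply]
      positivity
    · rw [integral_add (integrable_const _) (hind.const_mul _), integral_const, integral_const_mul,
        integral_indicator_const _ hS]
      simp only [probReal_univ, smul_eq_mul, one_mul]
      ring
  have hJ := H.integrable_weight_mul_score hδ hδ1 R hR0 (2 * R)
  have hα : Integrable (fun x => stdBump R hR0 x * (m x * truncInv δ (m x)) *
      (inner ℝ (score m Dm x) (α x) : ℝ)) μ := by
    have := integrable_inner_of_memLp_two (H.memLp_weight_smul_score hδ hδ1 R (2 * R) hR0)
      (H.memLp_of_continuous H.lipschitz.continuous (2 * R))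
    simpa only [real_inner_smul_left] using this
  have hG : Integrable (fun x => truncLog δ (m x) * (inner ℝ (∇ (stdBump R hR0) x)
        (matVec (A x) (score m Dm x)) : ℝ)) μ := by
    have := integrable_inner_of_memLp_two (H.memLp_truncLog_smul_gradient hδ hδ1 R (2 * R) hR0)
      (H.memLp_matVec_score (2 * R))
    simpa only [real_inner_smul_left] using this
  have hI : Integrable (fun x => (inner ℝ (testField m Dm δ R hR0 x) (rateField A α m Dm x) : ℝ)) μ :=
    integrable_inner_of_memLp_two (H.memLp_testField hδ hδ1 R (2 * R) hR0) (H.memLp_rateField (2 * R))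
  have key := integral_mono (((hJ.const_mul (κ / 4)).sub hα).add (hG.const_mul (1 / 2)))
    (hI.add hE.restrict) fun x => H.le_inner_testField_rateField hκ hδ hδ1 hC hR x
  rw [integral_add' ((hJ.const_mul (κ / 4)).sub hα) (hG.const_mul (1 / 2)),
    integral_sub' (hJ.const_mul (κ / 4)) hα, integral_add' hI hE.restrict, integral_const_mul,
    integral_const_mul] at key
  have b1 := (abs_le.1 (H.abs_integral_weight_mul_inner_drift_le hδ hδ1 hC hR)).2
  have b2 := (abs_le.1 (H.abs_integral_truncLog_mul_inner_le hδ hδ1 hC hR)).1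
  linarith

omit hκ in
lemma integral_norm_testField_sq_le {C : ℝ} (hC : BumpBound d C) {R : ℝ} (hR : 0 < R) :
    ∫ x, ‖testField m Dm δ R hR x‖ ^ 2 ∂(densityMeasure m).restrict (Metric.closedBall 0 (2 * R)) ≤
    2 * (∫ x, stdBump R hR x * (m x * truncInv δ (m x)) * ‖score m Dm x‖ ^ 2
        ∂(densityMeasure m).restrict (Metric.closedBall 0 (2 * R))) +
      2 * (- Real.log δ * (C / R)) ^ 2 := by
  have hprob := H.isProbabilityMeasure
  have hM0 : 0 ≤ - Real.log δ := by have := Real.log_neg hδ hδ1; linarith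
  set μ := (densityMeasure m).restrict (Metric.closedBall 0 (2 * R)) with hμ
  have hJ := H.integrable_weight_mul_score hδ hδ1 R hR (2 * R)
  have hW : Integrable (fun x => ‖testField m Dm δ R hR x‖ ^ 2) μ := by
    have := integrable_inner_of_memLp_two (H.memLp_testField hδ hδ1 R (2 * R) hR)
      (H.memLp_testField hδ hδ1 R (2 * R) hR)
    simpa only [real_inner_self_eq_norm_sq] using this
  have key := integral_mono hW ((hJ.const_mul 2).add
    (integrable_const (2 * (- Real.log δ * (C / R)) ^ 2))) fun x => by
      obtain ⟨hw0, hw1⟩ := weight_mem m hδ hδ1 R hR x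
      refine (norm_add_sq_le _ _).trans (add_le_add ?_ ?_)
      · rw [norm_smul, Real.norm_of_nonneg hw0, mul_pow]
        have : (stdBump R hR x * (m x * truncInv δ (m x))) ^ 2 ≤ stdBump R hR x * (m x * truncInv δ (m x)) := by
          rw [sq]; exact mul_le_of_le_one_left hw0 hw1
        exact mul_le_mul_of_nonneg_left (mul_le_mul_of_nonneg_right this (sq_nonneg _)) zero_le_two
      · have : ‖truncLog δ (m x) • ∇ (stdBump R hR) x‖ ≤ - Real.log δ * (C / R) := by
          rw [norm_smul]
          exact mul_le_mul (abs_truncLog_le hδ hδ1 (m x).2) (hC.gradient_le R hR x) (norm_nonneg _) hM0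
        exact mul_le_mul_of_nonneg_left (pow_le_pow_left₀ (norm_nonneg _) this 2) zero_le_two
  rw [integral_add' (hJ.const_mul 2) (integrable_const _), integral_const_mul, integral_const] at key
  have : μ.real univ • (2 * (- Real.log δ * (C / R)) ^ 2) ≤ 2 * (- Real.log δ * (C / R)) ^ 2 := by
    rw [smul_eq_mul]
    refine mul_le_of_le_one_left (by positivity) ?_
    rw [hμ, measureReal_restrict_apply_univ]
    exact measureReal_le_one
  linarith

/-- The estimate at a fixed level of truncation and a fixed scale of the cutoff. The multiple
`c = κ / (16 Λ)` of the test field, with `Λ = (d² K + 1) / 2`, makes the quadratic term half as large as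
the term from ellipticity. -/
lemma integral_weight_mul_score_le (hfin : fastRate A α m D ≠ ∞) {C : ℝ} (hC : BumpBound d C) {R : ℝ}
    (hR : 1 ≤ R) :
    κ / 8 * (∫ x, stdBump R (one_pos.trans_le hR) x * (m x * truncInv δ (m x)) * ‖score m Dm x‖ ^ 2
        ∂(densityMeasure m).restrict (Metric.closedBall 0 (2 * R))) ≤
      8 * (d ^ 2 * K + 1) / κ * (fastRate A α m D).toReal + ((d ^ 2 * K) ^ 2 / (4 * κ) + d * K) +
      ((3 * C * K + - Real.log δ * (d ^ 2 * K / 2 + K) * (3 * C)) * (densityMeasure m).real {x | R ≤ ‖x‖} +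
        - Real.log δ * (d ^ 2 * K * C) * R⁻¹ + κ / 8 * (- Real.log δ * C) ^ 2 * (R⁻¹) ^ 2) := by
  have hR0 := one_pos.trans_le hR
  have h1 := H.le_integral_inner_testField_rateField hκ hδ hδ1 hC hR
  have h2 := H.integral_norm_testField_sq_le hδ hδ1 hC hR0
  have h3 := H.integral_testField_le hδ hδ1 hfin R hR0 (κ / (8 * (d ^ 2 * K + 1)))
  set J := ∫ x, stdBump R hR0 x * (m x * truncInv δ (m x)) * ‖score m Dm x‖ ^ 2
        ∂(densityMeasure m).restrict (Metric.closedBall 0 (2 * R))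
  set I := ∫ x, (inner ℝ (testField m Dm δ R hR0 x) (rateField A α m Dm x) : ℝ)
        ∂(densityMeasure m).restrict (Metric.closedBall 0 (2 * R))
  set S := ∫ x, ‖testField m Dm δ R hR0 x‖ ^ 2 ∂(densityMeasure m).restrict (Metric.closedBall 0 (2 * R))
  set r := (fastRate A α m D).toReal
  have hL : (0 : ℝ) < d ^ 2 * K + 1 := by positivity
  -- the variational bound, multiplied by `1 / c`
  have h4 : I - κ / 16 * S ≤ 8 * (d ^ 2 * K + 1) / κ * r := by
    have := mul_le_mul_of_nonneg_left h3 (a := 8 * (d ^ 2 * K + 1) / κ) (by positivity)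
    refine le_trans (le_of_eq ?_) this
    field_simp
    ring
  have h5 : κ / 16 * S ≤ κ / 16 * (2 * J + 2 * (- Real.log δ * (C / R)) ^ 2) := by gcongr
  have e1 : - Real.log δ * (2 * d ^ 2 * K * C / R) = 2 * (- Real.log δ * (d ^ 2 * K * C) * R⁻¹) := by
    rw [div_eq_mul_inv]; ring
  have e2 : (- Real.log δ * (C / R)) ^ 2 = (- Real.log δ * C) ^ 2 * (R⁻¹) ^ 2 := by
    rw [div_eq_mul_inv]; ring
  rw [e1] at h1
  rw [e2] at h5
  linarith

/-- At a fixed level of truncation, the errors vanish as the scale of the cutoff increases. -/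
lemma exists_lintegral_weight_mul_score_le (hfin : fastRate A α m D ≠ ∞) (n : ℕ) :
    ∃ R : ℝ, ∃ hR : 0 < R, (n : ℝ) < R ∧
      ∫⁻ x, ENNReal.ofReal (stdBump R hR x * (m x * truncInv δ (m x)) * ‖score m Dm x‖ ^ 2)
        ∂(densityMeasure m) ≤
      ENNReal.ofReal (8 / κ * (8 * (d ^ 2 * K + 1) / κ * (fastRate A α m D).toReal +
        ((d ^ 2 * K) ^ 2 / (4 * κ) + d * K) + 1)) := by
  have hprob := H.isProbabilityMeasure
  obtain ⟨C, hC⟩ := exists_bumpBound d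
  have hP : Tendsto (fun i : ℕ => (densityMeasure m).real {x | (i : ℝ) + 1 ≤ ‖x‖}) atTop (𝓝 0) := by
    have h := tendsto_measure_iInter_atTop (μ := densityMeasure m)
      (s := fun i : ℕ => {x : Eu d | (i : ℝ) + 1 ≤ ‖x‖})
      (fun i => (measurableSet_le measurable_const measurable_norm).nullMeasurableSet)
      (fun i j hij x (hx : (j : ℝ) + 1 ≤ ‖x‖) => by
        have : (i : ℝ) ≤ j := by exact_mod_cast hij
        exact (add_le_add this le_rfl).trans hx) ⟨0, measure_ne_top _ _⟩
    have h0 : ⋂ i : ℕ, {x : Eu d | (i : ℝ) + 1 ≤ ‖x‖} = ∅ := by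
      refine eq_empty_of_forall_notMem fun x hx => ?_
      obtain ⟨i, hi⟩ := exists_nat_ge ‖x‖
      have := mem_iInter.1 hx i
      exact absurd hi (not_le.2 ((lt_add_one _).trans_le this))
    rw [h0, measure_empty] at h
    exact (ENNReal.tendsto_toReal ENNReal.zero_ne_top).comp h
  have hinv : Tendsto (fun i : ℕ => ((i : ℝ) + 1)⁻¹) atTop (𝓝 0) := by
    simpa only [one_div] using tendsto_one_div_add_atTop_nhds_zero_nat (𝕜 := ℝ)
  have herr : Tendsto (fun i : ℕ => (3 * C * K + - Real.log δ * (d ^ 2 * K / 2 + K) * (3 * C)) *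
      (densityMeasure m).real {x | (i : ℝ) + 1 ≤ ‖x‖} + - Real.log δ * (d ^ 2 * K * C) * ((i : ℝ) + 1)⁻¹ +
      κ / 8 * (- Real.log δ * C) ^ 2 * (((i : ℝ) + 1)⁻¹) ^ 2) atTop (𝓝 0) := by
    have := ((hP.const_mul (3 * C * K + - Real.log δ * (d ^ 2 * K / 2 + K) * (3 * C))).add
      (hinv.const_mul (- Real.log δ * (d ^ 2 * K * C)))).add
      ((hinv.pow 2).const_mul (κ / 8 * (- Real.log δ * C) ^ 2))
    simpa only [mul_zero, add_zero, zero_pow two_ne_zero] using this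
  obtain ⟨i, hi, hni⟩ := ((herr.eventually (eventually_lt_nhds one_pos)).and (eventually_ge_atTop n)).exists
  have hi1 : (1 : ℝ) ≤ i + 1 := by linarith [i.cast_nonneg (α := ℝ)]
  have hR0 := one_pos.trans_le hi1
  have hni' : (n : ℝ) ≤ i := by exact_mod_cast hni
  refine ⟨i + 1, hR0, by linarith, ?_⟩
  have hb := H.integral_weight_mul_score_le hκ hδ hδ1 hfin hC hi1
  have hle : ∫ x, stdBump ((i : ℝ) + 1) hR0 x * (m x * truncInv δ (m x)) * ‖score m Dm x‖ ^ 2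
        ∂(densityMeasure m).restrict (Metric.closedBall 0 (2 * ((i : ℝ) + 1))) ≤
      8 / κ * (8 * (d ^ 2 * K + 1) / κ * (fastRate A α m D).toReal +
        ((d ^ 2 * K) ^ 2 / (4 * κ) + d * K) + 1) := by
    refine le_trans (le_of_eq ?_) (mul_le_mul_of_nonneg_left (hb.trans (add_le_add le_rfl hi.le))
      (a := 8 / κ) (by positivity))
    field_simp
  refine le_trans (le_of_eq ?_) (ENNReal.ofReal_le_ofReal hle)
  rw [ofReal_integral_eq_lintegral_ofReal (H.integrable_weight_mul_score hδ hδ1 _ hR0 _)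
    (ae_of_all _ fun x => mul_nonneg (weight_mem m hδ hδ1 _ hR0 x).1 (by positivity)),
    setLIntegral_eq_of_support_subset]
  intro x hx
  by_contra h
  exact hx (by simp [stdBump_eq_zero hR0 (show 2 * ((i : ℝ) + 1) < ‖x‖ by simpa using h)])

end

/-- The bound on the Fisher information at a fixed time: as the truncation and the cutoff are removed,
the weight in `exists_lintegral_weight_mul_score_le` tends to `1` wherever the density is positive, and
Fatou's lemma applies. -/
theorem lintegral_fisherDensity_le (H : FixedTime K κ A α m Dm D) (hκ : 0 < κ) :
    ∫⁻ x, fisherDensity m Dm x ≤ ENNReal.ofReal (64 * (d ^ 2 * K + 1) / κ ^ 2) * fastRate A α m D +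
      ENNReal.ofReal (8 / κ * ((d ^ 2 * K) ^ 2 / (4 * κ) + d * K + 1)) := by
  have hprob := H.isProbabilityMeasure
  by_cases hfin : fastRate A α m D = ∞
  · rw [hfin, ENNReal.mul_top (by simp only [ne_eq, ENNReal.ofReal_eq_zero, not_le]; positivity)]
    simp
  set δ : ℕ → ℝ := fun n => 1 / ((n : ℝ) + 2) with hδdef
  have hδ : ∀ n, 0 < δ n := fun n => by positivity
  have hδ1 : ∀ n, δ n < 1 := fun n => by
    rw [hδdef]; simp only; rw [div_lt_one (by positivity)]; linarith [n.cast_nonneg (α := ℝ)]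
  have hδ0 : Tendsto δ atTop (𝓝 0) := by
    have := (tendsto_one_div_add_atTop_nhds_zero_nat (𝕜 := ℝ)).comp (tendsto_add_atTop_nat 1)
    refine this.congr fun n => ?_
    simp only [Function.comp, hδdef]; push_cast; ring
  choose R hR hnR hb using fun n : ℕ => H.exists_lintegral_weight_mul_score_le hκ (hδ n) (hδ1 n) hfin n
  have e1 : ∫⁻ x, fisherDensity m Dm x = ∫⁻ x, ‖score m Dm x‖ₑ ^ 2 ∂(densityMeasure m) := by
    have := H.setLIntegral_density (fun x => ‖score m Dm x‖ₑ ^ 2) MeasurableSet.univ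
    simp only [Measure.restrict_univ] at this
    rw [this]
    exact lintegral_congr_ae H.ae_fisher_eq
  have hlim : ∀ᵐ x ∂(densityMeasure m), Tendsto (fun n => ENNReal.ofReal (stdBump (R n) (hR n) x *
      (m x * truncInv (δ n) (m x)) * ‖score m Dm x‖ ^ 2)) atTop (𝓝 (‖score m Dm x‖ₑ ^ 2)) := by
    rw [densityMeasure, ae_withDensity_iff' H.aemeasurable_density.coe_nnreal_ennreal]
    refine ae_of_all _ fun x hx => ?_
    have hm : (0 : ℝ) < m x := by
      have : m x ≠ 0 := by simpa using hx
      exact_mod_cast this.bot_lt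
    rw [← ofReal_norm, ← ENNReal.ofReal_pow (norm_nonneg _)]
    refine ENNReal.tendsto_ofReal ?_
    have h1 : Tendsto (fun n => stdBump (R n) (hR n) x) atTop (𝓝 1) := by
      refine tendsto_const_nhds.congr' ?_
      obtain ⟨i, hi⟩ := exists_nat_ge ‖x‖
      filter_upwards [eventually_ge_atTop i] with n hn
      have : (i : ℝ) ≤ n := by exact_mod_cast hn
      exact (stdBump_eq_one (hR n) (by linarith [hnR n])).symm
    simpa using (h1.mul (tendsto_mul_truncInv hm hδ hδ0)).mul_const (‖score m Dm x‖ ^ 2)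
  calc ∫⁻ x, fisherDensity m Dm x = ∫⁻ x, liminf (fun n => ENNReal.ofReal (stdBump (R n) (hR n) x *
      (m x * truncInv (δ n) (m x)) * ‖score m Dm x‖ ^ 2)) atTop ∂(densityMeasure m) := by
        rw [e1]
        refine lintegral_congr_ae ?_
        filter_upwards [hlim] with x hx using hx.liminf_eq.symm
    _ ≤ liminf (fun n => ∫⁻ x, ENNReal.ofReal (stdBump (R n) (hR n) x *
      (m x * truncInv (δ n) (m x)) * ‖score m Dm x‖ ^ 2) ∂(densityMeasure m)) atTop := by
        refine lintegral_liminf_le' fun n => ?_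
        exact (((H.aestronglyMeasurable_weight (hδ n) (R n) (hR n)).mul
          (H.aestronglyMeasurable_score.norm.pow 2)).mono_ac (densityMeasure_ac m)).aemeasurable.ennreal_ofReal
    _ ≤ ENNReal.ofReal (8 / κ * (8 * (d ^ 2 * K + 1) / κ * (fastRate A α m D).toReal +
        ((d ^ 2 * K) ^ 2 / (4 * κ) + d * K) + 1)) :=
        (liminf_le_liminf (Eventually.of_forall hb)).trans_eq (liminf_const _)
    _ = _ := by
        nth_rewrite 2 [← ENNReal.ofReal_toReal hfin]
        rw [← ENNReal.ofReal_mul (by positivity), ← ENNReal.ofReal_add (by positivity) (by positivity)]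
        congr 1
        field_simp
        ring

end FixedTime

/-! ### Integration in time -/

lemma abs_diffusionMatrix_le {n k l : ℕ} {b : ℝ → Eu n → Eu l → Matrix (Fin l) (Fin k) ℝ} {s : ℝ} {u : Eu n}
    {x : Eu l} {C : ℝ} (h : ∀ i j, |b s u x i j| ≤ C) (i j : Fin l) :
    |diffusionMatrix b s u x i j| ≤ k * C ^ 2 := by
  rw [diffusionMatrix, Matrix.mul_apply]
  refine (Finset.abs_sum_le_sum_abs _ _).trans
    ((Finset.sum_le_card_nsmul _ _ (C ^ 2) fun q _ => ?_).trans_eq (by simp))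
  rw [abs_mul, Matrix.transpose_apply, sq]
  exact mul_le_mul (h i q) (h j q) (abs_nonneg _) ((abs_nonneg _).trans (h i q))

/-- At almost all times, the coefficients satisfy the bounds of `FixedTime` with common constants. -/
lemma RegularCoefficients.exists_bounds {n k l : ℕ} {a : ℝ → Eu n → Eu l → Eu l}
    {b : ℝ → Eu n → Eu l → Matrix (Fin l) (Fin k) ℝ} (hab : RegularCoefficients a b) (N t : ℝ) :
    ∃ (K : ℝ≥0) (κ : ℝ), 0 < κ ∧ ∀ᵐ s : ℝ, 0 ≤ s → s ≤ t → ∀ u : Eu n, ‖u‖ ≤ N →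
      (∀ x i j, |diffusionMatrix b s u x i j| ≤ K) ∧
      (∀ x i j, ‖∇ (fun y => diffusionMatrix b s u y i j) x‖ ≤ K) ∧
      (∀ x v, κ * ‖v‖ ^ 2 ≤ quadForm (diffusionMatrix b s u x) v) ∧
      LipschitzWith K (a s u) ∧ ‖a s u 0‖ ≤ K := by
  obtain ⟨K₁, h₁⟩ := hab.bounded_b t N
  obtain ⟨K₂, h₂⟩ := hab.deriv_c t N
  obtain ⟨K₃, h₃⟩ := hab.lipschitz_a t N
  obtain ⟨K₄, h₄⟩ := hab.bounded_a t N 0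
  obtain ⟨κ, hκ, h₅⟩ := hab.elliptic_c t N
  refine ⟨(k * K₁ ^ 2).toNNReal + K₂ + K₃ + K₄.toNNReal, κ, hκ, ?_⟩
  have p1 := Real.le_coe_toNNReal (k * K₁ ^ 2)
  have p4 := Real.le_coe_toNNReal K₄
  have q1 := (k * K₁ ^ 2).toNNReal.coe_nonneg
  have q2 := K₂.coe_nonneg
  have q3 := K₃.coe_nonneg
  have q4 := K₄.toNNReal.coe_nonneg
  filter_upwards [h₁, h₂, h₃, h₄, h₅] with s h₁ h₂ h₃ h₄ h₅ hs0 hst u hu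
  refine ⟨fun x i j => ?_, fun x i j => ?_, h₅ hs0 hst u hu, (h₃ hs0 hst u hu).weaken ?_, ?_⟩
  · refine (abs_diffusionMatrix_le (h₁ hs0 hst u hu x) i j).trans ?_
    push_cast; linarith
  · refine ((h₂ hs0 hst u hu i j).1 x).trans ?_
    push_cast; linarith
  · rw [← NNReal.coe_le_coe]; push_cast; linarith
  · refine (h₄ hs0 hst u hu 0 (by simp)).trans ?_
    push_cast; linarith

/-- Local finiteness of the space-time integral gives local finiteness in space at almost all times. -/
lemma ae_lintegral_closedBall_fisherDensity_lt_top {l : ℕ} {t : ℝ} {m : ℝ → Eu l → ℝ≥0} {Dm : ℝ → Eu l → Eu l}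
    (hm : AEMeasurable (fun p : ℝ × Eu l => m p.1 p.2) ((volume.restrict (Ici 0)).prod volume))
    (hDm : AEMeasurable (fun p : ℝ × Eu l => Dm p.1 p.2) ((volume.restrict (Ici 0)).prod volume))
    (hfin : ∀ (z : Eu l) (r : ℝ),
      ∫⁻ s in Icc 0 t, ∫⁻ x in Metric.ball z r, fisherDensity (m s) (Dm s) x < ∞) :
    ∀ᵐ s ∂(volume.restrict (Icc 0 t)), ∀ r : ℝ,
      ∫⁻ x in Metric.closedBall 0 r, fisherDensity (m s) (Dm s) x < ∞ := by
  have h : ∀ i : ℕ, ∀ᵐ s ∂(volume.restrict (Icc 0 t)),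
      ∫⁻ x in Metric.ball 0 i, fisherDensity (m s) (Dm s) x < ∞ := fun i => by
    refine ae_lt_top' ?_ (hfin 0 i).ne
    have hle : (volume.restrict (Icc 0 t)).prod (volume.restrict (Metric.ball (0 : Eu l) i)) ≤
        (volume.restrict (Ici (0 : ℝ))).prod volume := by
      have e : (volume.restrict (Ici (0 : ℝ))).prod (volume : Measure (Eu l)) =
          (volume.prod volume).restrict (Ici 0 ×ˢ univ) := by
        rw [← Measure.prod_restrict, Measure.restrict_univ]
      rw [e, Measure.prod_restrict]
      exact Measure.restrict_mono (Set.prod_mono Icc_subset_Ici_self (subset_univ _)) le_rfl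
    have hf : AEMeasurable (fun p : ℝ × Eu l => fisherDensity (m p.1) (Dm p.1) p.2)
        ((volume.restrict (Ici 0)).prod volume) :=
      (hDm.enorm.pow_const 2).div hm.coe_nnreal_ennreal
    exact (hf.mono_measure hle).lintegral_prod_right'
  filter_upwards [ae_all_iff.2 h] with s hs r
  obtain ⟨i, hi⟩ := exists_nat_gt r
  exact (lintegral_mono_set (Metric.closedBall_subset_ball hi)).trans_lt (hs i)

end FastDiffusion

theorem lemma6p6 {n k l : ℕ}
    (a : ℝ → FastDiffusion.Eu n → FastDiffusion.Eu l → FastDiffusion.Eu l)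
    (b : ℝ → FastDiffusion.Eu n → FastDiffusion.Eu l → Matrix (Fin l) (Fin k) ℝ)
    (hab : FastDiffusion.RegularCoefficients a b)
    (N t L₁ : ℝ) (ht : 0 < t) (hL₁ : 0 < L₁) :
    -- the constant depends only on `L₁`, `t`, the coefficients and a bound `N` on `|X|` over `[0,t]`
    ∃ L₂ : ℝ, 0 < L₂ ∧
      ∀ X : ℝ → FastDiffusion.Eu n, ContinuousOn X (Ici 0) → (∀ s ∈ Icc 0 t, ‖X s‖ ≤ N) →
      -- the densities `m_s(x)`, their weak gradients, and the weak divergences of `c_s(X_s,x) m_s(x)`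
      ∀ (m : ℝ → FastDiffusion.Eu l → ℝ≥0)
        (Dm divcm : ℝ → FastDiffusion.Eu l → FastDiffusion.Eu l),
      AEMeasurable (fun p : ℝ × FastDiffusion.Eu l => m p.1 p.2)
        ((volume.restrict (Ici 0)).prod volume) →
      AEMeasurable (fun p : ℝ × FastDiffusion.Eu l => Dm p.1 p.2)
        ((volume.restrict (Ici 0)).prod volume) →
      (∀ᵐ s : ℝ, 0 ≤ s → ∫⁻ x, (m s x : ℝ≥0∞) = 1) →
      (∀ᵐ s : ℝ, 0 ≤ s → FastDiffusion.HasWeakGradient (fun x => (m s x : ℝ)) (Dm s)) →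
      (∀ᵐ s : ℝ, 0 ≤ s → FastDiffusion.HasWeakDivergence
        (fun x => (m s x : ℝ) • FastDiffusion.diffusionMatrix b s (X s) x) (divcm s)) →
      -- local finiteness of the Fisher information
      (∀ (z : FastDiffusion.Eu l) (r : ℝ),
        ∫⁻ s in Icc 0 t, ∫⁻ x in Metric.ball z r, FastDiffusion.fisherDensity (m s) (Dm s) x < ∞) →
      -- the bound on the fast part of the rate function
      (∫⁻ s in Icc 0 t, FastDiffusion.fastRate (FastDiffusion.diffusionMatrix b s (X s))
        (a s (X s)) (m s) (divcm s) ≤ ENNReal.ofReal L₁) →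
      ∫⁻ s in Icc 0 t, ∫⁻ x, FastDiffusion.fisherDensity (m s) (Dm s) x ≤ ENNReal.ofReal L₂ := by
  obtain ⟨K, κ, hκ, hbd⟩ := hab.exists_bounds N t
  set C₁ : ℝ := 64 * (l ^ 2 * K + 1) / κ ^ 2 with hC₁
  set C₂ : ℝ := 8 / κ * ((l ^ 2 * K) ^ 2 / (4 * κ) + l * K + 1) with hC₂
  have h1 : 0 < C₁ := by positivity
  have h2 : 0 < C₂ := by positivity
  refine ⟨C₁ * L₁ + C₂ * t, by positivity, ?_⟩
  intro X _ hX m Dm divcm hm hDm hmass hgrad hdiv hfin hrate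
  have hpt : ∀ᵐ s ∂(volume.restrict (Icc 0 t)), ∫⁻ x, FastDiffusion.fisherDensity (m s) (Dm s) x ≤
      ENNReal.ofReal C₁ * FastDiffusion.fastRate (FastDiffusion.diffusionMatrix b s (X s))
        (a s (X s)) (m s) (divcm s) + ENNReal.ofReal C₂ := by
    filter_upwards [ae_restrict_of_ae hbd, ae_restrict_of_ae hmass, ae_restrict_of_ae hgrad,
      ae_restrict_of_ae hdiv, FastDiffusion.ae_lintegral_closedBall_fisherDensity_lt_top hm hDm hfin,
      ae_restrict_mem measurableSet_Icc] with s h₁ h₂ h₃ h₄ h₅ hs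
    obtain ⟨b1, b2, b3, b4, b5⟩ := h₁ hs.1 hs.2 (X s) (hX s hs)
    have H : FastDiffusion.FixedTime K κ (FastDiffusion.diffusionMatrix b s (X s)) (a s (X s)) (m s) (Dm s)
        (divcm s) :=
      ⟨hab.contDiff_c s hs.1 (X s), b1, b2, b3, b4, b5, h₂ hs.1, h₃ hs.1, h₄ hs.1, h₅⟩
    exact H.lintegral_fisherDensity_le hκ
  -- the rules for integrals used here do not need measurability of the rate in time
  calc _ ≤ ∫⁻ s in Icc 0 t, (ENNReal.ofReal C₁ *
          FastDiffusion.fastRate (FastDiffusion.diffusionMatrix b s (X s)) (a s (X s)) (m s) (divcm s) +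
          ENNReal.ofReal C₂) := lintegral_mono_ae hpt
    _ = ENNReal.ofReal C₁ * (∫⁻ s in Icc 0 t,
          FastDiffusion.fastRate (FastDiffusion.diffusionMatrix b s (X s)) (a s (X s)) (m s) (divcm s)) +
          ENNReal.ofReal C₂ * ENNReal.ofReal t := by
        rw [lintegral_add_right _ measurable_const, lintegral_const_mul' _ _ ENNReal.ofReal_ne_top,
          setLIntegral_const, Real.volume_Icc, sub_zero]
    _ ≤ ENNReal.ofReal C₁ * ENNReal.ofReal L₁ + ENNReal.ofReal C₂ * ENNReal.ofReal t := by gcongr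
    _ = _ := by
        rw [← ENNReal.ofReal_mul h1.le, ← ENNReal.ofReal_mul h2.le,
          ← ENNReal.ofReal_add (by positivity) (by positivity)]
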